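/- Fix a model $\mathcal M$ of $\mathsf{ACA}_0^\omega=\mathsf{RCA}_0^\omega+(\exists^2)$, i.e. a (Henkin) model of Kohlenbach's base theory $\mathsf{RCA}_0^\omega=\text{E-PRA}^\omega+\text{QF-AC}^{1,0}$ in the language of all finite types in which Kleene's quantifier $(\exists^2)$ exists. All notions below are interpreted in $\mathcal M$; so the result says that the implications hold in every model of $\mathsf{ACA}_0^\omega$, equivalently (completeness theorem) that they are provable in $\mathsf{ACA}_0^\omega$. Real numbers are Cauchy sequences of rationals with modulus $2^{-n}$, functions on the reals are functionals that respect equality of reals, and sets are given by characteristic functions. For an interval $I$ ($\mathbb R$ or $[0,1]$), a set $J\subseteq\mathbb R$, and a class $\Gamma$, the *supremum principle for $I^2\to J$-functions in $\Gamma$* says: for every $f:I^2\to J$ in $\Gamma$ there is $\Phi:I\times(\mathbb Q\cap I)^2\to\mathbb R\cup\{+\infty,-\infty\}$ with $\Phi(x,p,q)=\sup_{y\in[p,q]\cap I}f(x,y)$ for all $x\in I$ and $p,q\in\mathbb Q\cap I$ (where $\sup\emptyset=-\infty$). Let $\Gamma$ be any one of the following seven classes of functions $f:I^2\to\mathbb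 R$ (closure, interior and boundary are relative to $I^2$, resp. $I$; $G$ ranges over open subsets of $\mathbb R$): 1. *graph continuous*: there is a continuous $g:I^2\to\mathbb R$ whose graph is contained in the closure of the graph of $f$; 2. *Young condition*, in each variable separately: for each section $h:I\to\mathbb R$ of $f$ and each $x\in I$ there are sequences in $I$ strictly to the left and strictly to the right of $x$, with limit $x$, along which $h$ converges to $h(x)$ (at an end-point of $I$ only the side lying in $I$ is considered); 3. *almost continuous (Husain)*: if $f(p)\in G$, then $\overline{f^{-1}(G)}$ is a neighbourhood of $p$; 4. *not of Cesàro type*: there are no non-empty open $U\subseteq I^2$, $V\subseteq\mathbb R$ with $U\subseteq\overline{f^{-1}(z)}$ for all $z\in V$; 5. *peripherally continuous*, in each variable separately: for each section $h:I\to\mathbb R$ of $f$, each $x\in I$ and all open intervals $U\ni x$, $V\ni h(x)$, there is an open $W\subseteq U$ with $x\in W$ and $h(\partial W)\subseteq V$; 6. *pre-continuous*: $f^{-1}(G)\subseteq\mathrm{int}(\overline{f^{-1}(G)})$ for all $G$; 7. *$\mathcal C$-continuous*: for all $G$, $f^{-1}(G)=O\cap A$ with $O$ open and $A\subseteq\mathrm{int}(\overline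 A)$. Let $\mathsf{BOOT}_2$ be the principle: for every $Y:\mathbb N^{\mathbb N}\times\mathbb N^{\mathbb N}\times\mathbb N\to\mathbb N$ there is $X\subseteq\mathbb N$ such that for all $n\in\mathbb N$ $$n\in X\;\leftrightarrow\;(\exists f\in\mathbb N^{\mathbb N})(\forall g\in\mathbb N^{\mathbb N})\,(Y(f,g,n)=0).$$ **Theorem.** Over $\mathsf{ACA}_0^\omega$, for each of these classes $\Gamma$ (in particular for the graph continuous functions), each of the following principles implies the next one: (i) the supremum principle for all $\mathbb R^2\to\mathbb R$-functions; (ii) the supremum principle for the $\mathbb R^2\to\mathbb R$-functions in $\Gamma$; (iii) the supremum principle for the $[0,1]^2\to[0,1]$-functions in $\Gamma$; (iv) $\mathsf{BOOT}_2$; (v) $\Pi^1_2$-comprehension (with parameters): for each arithmetical $\varphi$ the set $\{n\in\mathbb N:(\forall A\subseteq\mathbb N)(\exists B\subseteq\mathbb N)\,\varphi(n,A,B)\}$ exists. -/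

import Mathlib

universe u

/-! # Higher-order arithmetic

Statements "provable in `ACA₀^ω`" are read as "true in every model of `ACA₀^ω`": the theory is a
classical many-sorted first-order theory, one sort for every finite type, and the quantifiers of all
principles below range over the sorts of an arbitrary (Henkin) model; in particular the natural
numbers of a model may be nonstandard, and the function sorts need not be full. -/

/-- The finite types: the type `0` of natural numbers, and `σ ⇒ τ`. -/
inductive FinTy : Type
  | nat : FinTy
  | arrow : FinTy → FinTy → FinTy

infixr:60 " ⇒ " => FinTy.arrow

/-- The type `0`. -/
abbrev ty0 : FinTy := FinTy.nat

/-- The type `1 = 0 → 0` of sequences of natural numbers. -/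
abbrev ty1 : FinTy := ty0 ⇒ ty0

/-- The Boolean closure of a family of atomic predicates: the predicates defined by quantifier-free
formulas whose prime formulas are the given atoms. -/
inductive QFree {X : Type u} (Atom : (X → Prop) → Prop) : (X → Prop) → Prop
  | atom {P : X → Prop} (h : Atom P) : QFree Atom P
  | neg {P : X → Prop} (h : QFree Atom P) : QFree Atom (fun x => ¬ P x)
  | and {P Q : X → Prop} (hP : QFree Atom P) (hQ : QFree Atom Q) : QFree Atom (fun x => P x ∧ Q x)

/-- Models of Kohlenbach's base theory `RCA₀^ω = E-PRA^ω + QF-AC^{1,0}`.  The only primitive equality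
is that of type `0`; equality of higher type is defined extensionally and is respected by all
functionals, so that (passing to the quotient) a model may be taken to be an extensional type
structure.  A quantifier-free formula with parameters is a Boolean combination of equations of type
`0` between terms, and by the combinators `K`, `S` the terms in the displayed variables are exactly
the applications of elements of the model. -/
structure RCAModel : Type (u + 1) where
  /-- the objects of each finite type -/
  carrier : FinTy → Type u
  /-- application -/
  app : ∀ {σ τ : FinTy}, carrier (σ ⇒ τ) → carrier σ → carrier τ
  /-- extensionality -/
  ext : ∀ {σ τ : FinTy} (f g : carrier (σ ⇒ τ)), (∀ x, app f x = app g x) → f = g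
  /-- the projection combinators -/
  K : ∀ {σ τ : FinTy}, carrier (σ ⇒ τ ⇒ σ)
  K_app : ∀ {σ τ : FinTy} (x : carrier σ) (y : carrier τ), app (app K x) y = x
  /-- the substitution combinators -/
  S : ∀ {ρ σ τ : FinTy}, carrier ((ρ ⇒ σ ⇒ τ) ⇒ (ρ ⇒ σ) ⇒ ρ ⇒ τ)
  S_app : ∀ {ρ σ τ : FinTy} (x : carrier (ρ ⇒ σ ⇒ τ)) (y : carrier (ρ ⇒ σ)) (z : carrier ρ),
    app (app (app S x) y) z = app (app x z) (app y z)
  zero : carrier ty0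
  succ : carrier (ty0 ⇒ ty0)
  succ_ne_zero : ∀ n, app succ n ≠ zero
  succ_inj : ∀ m n, app succ m = app succ n → m = n
  /-- the recursor for primitive recursion of type `0` -/
  R : carrier (ty0 ⇒ ty0 ⇒ (ty0 ⇒ ty0 ⇒ ty0) ⇒ ty0)
  R_zero : ∀ y z, app (app (app R zero) y) z = y
  R_succ : ∀ x y z, app (app (app R (app succ x)) y) z = app (app z (app (app (app R x) y) z)) x
  /-- quantifier-free induction -/
  qf_induction : ∀ P : carrier ty0 → Prop,
    QFree (fun A => ∃ f g : carrier ty1, A = fun n => app f n = app g n) P →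
    P zero → (∀ n, P n → P (app succ n)) → ∀ n, P n
  /-- quantifier-free choice `QF-AC^{1,0}` -/
  qf_choice : ∀ P : carrier ty1 × carrier ty0 → Prop,
    QFree (fun A => ∃ F G : carrier (ty1 ⇒ ty0 ⇒ ty0),
      A = fun p => app (app F p.1) p.2 = app (app G p.1) p.2) P →
    (∀ f, ∃ n, P (f, n)) → ∃ Φ : carrier (ty1 ⇒ ty0), ∀ f, P (f, app Φ f)

infixl:90 " ⬝ " => RCAModel.app _

namespace RCAModel

variable (M : RCAModel.{u})

/-- Kleene's quantifier `(∃²)`; `ACA₀^ω` is `RCA₀^ω + (∃²)`. -/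
def Exists2 : Prop :=
  ∃ E : M.carrier (ty1 ⇒ ty0), ∀ f : M.carrier ty1, E ⬝ f = M.zero ↔ ∃ n, f ⬝ n = M.zero

/-- The natural numbers of the model. -/
abbrev N : Type u := M.carrier ty0

/-- The type `1` objects of the model, i.e. its Baire space. -/
abbrev Seq : Type u := M.carrier ty1

variable {M}

/-! ### Arithmetic of the model -/

/-- `λ a b, h a`. -/
def lift (h : M.carrier (ty0 ⇒ ty0)) : M.carrier (ty0 ⇒ ty0 ⇒ ty0) := M.S ⬝ (M.K ⬝ M.K) ⬝ h

theorem lift_app (h : M.carrier (ty0 ⇒ ty0)) (a b : M.N) : lift h ⬝ a ⬝ b = h ⬝ a := by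
  simp only [lift, M.S_app, M.K_app]

def add (x y : M.N) : M.N := M.R ⬝ y ⬝ x ⬝ lift M.succ

theorem add_zero (x : M.N) : add x M.zero = x := by simp only [add, M.R_zero]

theorem add_succ (x y : M.N) : add x (M.succ ⬝ y) = M.succ ⬝ add x y := by
  simp only [add, M.R_succ, lift_app]

def mul (x y : M.N) : M.N :=
  M.R ⬝ y ⬝ M.zero ⬝ lift (M.S ⬝ (M.R ⬝ x) ⬝ (M.K ⬝ lift M.succ))

theorem mul_zero (x : M.N) : mul x M.zero = M.zero := by simp only [mul, M.R_zero]

theorem mul_succ (x y : M.N) : mul x (M.succ ⬝ y) = add (mul x y) x := by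
  simp only [mul, add, M.R_succ, lift_app, M.S_app, M.K_app]

/-- The function `k ↦ 2 ^ k - 1`. -/
def mersenne (k : M.N) : M.N :=
  M.R ⬝ k ⬝ M.zero ⬝
    lift (M.S ⬝ (M.K ⬝ M.succ) ⬝
      (M.S ⬝ (M.S ⬝ M.R ⬝ (M.S ⬝ M.K ⬝ (M.K : M.carrier (ty0 ⇒ ty0 ⇒ ty0)))) ⬝
        (M.K ⬝ lift M.succ)))

theorem mersenne_zero : mersenne M.zero = M.zero := by simp only [mersenne, M.R_zero]

theorem mersenne_succ (k : M.N) :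
    mersenne (M.succ ⬝ k) = M.succ ⬝ add (mersenne k) (mersenne k) := by
  simp only [mersenne, add, M.R_succ, lift_app, M.S_app, M.K_app]

variable (M) in
def one : M.N := M.succ ⬝ M.zero

def le (a b : M.N) : Prop := ∃ c, add a c = b

def lt (a b : M.N) : Prop := ∃ c, add a (M.succ ⬝ c) = b

/-- The pairing function `(a + b) ^ 2 + a`. -/
def pair (a b : M.N) : M.N := add (mul (add a b) (add a b)) a

/-! ### Rational numbers and real numbers -/

variable (M) in
/-- The rational number `(pos - neg) / (den + 1)` of the model. -/
structure Frac : Type u where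
  pos : M.N
  neg : M.N
  den : M.N

/-- The natural number that codes a fraction. -/
def Frac.code (r : M.Frac) : M.N := pair (pair r.pos r.neg) r.den

/-- The order of the rational numbers, by cross-multiplication. -/
def Frac.le (r s : M.Frac) : Prop :=
  RCAModel.le
    (RCAModel.add (mul r.pos (M.succ ⬝ s.den)) (mul s.neg (M.succ ⬝ r.den)))
    (RCAModel.add (mul s.pos (M.succ ⬝ r.den)) (mul r.neg (M.succ ⬝ s.den)))

/-- The sum of two fractions; its denominator is
`(r.den + 1) * (s.den + 1) = (r.den * s.den + (r.den + s.den)) + 1`. -/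
def Frac.add (r s : M.Frac) : M.Frac where
  pos := RCAModel.add (mul r.pos (M.succ ⬝ s.den)) (mul s.pos (M.succ ⬝ r.den))
  neg := RCAModel.add (mul r.neg (M.succ ⬝ s.den)) (mul s.neg (M.succ ⬝ r.den))
  den := RCAModel.add (mul r.den s.den) (RCAModel.add r.den s.den)

/-- The rational number `2 ^ (-k)`. -/
def twoPowNeg (k : M.N) : M.Frac := ⟨M.one, M.zero, mersenne k⟩

/-- `|r - s| ≤ t`. -/
def Frac.distLe (r s t : M.Frac) : Prop := r.le (s.add t) ∧ s.le (r.add t)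

/-- `c` is a code of a rational number. -/
def IsRat (c : M.N) : Prop := ∃ r : M.Frac, c = r.code

/-- Real numbers are sequences `(q_n)` of (codes of) rational numbers such that
`|q_n - q_m| ≤ 2 ^ (-n)` for all `n ≤ m`. -/
def IsReal (x : M.Seq) : Prop :=
  (∀ n, IsRat (x ⬝ n)) ∧
    ∀ (n m : M.N) (r s : M.Frac), le n m → x ⬝ n = r.code → x ⬝ m = s.code →
      r.distLe s (twoPowNeg n)

/-- `x ≤ y` for reals: `x_n ≤ y_n + 2 ^ (-n + 1)` for all `n`. -/
def leR (x y : M.Seq) : Prop :=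
  ∀ (n : M.N) (r s : M.Frac), x ⬝ n = r.code → y ⬝ n = s.code →
    r.le (s.add ((twoPowNeg n).add (twoPowNeg n)))

/-- Equality of reals. -/
def eqR (x y : M.Seq) : Prop := leR x y ∧ leR y x

/-- The strict order of the reals. -/
def ltR (x y : M.Seq) : Prop := ¬ leR y x

/-- `|x - y| ≤ 2 ^ (-k)` for reals: `|x_n - y_n| ≤ 2 ^ (-k) + 2 ^ (-n + 1)` for all `n`.  The balls
`{y | close k x y}` are used as a base of neighbourhoods of `x`. -/
def close (k : M.N) (x y : M.Seq) : Prop :=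
  ∀ (n : M.N) (r s : M.Frac), x ⬝ n = r.code → y ⬝ n = s.code →
    r.distLe s ((twoPowNeg k).add ((twoPowNeg n).add (twoPowNeg n)))

/-- The rational number with code `c`, as a real (a constant sequence). -/
def ratReal (c : M.N) : M.Seq := M.K ⬝ c

variable (M) in
/-- The real line. -/
def line : Set M.Seq := {x | IsReal x}

variable (M) in
/-- The unit interval `[0,1]`. -/
def unitInterval : Set M.Seq :=
  {x | IsReal x ∧ leR (ratReal (Frac.code ⟨M.zero, M.zero, M.zero⟩)) x ∧
    leR x (ratReal (Frac.code ⟨M.one, M.zero, M.zero⟩))}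

/-- `|p - q| ≤ 2 ^ (-k)` for points of the plane, in the maximum norm. -/
def close₂ (k : M.N) (p q : M.Seq × M.Seq) : Prop := close k p.1 q.1 ∧ close k p.2 q.2

/-! ### Sets and functions

In this section `I` is the line or the unit interval; subsets of `I` and of `I × I` are given by
characteristic functions in the model, and closure, interior and boundary are relative to `I`
resp. `I × I`. They are understood virtually: only membership in them is used. -/

/-- `A` is the characteristic function of an open subset of `I`. -/
def IsOpen₁ (I : Set M.Seq) (A : M.carrier (ty1 ⇒ ty0)) : Prop :=
  (∀ x ∈ I, A ⬝ x = M.zero ∨ A ⬝ x = M.one) ∧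
  (∀ x ∈ I, ∀ x' ∈ I, eqR x x' → A ⬝ x = A ⬝ x') ∧
  ∀ x ∈ I, A ⬝ x = M.one → ∃ k, ∀ z ∈ I, close k x z → A ⬝ z = M.one

/-- `A` is the characteristic function of a subset of `I × I`. -/
def IsSet₂ (I : Set M.Seq) (A : M.carrier (ty1 ⇒ ty1 ⇒ ty0)) : Prop :=
  (∀ x ∈ I, ∀ y ∈ I, A ⬝ x ⬝ y = M.zero ∨ A ⬝ x ⬝ y = M.one) ∧
  ∀ x ∈ I, ∀ y ∈ I, ∀ x' ∈ I, ∀ y' ∈ I, eqR x x' → eqR y y' → A ⬝ x ⬝ y = A ⬝ x' ⬝ y'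

/-- The points of `I × I` in the set with characteristic function `A`. -/
def points₂ (I : Set M.Seq) (A : M.carrier (ty1 ⇒ ty1 ⇒ ty0)) : Set (M.Seq × M.Seq) :=
  {p | p ∈ I ×ˢ I ∧ A ⬝ p.1 ⬝ p.2 = M.one}

/-- The closure of `T` in `I × I`. -/
def closure₂ (I : Set M.Seq) (T : Set (M.Seq × M.Seq)) : Set (M.Seq × M.Seq) :=
  {p | p ∈ I ×ˢ I ∧ ∀ k, ∃ s ∈ I ×ˢ I, s ∈ T ∧ close₂ k p s}

/-- The interior of `T` in `I × I`. -/
def interior₂ (I : Set M.Seq) (T : Set (M.Seq × M.Seq)) : Set (M.Seq × M.Seq) :=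
  {p | p ∈ I ×ˢ I ∧ ∃ k, ∀ s ∈ I ×ˢ I, close₂ k p s → s ∈ T}

/-- `A` is the characteristic function of an open subset of `I × I`. -/
def IsOpen₂ (I : Set M.Seq) (A : M.carrier (ty1 ⇒ ty1 ⇒ ty0)) : Prop :=
  IsSet₂ I A ∧ points₂ I A ⊆ interior₂ I (points₂ I A)

/-- `f` represents a function from `I × I` to `J`: it maps points to elements of `J`, and it respects
equality of reals. -/
def IsFun (I J : Set M.Seq) (f : M.carrier (ty1 ⇒ ty1 ⇒ ty1)) : Prop :=
  (∀ x ∈ I, ∀ y ∈ I, f ⬝ x ⬝ y ∈ J) ∧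
  ∀ x ∈ I, ∀ y ∈ I, ∀ x' ∈ I, ∀ y' ∈ I, eqR x x' → eqR y y' → eqR (f ⬝ x ⬝ y) (f ⬝ x' ⬝ y')

/-- The inverse image `f⁻¹(G)` of a set of reals. -/
def preimage (I : Set M.Seq) (f : M.carrier (ty1 ⇒ ty1 ⇒ ty1)) (G : M.carrier (ty1 ⇒ ty0)) :
    Set (M.Seq × M.Seq) :=
  {p | p ∈ I ×ˢ I ∧ G ⬝ (f ⬝ p.1 ⬝ p.2) = M.one}

/-- The inverse image `f⁻¹(z)` of a real. -/
def fiber (I : Set M.Seq) (f : M.carrier (ty1 ⇒ ty1 ⇒ ty1)) (z : M.Seq) : Set (M.Seq × M.Seq) :=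
  {p | p ∈ I ×ˢ I ∧ eqR (f ⬝ p.1 ⬝ p.2) z}

/-! ### Weak continuity of functions `I × I → ℝ` -/

/-- Continuity, in the usual epsilon-delta sense. -/
def IsContinuous (I : Set M.Seq) (g : M.carrier (ty1 ⇒ ty1 ⇒ ty1)) : Prop :=
  ∀ p ∈ I ×ˢ I, ∀ k, ∃ m, ∀ s ∈ I ×ˢ I, close₂ m p s → close k (g ⬝ p.1 ⬝ p.2) (g ⬝ s.1 ⬝ s.2)

/-- Graph continuity: the graph of some continuous function is contained in the closure of the graph
of `f`. -/
def GraphContinuous (I : Set M.Seq) (f : M.carrier (ty1 ⇒ ty1 ⇒ ty1)) : Prop :=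
  ∃ g, IsFun I M.line g ∧ IsContinuous I g ∧
    ∀ p ∈ I ×ˢ I, ∀ k, ∃ s ∈ I ×ˢ I, close₂ k p s ∧ close k (g ⬝ p.1 ⬝ p.2) (f ⬝ s.1 ⬝ s.2)

/-- Almost continuity in the sense of Husain: if `f(p)` is in the open set `G`, then the closure of
`f⁻¹(G)` is a neighbourhood of `p`. -/
def HusainContinuous (I : Set M.Seq) (f : M.carrier (ty1 ⇒ ty1 ⇒ ty1)) : Prop :=
  ∀ p ∈ I ×ˢ I, ∀ G, IsOpen₁ M.line G → G ⬝ (f ⬝ p.1 ⬝ p.2) = M.one →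
    p ∈ interior₂ I (closure₂ I (preimage I f G))

/-- `f` is of Cesàro type. -/
def CesaroType (I : Set M.Seq) (f : M.carrier (ty1 ⇒ ty1 ⇒ ty1)) : Prop :=
  ∃ U V, IsOpen₂ I U ∧ (points₂ I U).Nonempty ∧ IsOpen₁ M.line V ∧ (∃ z ∈ M.line, V ⬝ z = M.one) ∧
    ∀ z ∈ M.line, V ⬝ z = M.one → points₂ I U ⊆ closure₂ I (fiber I f z)

/-- Pre-continuity: `f⁻¹(G)` is pre-open for open `G`. -/
def PreContinuous (I : Set M.Seq) (f : M.carrier (ty1 ⇒ ty1 ⇒ ty1)) : Prop :=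
  ∀ G, IsOpen₁ M.line G → preimage I f G ⊆ interior₂ I (closure₂ I (preimage I f G))

/-- `𝒞`-continuity: for open `G`, `f⁻¹(G)` is the intersection of an open set and a pre-open set. -/
def CContinuous (I : Set M.Seq) (f : M.carrier (ty1 ⇒ ty1 ⇒ ty1)) : Prop :=
  ∀ G, IsOpen₁ M.line G → ∃ O A, IsOpen₂ I O ∧ IsSet₂ I A ∧
    points₂ I A ⊆ interior₂ I (closure₂ I (points₂ I A)) ∧
    preimage I f G = points₂ I O ∩ points₂ I A

/-- The sequence of reals `a` converges to `x`. -/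
def ConvergesTo (a : M.carrier (ty0 ⇒ ty1)) (x : M.Seq) : Prop :=
  ∀ k, ∃ m, ∀ n, le m n → close k (a ⬝ n) x

/-- The Young condition for a function `h` of one variable: every point `x` of `I` is the limit of
sequences in `I` strictly on the left and strictly on the right of `x` along which the values of `h`
converge to `h(x)`; at an end-point of `I`, only the side on which `I` has points is considered. The
values along the sequence form a sequence of the model. -/
def Young₁ (I : Set M.Seq) (h : M.carrier (ty1 ⇒ ty1)) : Prop :=
  ∀ x ∈ I,
    ((∃ z ∈ I, ltR z x) → ∃ a : M.carrier (ty0 ⇒ ty1), (∀ n, a ⬝ n ∈ I ∧ ltR (a ⬝ n) x) ∧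
      ConvergesTo a x ∧ ConvergesTo (M.S ⬝ (M.K ⬝ h) ⬝ a) (h ⬝ x)) ∧
    ((∃ z ∈ I, ltR x z) → ∃ a : M.carrier (ty0 ⇒ ty1), (∀ n, a ⬝ n ∈ I ∧ ltR x (a ⬝ n)) ∧
      ConvergesTo a x ∧ ConvergesTo (M.S ⬝ (M.K ⬝ h) ⬝ a) (h ⬝ x))

/-- The boundary in `I` of the set with characteristic function `W`. -/
def boundary₁ (I : Set M.Seq) (W : M.carrier (ty1 ⇒ ty0)) : Set M.Seq :=
  {z | z ∈ I ∧ (∀ k, ∃ w ∈ I, close k z w ∧ W ⬝ w = M.one) ∧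
    ∀ k, ∃ w ∈ I, close k z w ∧ W ⬝ w ≠ M.one}

/-- Peripheral continuity for a function `h` of one variable: for all open intervals `(a,b)` around
`x` and `(c,d)` around `h(x)` there is an open `W ⊆ (a,b)` containing `x` and such that `h` maps the
boundary of `W` into `(c,d)`. -/
def Peripheral₁ (I : Set M.Seq) (h : M.carrier (ty1 ⇒ ty1)) : Prop :=
  ∀ x ∈ I, ∀ a ∈ M.line, ∀ b ∈ M.line, ∀ c ∈ M.line, ∀ d ∈ M.line,
    ltR a x → ltR x b → ltR c (h ⬝ x) → ltR (h ⬝ x) d →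
    ∃ W, IsOpen₁ I W ∧ W ⬝ x = M.one ∧
      (∀ z ∈ I, W ⬝ z = M.one → ltR a z ∧ ltR z b) ∧
      ∀ z ∈ boundary₁ I W, ltR c (h ⬝ z) ∧ ltR (h ⬝ z) d

/-- The section `x ↦ f(x, y)`. -/
def sectionLeft (f : M.carrier (ty1 ⇒ ty1 ⇒ ty1)) (y : M.Seq) : M.carrier (ty1 ⇒ ty1) :=
  M.S ⬝ f ⬝ (M.K ⬝ y)

theorem sectionLeft_app (f : M.carrier (ty1 ⇒ ty1 ⇒ ty1)) (x y : M.Seq) :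
    sectionLeft f y ⬝ x = f ⬝ x ⬝ y := by simp only [sectionLeft, M.S_app, M.K_app]

/-- The Young condition in each variable separately. -/
def Young (I : Set M.Seq) (f : M.carrier (ty1 ⇒ ty1 ⇒ ty1)) : Prop :=
  (∀ x ∈ I, Young₁ I (f ⬝ x)) ∧ ∀ y ∈ I, Young₁ I (sectionLeft f y)

/-- Peripheral continuity in each variable separately. -/
def Peripheral (I : Set M.Seq) (f : M.carrier (ty1 ⇒ ty1 ⇒ ty1)) : Prop :=
  (∀ x ∈ I, Peripheral₁ I (f ⬝ x)) ∧ ∀ y ∈ I, Peripheral₁ I (sectionLeft f y)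

/-! ### The supremum principle -/

/-- The pair `(t, v)` of a natural number and a sequence represents the supremum of
`f(x, y)` over all `y` in `I` with `p ≤ y ≤ q`, as an extended real: `t = 0` stands for the real
number `v`, `t = 1` for `+∞`, and `t = 2` for `-∞` (the supremum of the empty set). -/
def IsSup (I : Set M.Seq) (f : M.carrier (ty1 ⇒ ty1 ⇒ ty1)) (x : M.Seq) (p q : M.N)
    (t : M.N) (v : M.Seq) : Prop :=
  (t = M.zero ∧ IsReal v ∧
    (∀ y ∈ I, leR (ratReal p) y → leR y (ratReal q) → leR (f ⬝ x ⬝ y) v) ∧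
    ∀ w ∈ M.line, (∀ y ∈ I, leR (ratReal p) y → leR y (ratReal q) → leR (f ⬝ x ⬝ y) w) →
      leR v w) ∨
  (t = M.one ∧
    ∀ w ∈ M.line, ∃ y ∈ I, leR (ratReal p) y ∧ leR y (ratReal q) ∧ ltR w (f ⬝ x ⬝ y)) ∨
  (t = M.succ ⬝ M.one ∧ ¬ ∃ y ∈ I, leR (ratReal p) y ∧ leR y (ratReal q))

variable (M) in
/-- The supremum principle for the functions `I × I → J` in the class `Γ`: the function
`(x, p, q) ↦ sup_{y ∈ [p,q]} f(x, y)`, with `x ∈ I` and rational `p, q ∈ I`, exists in the model.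
Its values are extended reals, given by `T` and `V` together. -/
def SupPrinciple (I J : Set M.Seq) (Γ : M.carrier (ty1 ⇒ ty1 ⇒ ty1) → Prop) : Prop :=
  ∀ f, IsFun I J f → Γ f →
    ∃ (T : M.carrier (ty1 ⇒ ty0 ⇒ ty0 ⇒ ty0)) (V : M.carrier (ty1 ⇒ ty0 ⇒ ty0 ⇒ ty1)),
      ∀ x ∈ I, ∀ p q : M.N, IsRat p → IsRat q → ratReal p ∈ I → ratReal q ∈ I →
        IsSup I f x p q (T ⬝ x ⬝ p ⬝ q) (V ⬝ x ⬝ p ⬝ q)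

/-! ### Comprehension -/

variable (M) in
/-- `BOOT₂`. Sets of natural numbers are given by characteristic functions. -/
def BOOT₂ : Prop :=
  ∀ Y : M.carrier (ty1 ⇒ ty1 ⇒ ty0 ⇒ ty0), ∃ X : M.Seq,
    (∀ n, X ⬝ n = M.zero ∨ X ⬝ n = M.one) ∧
    ∀ n, X ⬝ n = M.one ↔ ∃ f : M.Seq, ∀ g : M.Seq, Y ⬝ f ⬝ g ⬝ n = M.zero

end RCAModel

/-- Numerical terms of second-order arithmetic. -/
inductive L2Term : Type
  | var : ℕ → L2Term
  | zero : L2Term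
  | one : L2Term
  | add : L2Term → L2Term → L2Term
  | mul : L2Term → L2Term → L2Term

/-- Arithmetical formulas of second-order arithmetic: number quantifiers only, with free set
variables. -/
inductive ArithFormula : Type
  | eq : L2Term → L2Term → ArithFormula
  | lt : L2Term → L2Term → ArithFormula
  | mem : L2Term → ℕ → ArithFormula
  | neg : ArithFormula → ArithFormula
  | and : ArithFormula → ArithFormula → ArithFormula
  | all : ℕ → ArithFormula → ArithFormula

namespace RCAModel

variable {M : RCAModel.{u}}

/-- The value of a term when `e` assigns values to the number variables. -/
def termVal (e : ℕ → M.N) : L2Term → M.N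
  | .var i => e i
  | .zero => M.zero
  | .one => M.one
  | .add s t => add (termVal e s) (termVal e t)
  | .mul s t => mul (termVal e s) (termVal e t)

/-- Truth of an arithmetical formula in the model, where `e` assigns values to the number variables
and `X` assigns (characteristic functions of) sets to the set variables. -/
def Sat (X : ℕ → M.Seq) : (ℕ → M.N) → ArithFormula → Prop
  | e, .eq s t => termVal e s = termVal e t
  | e, .lt s t => lt (termVal e s) (termVal e t)
  | e, .mem t j => X j ⬝ termVal e t = M.one
  | e, .neg φ => ¬ Sat X e φ
  | e, .and φ ψ => Sat X e φ ∧ Sat X e ψ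
  | e, .all i φ => ∀ a : M.N, Sat X (Function.update e i a) φ

variable (M) in
/-- `Π¹₂`-comprehension with parameters: for every arithmetical `φ`, the set of all `n` with
`(∀ A) (∃ B) φ(n, A, B)` exists. -/
def Pi12CA : Prop :=
  ∀ (φ : ArithFormula) (e : ℕ → M.N) (X : ℕ → M.Seq), ∃ Z : M.Seq,
    (∀ n, Z ⬝ n = M.zero ∨ Z ⬝ n = M.one) ∧
    ∀ n, Z ⬝ n = M.one ↔ ∀ A : M.Seq, ∃ B : M.Seq,
      Sat (Function.update (Function.update X 0 A) 1 B) (Function.update e 0 n) φ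

end RCAModel

/-- The seven weak continuity notions. -/
inductive WeakContinuity : Type
  | graph
  | young
  | husain
  | notCesaro
  | peripheral
  | pre
  | curlyC

/-- The class of functions `I × I → ℝ` given by a weak continuity notion. -/
def WeakContinuity.Holds (Γ : WeakContinuity) {M : RCAModel.{u}} (I : Set M.Seq)
    (f : M.carrier (ty1 ⇒ ty1 ⇒ ty1)) : Prop :=
  match Γ with
  | .graph => RCAModel.GraphContinuous I f
  | .young => RCAModel.Young I f
  | .husain => RCAModel.HusainContinuous I f
  | .notCesaro => ¬ RCAModel.CesaroType I f
  | .peripheral => RCAModel.Peripheral I f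
  | .pre => RCAModel.PreContinuous I f
  | .curlyC => RCAModel.CContinuous I f

/-! The first implication is a restriction, and the other three are independent of each other.

From the supremum principle on the unit square to `BOOT₂`: an element `g` of Baire space is coded by
reals in `[0,1]` whose base 4 digits list the graph of `g`, each pair `(n, g n)` at infinitely many
positions, while finitely many leading digits are free. Hence the codes of each `g` are dense, from
either side, although decoding is arithmetical and respects equality of reals. Given `Y`, let `f(x,
y)` be `1` if `Y` vanishes at the decoded arguments and `0` otherwise. As `f` depends on the decoded
arguments only, each of its values is taken on a dense set, and in each variable separately the
value at a point recurs arbitrarily near to it on both sides. Since only the values `0` and `1`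
occur, `f` lies in all seven classes (`holds_of_decode`). The supremum of `f(x, ·)` at a code `x` of
`g` is positive exactly if `Y g h = 0` for some `h`; so the supremum functional decides an
existential quantifier over Baire space, uniformly in `g` (`exists_of_supPrinciple`). Two such steps
decide `∃ f ∀ g` (`boot₂_of_supPrinciple`).

From the plane to the unit square: the line is folded onto `[0,1]` by the distance to the nearest
even integer. The folding is 1-Lipschitz, it is the identity on `[0,1]`, and it has isometric local
inverses, the branches `y ↦ 2 z ± y`. Composition with it in both variables keeps a function in its
class (`holds_foldFun`) and does not change the suprema over intervals inside `[0,1]`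
(`isSup_of_foldFun`).

From `BOOT₂` to comprehension: arithmetical formulas have characteristic functionals (`isAr_sat`),
so `BOOT₂` applied to the negated matrix gives the complement of the required set.

All of this takes place inside an arbitrary model, so every object used must be shown to exist
there. Combinatory completeness is cast as a type class `IsDef`, and `(∃²)` yields a search
operator, under which the predicates with a characteristic functional (`IsAr`) become closed under
number quantifiers and satisfy induction. To calculate with the possibly nonstandard reals, each of
them is given a value `rho x` in an ordered field outside the model, where comparisons become
ordinary inequalities. -/

namespace Henkin

section

variable {M : RCAModel.{u}}

/-! ### Definable functionals

A context is an iterated product of the types of the model; `IsDef F` says that `F` is given by a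
term of the model in the variables of the context. -/

/-- Contexts of variables, together with the functionals on them that the model represents. -/
class Ctx (M : RCAModel.{u}) (C : Type u) where
  Rep : ∀ {τ : FinTy}, (C → M.carrier τ) → Prop
  const : ∀ {τ : FinTy} (a : M.carrier τ), Rep fun _ => a
  app : ∀ {σ τ : FinTy} {F : C → M.carrier (σ ⇒ τ)} {G : C → M.carrier σ}, Rep F → Rep G →
    Rep fun c => F c ⬝ G c

instance : Ctx M PUnit.{u + 1} where
  Rep _ := True
  const _ := trivial
  app _ _ := trivial

/-- Combinatory completeness is built into the notion of context: a functional of one more variable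
is represented if its abstraction over that variable is, and `K` and `S` abstract constants and
applications. -/
instance {C : Type u} [Ctx M C] {σ : FinTy} : Ctx M (C × M.carrier σ) where
  Rep F := ∃ G : C → M.carrier (σ ⇒ _), Ctx.Rep G ∧ ∀ c x, G c ⬝ x = F (c, x)
  const a := ⟨fun _ => M.K ⬝ a, Ctx.const _, fun _ x => M.K_app a x⟩
  app := by
    rintro σ' τ F G ⟨F', hF, hF'⟩ ⟨G', hG, hG'⟩
    refine ⟨fun c => M.S ⬝ F' c ⬝ G' c, Ctx.app (Ctx.app (Ctx.const _) hF) hG, fun c x => ?_⟩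
    rw [M.S_app, hF', hG']

/-- `F` is represented in the model, with the variables of the context as parameters. -/
class IsDef {C : Type u} [Ctx M C] {τ : FinTy} (F : C → M.carrier τ) : Prop where
  rep : Ctx.Rep F

section

variable {C : Type u} [Ctx M C] {σ τ : FinTy}

instance (priority := 1100) isDef_const (a : M.carrier τ) : IsDef fun _ : C => a := ⟨Ctx.const a⟩

instance isDef_app (F : C → M.carrier (σ ⇒ τ)) (G : C → M.carrier σ) [hF : IsDef F]
    [hG : IsDef G] : IsDef fun c => F c ⬝ G c := ⟨Ctx.app hF.rep hG.rep⟩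

instance isDef_var : IsDef fun c : C × M.carrier σ => c.2 :=
  ⟨fun _ => M.S ⬝ M.K ⬝ (M.K : M.carrier (σ ⇒ σ ⇒ σ)), Ctx.const _,
    fun _ x => by rw [M.S_app, M.K_app]⟩

instance (priority := 900) isDef_weak (F : C → M.carrier τ) [hF : IsDef F] :
    IsDef fun c : C × M.carrier σ => F c.1 :=
  ⟨fun c => M.K ⬝ F c, Ctx.app (Ctx.const _) hF.rep, fun c x => M.K_app (F c) x⟩

instance (priority := 890) isDef_weak₂ {ρ : FinTy} (F : C → M.carrier τ) [IsDef F] :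
    IsDef fun c : (C × M.carrier σ) × M.carrier ρ => F c.1.1 :=
  isDef_weak (C := C × M.carrier σ) fun c => F c.1

instance (priority := 880) isDef_weak₃ {ρ π : FinTy} (F : C → M.carrier τ) [IsDef F] :
    IsDef fun c : ((C × M.carrier σ) × M.carrier ρ) × M.carrier π => F c.1.1.1 :=
  isDef_weak (C := (C × M.carrier σ) × M.carrier ρ) fun c => F c.1.1

instance (priority := 870) isDef_weak₄ {ρ π ν : FinTy} (F : C → M.carrier τ) [IsDef F] :
    IsDef fun c : (((C × M.carrier σ) × M.carrier ρ) × M.carrier π) × M.carrier ν =>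
      F c.1.1.1.1 :=
  isDef_weak (C := ((C × M.carrier σ) × M.carrier ρ) × M.carrier π) fun c => F c.1.1.1

/-- An element of each type. -/
def default : (τ : FinTy) → M.carrier τ
  | .nat => M.zero
  | .arrow _ τ => M.K ⬝ default τ

open Classical in
/-- The object of the model that represents a function, if there is one. -/
noncomputable def lam (F : M.carrier σ → M.carrier τ) : M.carrier (σ ⇒ τ) :=
  if h : ∃ t : M.carrier (σ ⇒ τ), ∀ x, t ⬝ x = F x then h.choose else default _

theorem lam_app (F : M.carrier σ → M.carrier τ)
    [hF : IsDef fun c : PUnit.{u + 1} × M.carrier σ => F c.2] (x : M.carrier σ) :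
    lam F ⬝ x = F x := by
  obtain ⟨G, -, hG⟩ := hF.rep
  have h : ∃ t : M.carrier (σ ⇒ τ), ∀ x, t ⬝ x = F x := ⟨G ⟨⟩, hG ⟨⟩⟩
  rw [lam, dif_pos h]
  exact h.choose_spec x

/-- By extensionality the object chosen by `lam` is unique, so it is the abstraction given by the
context, and it depends on the parameters in a represented way. -/
instance isDef_lam (F : C → M.carrier σ → M.carrier τ)
    [hF : IsDef fun c : C × M.carrier σ => F c.1 c.2] : IsDef fun c => lam (F c) := by
  obtain ⟨G, hG, hG'⟩ := hF.rep
  have : (fun c => lam (F c)) = G := by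
    funext c
    have h : ∃ t : M.carrier (σ ⇒ τ), ∀ x, t ⬝ x = F c x := ⟨G c, hG' c⟩
    apply M.ext
    intro x
    rw [hG', lam, dif_pos h]
    exact h.choose_spec x
  exact ⟨this ▸ hG⟩

end

/-! ### Arithmetical predicates -/

open Classical in
/-- The truth value of a proposition, with `0` for truth. -/
noncomputable def chi (M : RCAModel.{u}) (P : Prop) : M.N := if P then M.zero else M.one

theorem one_ne_zero' : (M.one : M.N) ≠ M.zero := M.succ_ne_zero _

theorem chi_eq_zero {P : Prop} : chi M P = M.zero ↔ P := by
  by_cases h : P <;> simp [chi, h, one_ne_zero']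

theorem chi_of {P : Prop} (h : P) : chi M P = M.zero := chi_eq_zero.2 h

theorem chi_of_not {P : Prop} (h : ¬ P) : chi M P = M.one := by simp [chi, h]

/-- `P` has a characteristic functional in the model, with the variables of the context as
parameters. -/
class IsAr (M : RCAModel.{u}) {C : Type u} [Ctx M C] (P : C → Prop) : Prop where
  rep : IsDef fun c => chi M (P c)

open Classical in
/-- Definition by cases. -/
noncomputable def sel (P : Prop) (a b : M.N) : M.N := if P then a else b

theorem sel_of {P : Prop} (h : P) (a b : M.N) : sel P a b = a := if_pos h

theorem sel_of_not {P : Prop} (h : ¬ P) (a b : M.N) : sel P a b = b := if_neg h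

/-- Definition by cases on a natural number. -/
noncomputable def caseZero (n a b : M.N) : M.N := M.R ⬝ n ⬝ a ⬝ lam fun _ => lam fun _ => b

theorem caseZero_zero (a b : M.N) : caseZero M.zero a b = a := M.R_zero _ _

theorem caseZero_succ (n a b : M.N) : caseZero (M.succ ⬝ n) a b = b := by
  simp only [caseZero, M.R_succ, lam_app]

/-- Quantifier-free induction has no room for the existential quantifier; a predecessor `p` from the
recursor replaces it, and the formula becomes `n = 0 ∨ n = succ (p n)`. -/
theorem exists_succ {n : M.N} (hn : n ≠ M.zero) : ∃ m, n = M.succ ⬝ m := by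
  let p : M.N → M.N := fun n => M.R ⬝ n ⬝ M.zero ⬝ lam fun _ => lam fun m => m
  have hp : ∀ m, p (M.succ ⬝ m) = m := fun m => by simp only [p, M.R_succ, lam_app]
  have h₁ := QFree.atom (Atom := fun A => ∃ f g : M.carrier ty1,
      A = fun n : M.carrier ty0 => f ⬝ n = g ⬝ n)
    ⟨lam fun n => n, lam fun n => M.zero, rfl⟩
  have h₂ := QFree.atom (Atom := fun A => ∃ f g : M.carrier ty1,
      A = fun n : M.carrier ty0 => f ⬝ n = g ⬝ n)
    ⟨lam fun n => n, lam fun n => M.succ ⬝ p n, rfl⟩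
  have := M.qf_induction _ (h₁.neg.and h₂.neg).neg
  simp only [p, lam_app] at this
  have := this (fun h => h.1 trivial) (fun m _ h => h.2 (by simp only [M.R_succ, lam_app])) n
  by_contra h
  exact this ⟨hn, fun h' => h ⟨_, h'⟩⟩

theorem sel_eq (P : Prop) (a b : M.N) : sel P a b = caseZero (chi M P) a b := by
  by_cases h : P
  · rw [chi_of h, caseZero_zero, sel_of h]
  · rw [chi_of_not h, RCAModel.one, caseZero_succ, sel_of_not h]

section

variable {C : Type u} [Ctx M C] {σ τ : FinTy}

instance isDef_chi (P : C → Prop) [h : IsAr M P] : IsDef fun c => chi M (P c) := h.rep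

instance isDef_caseZero (F G H : C → M.N) [IsDef F] [IsDef G] [IsDef H] :
    IsDef fun c => caseZero (F c) (G c) (H c) := by
  unfold caseZero; infer_instance

instance isDef_sel (P : C → Prop) (G H : C → M.N) [IsAr M P] [IsDef G] [IsDef H] :
    IsDef fun c => sel (P c) (G c) (H c) := by
  simp only [sel_eq]; infer_instance

theorem isAr_of_iff {P : C → Prop} (F : C → M.N) [IsDef F] (h : ∀ c, P c ↔ F c = M.zero) :
    IsAr M P := by
  refine ⟨?_⟩
  have : (fun c => chi M (P c)) = fun c => caseZero (F c) M.zero M.one := by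
    funext c
    by_cases hP : P c
    · rw [chi_of hP, (h c).1 hP, caseZero_zero]
    · rw [chi_of_not hP]
      obtain ⟨n, hn⟩ := exists_succ fun h' => hP ((h c).2 h')
      rw [hn, caseZero_succ]
  rw [this]; infer_instance

instance (priority := 1100) isAr_const (P : Prop) : IsAr M fun _ : C => P := ⟨isDef_const _⟩

instance isAr_not (P : C → Prop) [IsAr M P] : IsAr M fun c => ¬ P c := by
  refine ⟨?_⟩
  have : (fun c => chi M (¬ P c)) = fun c => sel (P c) M.one M.zero := by
    funext c
    by_cases h : P c <;> simp [chi, sel, h]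
  rw [this]; infer_instance

instance isAr_and (P Q : C → Prop) [IsAr M P] [IsAr M Q] : IsAr M fun c => P c ∧ Q c := by
  refine ⟨?_⟩
  have : (fun c => chi M (P c ∧ Q c)) =
      fun c => sel (P c) (chi M (Q c)) M.one := by
    funext c
    by_cases h : P c
    · simp only [h, true_and, sel_of trivial]
    · simp only [h, false_and, chi_of_not not_false, sel_of_not not_false]
  rw [this]; infer_instance

instance isAr_or (P Q : C → Prop) [IsAr M P] [IsAr M Q] : IsAr M fun c => P c ∨ Q c := by
  simp only [or_iff_not_and_not]; infer_instance

instance isAr_imp (P Q : C → Prop) [IsAr M P] [IsAr M Q] : IsAr M fun c => P c → Q c := by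
  simp only [imp_iff_not_or]; infer_instance

end

/-- The sequence `a, b, b, …`. -/
noncomputable def twoSeq (a b : M.N) : M.Seq := lam fun n => caseZero n a b

theorem exists_eqChar (M : RCAModel.{u}) : ∃ Φ : M.carrier (ty1 ⇒ ty0), ∀ f : M.Seq,
    Φ ⬝ f = chi M (f ⬝ M.zero = f ⬝ M.one) := by
  let F₀ : M.carrier (ty1 ⇒ ty0 ⇒ ty0) := lam fun f => lam fun _ => f ⬝ M.zero
  let F₁ : M.carrier (ty1 ⇒ ty0 ⇒ ty0) := lam fun f => lam fun _ => f ⬝ M.one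
  let F₂ : M.carrier (ty1 ⇒ ty0 ⇒ ty0) := lam fun _ => lam fun n => n
  let F₃ : M.carrier (ty1 ⇒ ty0 ⇒ ty0) := lam fun _ => lam fun _ => M.zero
  let F₄ : M.carrier (ty1 ⇒ ty0 ⇒ ty0) := lam fun _ => lam fun _ => M.one
  have h₁ := QFree.atom (Atom := fun A => ∃ F G : M.carrier (ty1 ⇒ ty0 ⇒ ty0),
      A = fun p : M.carrier ty1 × M.carrier ty0 => F ⬝ p.1 ⬝ p.2 = G ⬝ p.1 ⬝ p.2) ⟨F₀, F₁, rfl⟩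
  have h₂ := QFree.atom (Atom := fun A => ∃ F G : M.carrier (ty1 ⇒ ty0 ⇒ ty0),
      A = fun p : M.carrier ty1 × M.carrier ty0 => F ⬝ p.1 ⬝ p.2 = G ⬝ p.1 ⬝ p.2) ⟨F₂, F₃, rfl⟩
  have h₃ := QFree.atom (Atom := fun A => ∃ F G : M.carrier (ty1 ⇒ ty0 ⇒ ty0),
      A = fun p : M.carrier ty1 × M.carrier ty0 => F ⬝ p.1 ⬝ p.2 = G ⬝ p.1 ⬝ p.2) ⟨F₂, F₄, rfl⟩
  -- The formula is `(f 0 = f 1 → n = 0) ∧ (f 0 ≠ f 1 → n = 1)`, written with negation and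
  -- conjunction only; it pins down `n`.
  obtain ⟨Φ, hΦ⟩ := M.qf_choice _ ((h₁.and h₂.neg).neg.and (h₁.neg.and h₃.neg).neg) (by
    intro f
    simp only [F₀, F₁, F₂, F₃, F₄, lam_app]
    refine ⟨chi M (f ⬝ M.zero = f ⬝ M.one), ?_⟩
    by_cases h : f ⬝ M.zero = f ⬝ M.one <;> simp [h, chi])
  refine ⟨Φ, fun f => ?_⟩
  have := hΦ f
  simp only [F₀, F₁, F₂, F₃, F₄, lam_app] at this
  by_cases h : f ⬝ M.zero = f ⬝ M.one
  · rw [chi_of h]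
    by_contra h'
    exact this.1 ⟨h, h'⟩
  · rw [chi_of_not h]
    by_contra h'
    exact this.2 ⟨h, h'⟩

/-- The characteristic functional of equality. -/
noncomputable def eqChar (M : RCAModel.{u}) : M.carrier (ty1 ⇒ ty0) := (exists_eqChar M).choose

instance isAr_eq {C : Type u} [Ctx M C] (F G : C → M.N) [IsDef F] [IsDef G] :
    IsAr M fun c => F c = G c := by
  refine ⟨?_⟩
  have : (fun c => chi M (F c = G c)) = fun c => eqChar M ⬝ twoSeq (F c) (G c) := by
    funext c
    rw [eqChar, (exists_eqChar M).choose_spec]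
    simp only [twoSeq, lam_app, caseZero_zero, RCAModel.one, caseZero_succ]
  rw [this]
  unfold twoSeq
  infer_instance

/-! ### Kleene's quantifier, unbounded search and arithmetical predicates -/

section

variable [hE : Fact M.Exists2]

variable (M) in
/-- Kleene's quantifier. -/
noncomputable def kleene : M.carrier (ty1 ⇒ ty0) := hE.out.choose

theorem kleene_eq_zero (f : M.Seq) : kleene M ⬝ f = M.zero ↔ ∃ n, f ⬝ n = M.zero :=
  hE.out.choose_spec f

/-- Kleene's quantifier makes the premise `∃ n, f n = 0` quantifier-free, so quantifier-free choice
applies to the implication from this premise to `f m = 0`. -/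
theorem exists_mu (M : RCAModel.{u}) [Fact M.Exists2] : ∃ μ : M.carrier (ty1 ⇒ ty0),
    ∀ f : M.Seq, (∃ n, f ⬝ n = M.zero) → f ⬝ (μ ⬝ f) = M.zero := by
  let F₀ : M.carrier (ty1 ⇒ ty0 ⇒ ty0) := lam fun f => lam fun n => f ⬝ n
  let F₁ : M.carrier (ty1 ⇒ ty0 ⇒ ty0) := lam fun f => lam fun _ => kleene M ⬝ f
  let F₂ : M.carrier (ty1 ⇒ ty0 ⇒ ty0) := lam fun _ => lam fun _ => M.zero
  have h₁ := QFree.atom (Atom := fun A => ∃ F G : M.carrier (ty1 ⇒ ty0 ⇒ ty0),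
      A = fun p : M.carrier ty1 × M.carrier ty0 => F ⬝ p.1 ⬝ p.2 = G ⬝ p.1 ⬝ p.2) ⟨F₀, F₂, rfl⟩
  have h₂ := QFree.atom (Atom := fun A => ∃ F G : M.carrier (ty1 ⇒ ty0 ⇒ ty0),
      A = fun p : M.carrier ty1 × M.carrier ty0 => F ⬝ p.1 ⬝ p.2 = G ⬝ p.1 ⬝ p.2) ⟨F₁, F₂, rfl⟩
  obtain ⟨Φ, hΦ⟩ := M.qf_choice _ (h₁.neg.and h₂).neg (by
    intro f
    simp only [F₀, F₁, F₂, lam_app, kleene_eq_zero]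
    by_cases h : ∃ n, f ⬝ n = M.zero
    · obtain ⟨n, hn⟩ := h
      exact ⟨n, fun h => h.1 hn⟩
    · exact ⟨M.zero, fun h' => h h'.2⟩)
  refine ⟨Φ, fun f hf => ?_⟩
  have := hΦ f
  simp only [F₀, F₁, F₂, lam_app, kleene_eq_zero] at this
  by_contra h
  exact this ⟨h, hf⟩

/-- A natural number with the property `P`, if there is one. -/
noncomputable def eps (P : M.N → Prop) : M.N := (exists_mu M).choose ⬝ lam fun n => chi M (P n)

theorem eps_spec (P : M.N → Prop) [IsAr M fun c : PUnit.{u + 1} × M.N => P c.2] (h : ∃ n, P n) :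
    P (eps P) := by
  have := (exists_mu M).choose_spec (lam fun n => chi M (P n))
  simp only [lam_app, chi_eq_zero] at this
  exact this h

variable {C : Type u} [Ctx M C] {σ τ : FinTy}

instance isDef_eps (P : C → M.N → Prop) [IsAr M fun c : C × M.N => P c.1 c.2] :
    IsDef fun c => eps (P c) := by
  unfold eps; infer_instance

omit hE in
theorem ar_slice (P : C → M.N → Prop) [h : IsAr M fun c : C × M.N => P c.1 c.2] (c : C) :
    IsAr M fun d : PUnit.{u + 1} × M.N => P c d.2 := by
  obtain ⟨⟨G, -, hG⟩⟩ := h.rep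
  refine ⟨?_⟩
  have : (fun d : PUnit.{u + 1} × M.N => chi M (P c d.2)) = fun d => G c ⬝ d.2 := by
    funext d
    rw [hG]
  rw [this]; infer_instance

/-- Kleene's quantifier is evaluated at the characteristic function of `P c`. With the propositional
connectives this amounts to arithmetical comprehension with parameters of all types. -/
instance isAr_exists (P : C → M.N → Prop) [IsAr M fun c : C × M.N => P c.1 c.2] :
    IsAr M fun c => ∃ n, P c n := by
  have : ∀ c, (∃ n, P c n) ↔ P c (eps (P c)) := fun c => by
    have := ar_slice P c
    exact ⟨eps_spec (P c), fun h => ⟨_, h⟩⟩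
  refine isAr_of_iff (fun c => kleene M ⬝ lam fun n => chi M (P c n)) fun c => ?_
  have := ar_slice P c
  simp only [kleene_eq_zero, lam_app, chi_eq_zero]

instance isAr_forall (P : C → M.N → Prop) [IsAr M fun c : C × M.N => P c.1 c.2] :
    IsAr M fun c => ∀ n, P c n := by
  simp only [← not_exists_not (p := P _)]; infer_instance

end

/-- A predicate with a characteristic functional is an equation between two sequences of the model,
hence an atom of quantifier-free induction. -/
theorem induction (P : M.N → Prop) [IsAr M fun c : PUnit.{u + 1} × M.N => P c.2] (n : M.N)
    (zero : P M.zero) (succ : ∀ n, P n → P (M.succ ⬝ n)) : P n := by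
  have h := QFree.atom (Atom := fun A => ∃ f g : M.carrier ty1,
      A = fun n : M.carrier ty0 => f ⬝ n = g ⬝ n)
    ⟨lam fun n => chi M (P n), lam fun _ => M.zero, rfl⟩
  have := M.qf_induction _ h
  simp only [lam_app, chi_eq_zero] at this
  exact this zero succ n

/-! ### The ordered semiring of natural numbers -/

section

variable {C : Type u} [Ctx M C]

instance isDef_natAdd (F G : C → M.N) [IsDef F] [IsDef G] :
    IsDef fun c => RCAModel.add (F c) (G c) := by
  have : RCAModel.lift M.succ = lam fun a => lam fun _ => M.succ ⬝ a := by
    apply M.ext; intro a; apply M.ext; intro b; simp only [RCAModel.lift_app, lam_app]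
  simp only [RCAModel.add, this]; infer_instance

instance isDef_natMul (F G : C → M.N) [IsDef F] [IsDef G] :
    IsDef fun c => RCAModel.mul (F c) (G c) := by
  have (x : M.N) : RCAModel.lift (M.S ⬝ (M.R ⬝ x) ⬝ (M.K ⬝ RCAModel.lift M.succ)) =
      lam fun a => lam fun _ => RCAModel.add a x := by
    apply M.ext; intro a; apply M.ext; intro b
    simp only [RCAModel.lift_app, lam_app, M.S_app, M.K_app, RCAModel.add]
  simp only [RCAModel.mul, this]; infer_instance

instance isDef_mersenne (F : C → M.N) [IsDef F] : IsDef fun c => RCAModel.mersenne (F c) := by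
  unfold RCAModel.mersenne; infer_instance

end

theorem nat_zero_add (x : M.N) : RCAModel.add M.zero x = x :=
  induction (fun x => RCAModel.add M.zero x = x) x (RCAModel.add_zero _) fun n h => by
    rw [RCAModel.add_succ, h]

theorem nat_add_assoc (x y z : M.N) :
    RCAModel.add (RCAModel.add x y) z = RCAModel.add x (RCAModel.add y z) :=
  induction (fun z => RCAModel.add (RCAModel.add x y) z = RCAModel.add x (RCAModel.add y z)) z
    (by simp only [RCAModel.add_zero]) fun n h => by simp only [RCAModel.add_succ, h]

theorem nat_succ_add (x y : M.N) : RCAModel.add (M.succ ⬝ x) y = M.succ ⬝ RCAModel.add x y :=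
  induction (fun y => RCAModel.add (M.succ ⬝ x) y = M.succ ⬝ RCAModel.add x y) y
    (by simp only [RCAModel.add_zero]) fun n h => by simp only [RCAModel.add_succ, h]

theorem nat_add_comm (x y : M.N) : RCAModel.add x y = RCAModel.add y x :=
  induction (fun y => RCAModel.add x y = RCAModel.add y x) y
    (by rw [nat_zero_add, RCAModel.add_zero]) fun n h => by
      rw [RCAModel.add_succ, nat_succ_add, h]

theorem nat_zero_mul (x : M.N) : RCAModel.mul M.zero x = M.zero :=
  induction (fun x => RCAModel.mul M.zero x = M.zero) x (RCAModel.mul_zero _) fun n h => by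
    rw [RCAModel.mul_succ, h, RCAModel.add_zero]

theorem nat_succ_mul (x y : M.N) :
    RCAModel.mul (M.succ ⬝ x) y = RCAModel.add (RCAModel.mul x y) y :=
  induction (fun y => RCAModel.mul (M.succ ⬝ x) y = RCAModel.add (RCAModel.mul x y) y) y
    (by simp only [RCAModel.mul_zero, RCAModel.add_zero]) fun n h => by
      rw [RCAModel.mul_succ, h, RCAModel.mul_succ, RCAModel.add_succ, RCAModel.add_succ,
        nat_add_assoc, nat_add_comm n x, nat_add_assoc]

theorem nat_mul_comm (x y : M.N) : RCAModel.mul x y = RCAModel.mul y x :=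
  induction (fun y => RCAModel.mul x y = RCAModel.mul y x) y
    (by rw [nat_zero_mul, RCAModel.mul_zero]) fun n h => by
      rw [RCAModel.mul_succ, nat_succ_mul, h]

theorem nat_mul_add (x y z : M.N) :
    RCAModel.mul x (RCAModel.add y z) = RCAModel.add (RCAModel.mul x y) (RCAModel.mul x z) :=
  induction (fun z => RCAModel.mul x (RCAModel.add y z) =
    RCAModel.add (RCAModel.mul x y) (RCAModel.mul x z)) z
    (by simp only [RCAModel.mul_zero, RCAModel.add_zero]) fun n h => by
      rw [RCAModel.add_succ, RCAModel.mul_succ, h, RCAModel.mul_succ, nat_add_assoc]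

theorem nat_mul_assoc (x y z : M.N) :
    RCAModel.mul (RCAModel.mul x y) z = RCAModel.mul x (RCAModel.mul y z) :=
  induction (fun z => RCAModel.mul (RCAModel.mul x y) z =
    RCAModel.mul x (RCAModel.mul y z)) z (by simp only [RCAModel.mul_zero]) fun n h => by
      rw [RCAModel.mul_succ, h, RCAModel.mul_succ, nat_mul_add]

theorem nat_mul_one (x : M.N) : RCAModel.mul x M.one = x := by
  rw [RCAModel.one, RCAModel.mul_succ, RCAModel.mul_zero, nat_zero_add]

instance : CommSemiring M.N where
  add := RCAModel.add
  mul := RCAModel.mul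
  zero := M.zero
  one := M.one
  nsmul := @nsmulRec _ ⟨M.zero⟩ ⟨RCAModel.add⟩
  add_assoc := nat_add_assoc
  zero_add := nat_zero_add
  add_zero := RCAModel.add_zero
  add_comm := nat_add_comm
  left_distrib := nat_mul_add
  right_distrib x y z := by
    change RCAModel.mul _ _ = RCAModel.add (RCAModel.mul _ _) (RCAModel.mul _ _)
    rw [nat_mul_comm, nat_mul_comm x, nat_mul_comm y]; exact nat_mul_add z x y
  zero_mul := nat_zero_mul
  mul_zero := RCAModel.mul_zero
  mul_assoc := nat_mul_assoc
  one_mul x := (nat_mul_comm _ _).trans (nat_mul_one x)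
  mul_one := nat_mul_one
  mul_comm := nat_mul_comm

theorem zero_eq : M.zero = 0 := rfl

theorem one_eq : M.one = 1 := rfl

theorem add_eq (x y : M.N) : RCAModel.add x y = x + y := rfl

theorem mul_eq (x y : M.N) : RCAModel.mul x y = x * y := rfl

theorem succ_eq (x : M.N) : M.succ ⬝ x = x + 1 := by
  rw [← add_eq, ← one_eq, RCAModel.one, RCAModel.add_succ, RCAModel.add_zero]

instance isDef_add {C : Type u} [Ctx M C] (F G : C → M.N) [IsDef F] [IsDef G] :
    IsDef fun c => F c + G c := isDef_natAdd F G

instance isDef_mul {C : Type u} [Ctx M C] (F G : C → M.N) [IsDef F] [IsDef G] :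
    IsDef fun c => F c * G c := isDef_natMul F G

theorem nat_induction (P : M.N → Prop) [IsAr M fun c : PUnit.{u + 1} × M.N => P c.2] (n : M.N)
    (zero : P 0) (succ : ∀ n, P n → P (n + 1)) : P n :=
  induction P n zero fun n h => succ_eq n ▸ succ n h

theorem add_one_ne_zero (n : M.N) : n + 1 ≠ 0 := by
  rw [← succ_eq]; exact M.succ_ne_zero n

theorem add_one_inj {m n : M.N} (h : m + 1 = n + 1) : m = n := by
  rw [← succ_eq, ← succ_eq] at h; exact M.succ_inj _ _ h

theorem nat_cases (n : M.N) : n = 0 ∨ ∃ m, n = m + 1 := by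
  by_cases h : n = 0
  · exact Or.inl h
  · obtain ⟨m, hm⟩ := exists_succ h
    exact Or.inr ⟨m, hm.trans (succ_eq m)⟩

theorem nat_add_right_cancel {x y z : M.N} (h : x + z = y + z) : x = y := by
  by_contra hxy
  refine induction (fun z => x + z ≠ y + z) z (by simpa [zero_eq] using hxy) (fun n hn h => ?_) h
  rw [succ_eq, ← add_assoc, ← add_assoc] at h
  exact hn (add_one_inj h)

theorem nat_add_eq_zero {x y : M.N} (h : x + y = 0) : x = 0 ∧ y = 0 := by
  rcases nat_cases y with rfl | ⟨m, rfl⟩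
  · exact ⟨by simpa using h, rfl⟩
  · exact (add_one_ne_zero (x + m) (by rw [add_assoc, h])).elim

/-! ### The linear order of the natural numbers -/

section

variable [Fact M.Exists2]

theorem nat_total (x y : M.N) : (∃ c, x + c = y) ∨ ∃ c, y + c = x := by
  refine nat_induction (fun y => (∃ c, x + c = y) ∨ ∃ c, y + c = x) y (Or.inr ⟨x, zero_add x⟩) ?_
  rintro n (⟨c, rfl⟩ | ⟨c, rfl⟩)
  · exact Or.inl ⟨c + 1, (add_assoc _ _ _).symm⟩
  · rcases nat_cases c with rfl | ⟨m, rfl⟩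
    · exact Or.inl ⟨1, by rw [add_zero]⟩
    · exact Or.inr ⟨m, by rw [add_assoc, add_comm 1]⟩

open Classical in
noncomputable instance : LinearOrder M.N where
  le := RCAModel.le
  le_refl x := ⟨0, add_zero x⟩
  le_trans := by
    rintro x y z ⟨c, rfl⟩ ⟨d, rfl⟩
    exact ⟨c + d, (add_assoc _ _ _).symm⟩
  le_antisymm := by
    rintro x y ⟨c, rfl⟩ ⟨d, hd⟩
    have : c + d + x = 0 + x := by
      rw [zero_add, add_comm, ← add_assoc]; exact hd
    have hc : c = 0 := (nat_add_eq_zero (nat_add_right_cancel this)).1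
    rw [hc]
    exact (add_zero x).symm
  le_total := nat_total
  toDecidableLE := Classical.decRel _

theorem le_iff (x y : M.N) : RCAModel.le x y ↔ x ≤ y := Iff.rfl

theorem nat_le_def {x y : M.N} : x ≤ y ↔ ∃ c, x + c = y := Iff.rfl

theorem nat_lt_iff {x y : M.N} : x < y ↔ x + 1 ≤ y := by
  constructor
  · intro h
    obtain ⟨c, rfl⟩ := h.le
    rcases nat_cases c with rfl | ⟨m, rfl⟩
    · exact (h.ne (add_zero x).symm).elim
    · exact ⟨m, by change x + 1 + m = x + (m + 1); rw [add_assoc, add_comm 1]⟩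
  · rintro ⟨c, rfl⟩
    refine lt_of_le_of_ne ⟨1 + c, (add_assoc _ _ _).symm⟩ fun h => ?_
    have : c + 1 + x = 0 + x := by rw [zero_add, add_comm, add_comm c, ← add_assoc]; exact h.symm
    exact add_one_ne_zero c (nat_add_right_cancel this)

theorem lt_iff (x y : M.N) : RCAModel.lt x y ↔ x < y := by
  rw [nat_lt_iff]
  refine exists_congr fun c => ?_
  rw [succ_eq, add_eq, add_eq, add_comm c, add_assoc]

instance : IsOrderedAddMonoid M.N where
  add_le_add_left := by
    rintro x y ⟨c, rfl⟩ z
    exact ⟨c, by change x + z + c = x + c + z; ring⟩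

instance : IsOrderedCancelAddMonoid M.N where
  le_of_add_le_add_left := by
    rintro x y z ⟨c, hc⟩
    refine ⟨c, nat_add_right_cancel (z := x) ?_⟩
    change x + y + c = x + z at hc
    change y + c + x = z + x
    rw [add_comm z, ← hc]; ring

instance : CanonicallyOrderedAdd M.N where
  exists_add_of_le := by rintro x y ⟨c, rfl⟩; exact ⟨c, rfl⟩
  le_add_self x y := ⟨y, by change x + y = y + x; ring⟩
  le_self_add x y := ⟨y, rfl⟩

theorem nat_mul_lt_mul {a b c : M.N} (ha : 0 < a) (h : b < c) : a * b < a * c := by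
  obtain ⟨k, rfl⟩ := (nat_cases a).resolve_left (ne_of_gt ha)
  obtain ⟨m, rfl⟩ := nat_lt_iff.1 h
  refine nat_lt_iff.2 ⟨k * m + m + k, ?_⟩
  change (k + 1) * b + 1 + (k * m + m + k) = (k + 1) * (b + 1 + m)
  ring

instance : IsStrictOrderedRing M.N where
  zero_le_one := zero_le
  exists_pair_ne := ⟨0, 1, fun h => add_one_ne_zero (0 : M.N) (by rw [zero_add, h])⟩
  mul_lt_mul_of_pos_left _ ha _ _ h := nat_mul_lt_mul ha h
  mul_lt_mul_of_pos_right a ha b c h := by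
    rw [mul_comm b, mul_comm c]
    exact nat_mul_lt_mul ha h

section

variable {C : Type u} [Ctx M C]

instance isAr_le (F G : C → M.N) [IsDef F] [IsDef G] : IsAr M fun c => F c ≤ G c := by
  simp only [nat_le_def]; infer_instance

instance isAr_lt (F G : C → M.N) [IsDef F] [IsDef G] : IsAr M fun c => F c < G c := by
  simp only [nat_lt_iff]; infer_instance

end

/-- The code lies between `(a + b) ^ 2` and `(a + b + 1) ^ 2`, the latter excluded, so it determines
`a + b` and then `a`. -/
theorem pair_inj {a b c d : M.N} (h : RCAModel.pair a b = RCAModel.pair c d) : a = c ∧ b = d := by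
  simp only [RCAModel.pair, add_eq, mul_eq] at h
  have key : ∀ a b c d : M.N, (a + b) * (a + b) + a = (c + d) * (c + d) + c → a + b ≤ c + d := by
    intro a b c d h
    by_contra! hlt
    obtain ⟨e, he⟩ := nat_lt_iff.1 hlt
    change c + d + 1 + e = a + b at he
    have : (c + d) * (c + d) + c < (a + b) * (a + b) := by
      rw [← he]
      have : (c + d + 1 + e) * (c + d + 1 + e) =
        ((c + d) * (c + d) + c) + (c + (d + d) + 1 + (2 * e * (c + d + 1) + e * e)) := by ring
      rw [this]
      exact lt_add_of_pos_right _ (by positivity)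
    exact absurd (h ▸ this) (not_lt.2 (self_le_add_right _ _))
  have hs : a + b = c + d := le_antisymm (key _ _ _ _ h) (key _ _ _ _ h.symm)
  rw [hs] at h
  have ha : a = c := add_left_cancel h
  subst ha
  exact ⟨rfl, add_left_cancel hs⟩

theorem le_pair_right (a b : M.N) : b ≤ RCAModel.pair a b := by
  simp only [RCAModel.pair, add_eq, mul_eq]
  rcases nat_cases b with rfl | ⟨m, rfl⟩
  · exact zero_le
  · rw [show (a + (m + 1)) * (a + (m + 1)) + a =
      m + 1 + (a * a + 2 * a * (m + 1) + m * m + m + a) by ring]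
    exact self_le_add_right _ _

end

end

/-! ### The field of fractions of an ordered semiring -/

section

variable (N : Type u) [CommSemiring N] [LinearOrder N] [IsStrictOrderedRing N]

/-- The formal fraction `(pos - neg) / den`. -/
structure PreFrac : Type u where
  pos : N
  neg : N
  den : N
  den_pos : 0 < den

variable {N}

/-- Each hypothesis is multiplied by the denominator missing in it; in the sum of the two, the terms
of `q` and the factor `q.den` cancel without any subtraction. -/
theorem preFrac_le_trans (p q r : PreFrac N)
    (hpq : p.pos * q.den + q.neg * p.den ≤ q.pos * p.den + p.neg * q.den)
    (hqr : q.pos * r.den + r.neg * q.den ≤ r.pos * q.den + q.neg * r.den) :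
    p.pos * r.den + r.neg * p.den ≤ r.pos * p.den + p.neg * r.den := by
  have h₁ := mul_le_mul_of_nonneg_right hpq r.den_pos.le
  have h₂ := mul_le_mul_of_nonneg_right hqr p.den_pos.le
  have h := add_le_add h₁ h₂
  refine le_of_mul_le_mul_left (a := q.den) ?_ q.den_pos
  refine le_of_add_le_add_right (a := q.neg * p.den * r.den + q.pos * r.den * p.den) ?_
  convert h using 1 <;> ring

instance : Preorder (PreFrac N) where
  le p q := p.pos * q.den + q.neg * p.den ≤ q.pos * p.den + p.neg * q.den
  le_refl _ := le_rfl
  le_trans := preFrac_le_trans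

theorem PreFrac.le_def (p q : PreFrac N) :
    p ≤ q ↔ p.pos * q.den + q.neg * p.den ≤ q.pos * p.den + p.neg * q.den := Iff.rfl

instance : @Std.Total (PreFrac N) (· ≤ ·) :=
  ⟨fun p q => by
    rw [PreFrac.le_def, PreFrac.le_def, add_comm (p.pos * _), add_comm (q.pos * _)]
    rcases le_total (q.neg * p.den + p.pos * q.den) (p.neg * q.den + q.pos * p.den) with h | h
    · exact Or.inl h
    · exact Or.inr (by convert h using 1)⟩

variable (N) in
/-- The ordered field of fractions. -/
def FracField : Type u := Antisymmetrization (PreFrac N) (· ≤ ·)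

namespace FracField

def mk (p : PreFrac N) : FracField N := toAntisymmetrization _ p

theorem ind {P : FracField N → Prop} (h : ∀ p, P (mk p)) (x : FracField N) : P x :=
  Quotient.ind h x

open Classical in
noncomputable instance : LinearOrder (FracField N) :=
  inferInstanceAs (LinearOrder (Antisymmetrization (PreFrac N) (· ≤ ·)))

theorem mk_le_mk {p q : PreFrac N} :
    mk p ≤ mk q ↔ p.pos * q.den + q.neg * p.den ≤ q.pos * p.den + p.neg * q.den := Iff.rfl

theorem mk_eq_mk {p q : PreFrac N} :
    mk p = mk q ↔ p.pos * q.den + q.neg * p.den = q.pos * p.den + p.neg * q.den := by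
  rw [le_antisymm_iff, le_antisymm_iff, mk_le_mk, mk_le_mk, add_comm (q.pos * _),
    add_comm (p.pos * _), add_comm (q.neg * _), add_comm (p.neg * _)]

theorem sound {p q : PreFrac N} : AntisymmRel (· ≤ ·) p q ↔ mk p = mk q :=
  (Quotient.eq (r := AntisymmRel.setoid (PreFrac N) (· ≤ ·))).symm

def preAdd (p q : PreFrac N) : PreFrac N :=
  ⟨p.pos * q.den + q.pos * p.den, p.neg * q.den + q.neg * p.den, p.den * q.den,
    mul_pos p.den_pos q.den_pos⟩

def preMul (p q : PreFrac N) : PreFrac N :=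
  ⟨p.pos * q.pos + p.neg * q.neg, p.pos * q.neg + p.neg * q.pos, p.den * q.den,
    mul_pos p.den_pos q.den_pos⟩

theorem preAdd_comm (p q : PreFrac N) : preAdd p q = preAdd q p := by
  simp only [preAdd, PreFrac.mk.injEq]
  refine ⟨?_, ?_, ?_⟩ <;> ring

theorem preMul_comm (p q : PreFrac N) : preMul p q = preMul q p := by
  simp only [preMul, PreFrac.mk.injEq]
  refine ⟨?_, ?_, ?_⟩ <;> ring

theorem preAdd_congr {p p' : PreFrac N} (q : PreFrac N) (h : mk p = mk p') :
    mk (preAdd p q) = mk (preAdd p' q) := by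
  rw [mk_eq_mk] at h ⊢
  simp only [preAdd]
  calc _ = q.den * q.den * (p.pos * p'.den + p'.neg * p.den) +
        p.den * p'.den * q.den * (q.pos + q.neg) := by ring
    _ = _ := by rw [h]; ring

theorem preMul_congr {p p' : PreFrac N} (q : PreFrac N) (h : mk p = mk p') :
    mk (preMul p q) = mk (preMul p' q) := by
  rw [mk_eq_mk] at h ⊢
  simp only [preMul]
  calc _ = q.den * (q.pos * (p.pos * p'.den + p'.neg * p.den) +
        q.neg * (p'.pos * p.den + p.neg * p'.den)) := by ring
    _ = q.den * (q.pos * (p'.pos * p.den + p.neg * p'.den) +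
        q.neg * (p.pos * p'.den + p'.neg * p.den)) := by rw [h]
    _ = _ := by ring

def preNeg (p : PreFrac N) : PreFrac N := ⟨p.neg, p.pos, p.den, p.den_pos⟩

def preNat (n : N) : PreFrac N := ⟨n, 0, 1, one_pos⟩

instance : Add (FracField N) :=
  ⟨Quotient.map₂ preAdd fun p p' hp q q' hq => sound.2 <| by
    rw [preAdd_congr q (sound.1 hp), preAdd_comm, preAdd_congr p' (sound.1 hq), preAdd_comm]⟩

instance : Mul (FracField N) :=
  ⟨Quotient.map₂ preMul fun p p' hp q q' hq => sound.2 <| by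
    rw [preMul_congr q (sound.1 hp), preMul_comm, preMul_congr p' (sound.1 hq), preMul_comm]⟩

instance : Neg (FracField N) :=
  ⟨Quotient.map preNeg fun p p' hp => sound.2 <| by
    have := mk_eq_mk.1 (sound.1 hp)
    rw [mk_eq_mk]
    simp only [preNeg]
    rw [add_comm, add_comm (p'.neg * _), this]⟩

instance : Zero (FracField N) := ⟨mk (preNat 0)⟩

instance : One (FracField N) := ⟨mk (preNat 1)⟩

theorem mk_add (p q : PreFrac N) : mk p + mk q = mk (preAdd p q) := rfl

theorem mk_mul (p q : PreFrac N) : mk p * mk q = mk (preMul p q) := rfl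

theorem mk_neg (p : PreFrac N) : - mk p = mk (preNeg p) := rfl

theorem zero_def : (0 : FracField N) = mk (preNat 0) := rfl

theorem one_def : (1 : FracField N) = mk (preNat 1) := rfl

theorem fracField_add_comm (x y : FracField N) : x + y = y + x := by
  induction x using ind with | h p
  induction y using ind with | h q
  rw [mk_add, mk_add, preAdd_comm]

theorem fracField_mul_comm (x y : FracField N) : x * y = y * x := by
  induction x using ind with | h p
  induction y using ind with | h q
  rw [mk_mul, mk_mul, preMul_comm]

theorem fracField_mul_add (x y z : FracField N) : x * (y + z) = x * y + x * z := by
  induction x using ind with | h p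
  induction y using ind with | h q
  induction z using ind with | h r
  simp only [mk_mul, mk_add, mk_eq_mk, preMul, preAdd]; ring

theorem fracField_zero_add (x : FracField N) : 0 + x = x := by
  induction x using ind with | h p
  simp only [zero_def, mk_add, mk_eq_mk, preAdd, preNat]; ring

theorem fracField_one_mul (x : FracField N) : 1 * x = x := by
  induction x using ind with | h p
  simp only [one_def, mk_mul, mk_eq_mk, preMul, preNat]; ring

theorem fracField_zero_mul (x : FracField N) : 0 * x = 0 := by
  induction x using ind with | h p
  simp only [zero_def, mk_mul, mk_eq_mk, preMul, preNat]; ring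

noncomputable instance : CommRing (FracField N) where
  add_assoc x y z := by
    induction x using ind with | h p
    induction y using ind with | h q
    induction z using ind with | h r
    simp only [mk_add, mk_eq_mk, preAdd]; ring
  add_comm := fracField_add_comm
  zero_add := fracField_zero_add
  add_zero x := (fracField_add_comm _ _).trans (fracField_zero_add x)
  neg_add_cancel x := by
    induction x using ind with | h p
    simp only [zero_def, mk_add, mk_neg, mk_eq_mk, preAdd, preNeg, preNat]; ring
  mul_assoc x y z := by
    induction x using ind with | h p
    induction y using ind with | h q
    induction z using ind with | h r
    simp only [mk_mul, mk_eq_mk, preMul]; ring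
  mul_comm := fracField_mul_comm
  one_mul := fracField_one_mul
  mul_one x := (fracField_mul_comm _ _).trans (fracField_one_mul x)
  zero_mul := fracField_zero_mul
  mul_zero x := (fracField_mul_comm _ _).trans (fracField_zero_mul x)
  left_distrib := fracField_mul_add
  right_distrib x y z := by
    rw [fracField_mul_comm, fracField_mul_add, fracField_mul_comm z, fracField_mul_comm z]
  nsmul := nsmulRec
  zsmul := zsmulRec

theorem add_le_add_right' (x y z : FracField N) (h : x ≤ y) : x + z ≤ y + z := by
  induction x using ind with | h p
  induction y using ind with | h q
  induction z using ind with | h r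
  rw [mk_le_mk] at h
  simp only [mk_add, mk_le_mk, preAdd]
  have := mul_le_mul_of_nonneg_left h (mul_pos r.den_pos r.den_pos).le
  convert add_le_add_left this (p.den * q.den * r.den * (r.pos + r.neg)) using 1 <;> ring

theorem mk_pos {p : PreFrac N} : 0 < mk p ↔ p.neg < p.pos := by
  rw [← not_le, ← not_le, not_iff_not, zero_def, mk_le_mk]
  simp [preNat]

instance : IsOrderedAddMonoid (FracField N) where
  add_le_add_left x y h z := add_le_add_right' x y z h

theorem ne_of_mk_pos {p : PreFrac N} (h : p.neg < p.pos) : mk p ≠ 0 := (mk_pos.2 h).ne'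

instance : Nontrivial (FracField N) :=
  ⟨⟨1, 0, ne_of_mk_pos (by simp [preNat])⟩⟩

variable [ExistsAddOfLE N]

/-- `ExistsAddOfLE` supplies the missing subtraction. A representative without negative part makes
products of positive elements visibly positive, and it is inverted by exchanging numerator and
denominator. -/
theorem mk_eq_of_pos {p : PreFrac N} (h : p.neg < p.pos) :
    ∃ c d, ∃ hd : 0 < d, 0 < c ∧ mk p = mk ⟨c, 0, d, hd⟩ := by
  obtain ⟨c, hc⟩ := exists_add_of_le h.le
  refine ⟨c, p.den, p.den_pos, ?_, ?_⟩
  · rw [hc] at h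
    simpa using h
  · rw [mk_eq_mk, hc]; ring

theorem pos_mul {x y : FracField N} (hx : 0 < x) (hy : 0 < y) : 0 < x * y := by
  induction x using ind with | h p
  induction y using ind with | h q
  obtain ⟨a, b, hb, ha, h₁⟩ := mk_eq_of_pos (mk_pos.1 hx)
  obtain ⟨c, d, hd, hc, h₂⟩ := mk_eq_of_pos (mk_pos.1 hy)
  rw [h₁, h₂, mk_mul, mk_pos]
  simpa [preMul] using mul_pos ha hc

instance : ZeroLEOneClass (FracField N) := ⟨(mk_pos.2 (by simp [preNat])).le⟩

instance : IsStrictOrderedRing (FracField N) := .of_mul_pos fun _ _ => pos_mul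

theorem exists_inv_of_pos {x : FracField N} (hx : 0 < x) : ∃ y, x * y = 1 := by
  induction x using ind with | h p
  obtain ⟨a, b, hb, ha, h₁⟩ := mk_eq_of_pos (mk_pos.1 hx)
  refine ⟨mk ⟨b, 0, a, ha⟩, ?_⟩
  rw [h₁, one_def, mk_mul, mk_eq_mk]
  simp only [preMul, preNat]; ring

theorem fracField_isField : IsField (FracField N) where
  exists_pair_ne := exists_pair_ne _
  mul_comm := mul_comm
  mul_inv_cancel {x} hx := by
    rcases lt_or_gt_of_ne hx with h | h
    · obtain ⟨y, hy⟩ := exists_inv_of_pos (neg_pos.2 h)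
      exact ⟨-y, by rw [← hy]; ring⟩
    · exact exists_inv_of_pos h

noncomputable instance : Field (FracField N) := fracField_isField.toField

/-- The embedding of the semiring. -/
def ofNat : N →+* FracField N where
  toFun n := mk (preNat n)
  map_one' := rfl
  map_zero' := rfl
  map_add' m n := by simp only [mk_add, mk_eq_mk, preAdd, preNat]; ring
  map_mul' m n := by simp only [mk_mul, mk_eq_mk, preMul, preNat]; ring

theorem ofNat_le {m n : N} : ofNat m ≤ ofNat n ↔ m ≤ n := by
  change mk (preNat m) ≤ mk (preNat n) ↔ _
  rw [mk_le_mk]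
  simp [preNat]

theorem ofNat_inj {m n : N} : ofNat m = ofNat n ↔ m = n := by
  rw [le_antisymm_iff, le_antisymm_iff, ofNat_le, ofNat_le]

theorem ofNat_nonneg {n : N} (hn : 0 ≤ n) : 0 ≤ ofNat n := by
  rwa [← map_zero ofNat, ofNat_le]

theorem mk_eq_div (p : PreFrac N) : mk p = (ofNat p.pos - ofNat p.neg) / ofNat p.den := by
  have h : ofNat p.den ≠ 0 := by
    rw [← map_zero ofNat, Ne, ofNat_inj]; exact p.den_pos.ne'
  rw [eq_div_iff h, eq_sub_iff_add_eq]
  change mk p * mk (preNat _) + mk (preNat _) = mk (preNat _)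
  simp only [mk_add, mk_mul, mk_eq_mk, preAdd, preMul, preNat]; ring

end FracField

end

section

variable {M : RCAModel.{u}} [Fact M.Exists2]

/-! ### The rational numbers of the model -/

variable (M) in
/-- The ordered field of rational numbers of the model. -/
def QQ : Type u := FracField M.N

noncomputable instance : Field (QQ M) := inferInstanceAs (Field (FracField M.N))

noncomputable instance : LinearOrder (QQ M) := inferInstanceAs (LinearOrder (FracField M.N))

instance : IsStrictOrderedRing (QQ M) := inferInstanceAs (IsStrictOrderedRing (FracField M.N))

instance : IsOrderedRing (QQ M) := inferInstance

instance : IsOrderedAddMonoid (QQ M) := inferInstance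

/-- The natural numbers as rational numbers. -/
noncomputable def nn : M.N →+* QQ M := FracField.ofNat (N := M.N)

theorem nn_le {m n : M.N} : nn m ≤ nn n ↔ m ≤ n := FracField.ofNat_le

theorem nn_nonneg (n : M.N) : 0 ≤ nn n := FracField.ofNat_nonneg zero_le

theorem nn_add_one_pos (n : M.N) : 0 < nn n + 1 := by linarith [nn_nonneg n]

theorem nn_add_one (n : M.N) : nn (n + 1) = nn n + 1 := by simp

theorem nn_lt {m n : M.N} (h : nn m < nn n) : nn m + 1 ≤ nn n := by
  rw [← not_le, nn_le, not_le, nat_lt_iff] at h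
  rwa [← nn_add_one, nn_le]

/-- The value of a fraction. -/
noncomputable def val (r : M.Frac) : QQ M := (nn r.pos - nn r.neg) / (nn r.den + 1)

theorem val_le {r s : M.Frac} : r.le s ↔ val r ≤ val s := by
  rw [val, val, div_le_div_iff₀ (nn_add_one_pos _) (nn_add_one_pos _), RCAModel.Frac.le, le_iff,
    ← nn_le]
  simp only [succ_eq, add_eq, mul_eq, map_add, map_mul, map_one]
  constructor <;> intro h <;> linarith

theorem val_add (r s : M.Frac) : val (r.add s) = val r + val s := by
  have h₁ := (nn_add_one_pos r.den).ne'
  have h₂ := (nn_add_one_pos s.den).ne'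
  have h₃ := (nn_add_one_pos (r.add s).den).ne'
  simp only [val]
  rw [div_add_div _ _ h₁ h₂, div_eq_div_iff h₃ (mul_ne_zero h₁ h₂)]
  simp only [RCAModel.Frac.add, succ_eq, add_eq, mul_eq, map_add, map_mul, map_one]
  ring

theorem exists_val (q : QQ M) : ∃ r : M.Frac, val r = q := by
  induction q using FracField.ind with | h p
  obtain ⟨d, hd⟩ := (nat_cases p.den).resolve_left p.den_pos.ne'
  refine ⟨⟨p.pos, p.neg, d⟩, ?_⟩
  rw [val, ← nn_add_one, ← hd]
  exact (FracField.mk_eq_div p).symm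

/-- The rational number `2 ^ (-k)`. -/
noncomputable def ex (k : M.N) : QQ M := 1 / (nn (RCAModel.mersenne k) + 1)

theorem val_twoPowNeg (k : M.N) : val (RCAModel.twoPowNeg k) = ex k := by
  simp [val, RCAModel.twoPowNeg, ex, one_eq, zero_eq]

theorem ex_pos (k : M.N) : 0 < ex k := one_div_pos.2 (nn_add_one_pos _)

theorem ex_zero : ex (0 : M.N) = 1 := by
  rw [ex, ← zero_eq, RCAModel.mersenne_zero, zero_eq]; simp

theorem ex_add_one (k : M.N) : ex (k + 1) = ex k / 2 := by
  have h := (nn_add_one_pos (RCAModel.mersenne k)).ne'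
  rw [ex, ex, ← succ_eq, RCAModel.mersenne_succ, succ_eq, nn_add_one, add_eq, map_add, div_div]
  congr 1; ring

theorem distLe_iff {r s t : M.Frac} : r.distLe s t ↔ |val r - val s| ≤ val t := by
  rw [RCAModel.Frac.distLe, val_le, val_le, val_add, val_add, abs_le]
  constructor <;> rintro ⟨h₁, h₂⟩ <;> constructor <;> linarith

/-! ### Definable families of rational numbers -/

/-- `F` is given by functionals of the model for the numerators and the denominator. -/
class IsRatDef {C : Type u} [Ctx M C] (F : C → QQ M) : Prop where
  rep : ∃ p n d : C → M.N, IsDef p ∧ IsDef n ∧ IsDef d ∧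
    ∀ c, F c = (nn (p c) - nn (n c)) / (nn (d c) + 1)

section

variable {C : Type u} [Ctx M C] {σ : FinTy}

instance (priority := 1100) isRatDef_const (q : QQ M) : IsRatDef fun _ : C => q := by
  obtain ⟨r, rfl⟩ := exists_val q
  exact ⟨_, _, _, isDef_const r.pos, isDef_const r.neg, isDef_const r.den, fun _ => rfl⟩

instance (priority := 900) isRatDef_weak (F : C → QQ M) [h : IsRatDef F] :
    IsRatDef fun c : C × M.carrier σ => F c.1 := by
  obtain ⟨p, n, d, hp, hn, hd, h⟩ := h.rep
  exact ⟨_, _, _, isDef_weak p, isDef_weak n, isDef_weak d, fun c => h c.1⟩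

instance (priority := 890) isRatDef_weak₂ {τ : FinTy} (F : C → QQ M) [IsRatDef F] :
    IsRatDef fun c : (C × M.carrier σ) × M.carrier τ => F c.1.1 :=
  isRatDef_weak (C := C × M.carrier σ) fun c => F c.1

instance isRatDef_nn (F : C → M.N) [IsDef F] : IsRatDef fun c => nn (F c) :=
  ⟨F, fun _ => 0, fun _ => 0, inferInstance, inferInstance, inferInstance, fun c => by simp⟩

instance isRatDef_ex (F : C → M.N) [IsDef F] : IsRatDef fun c => ex (F c) :=
  ⟨fun _ => 1, fun _ => 0, fun c => RCAModel.mersenne (F c), inferInstance, inferInstance,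
    inferInstance, fun c => by simp [ex]⟩

instance isRatDef_neg (F : C → QQ M) [h : IsRatDef F] : IsRatDef fun c => - F c := by
  obtain ⟨p, n, d, hp, hn, hd, h⟩ := h.rep
  exact ⟨n, p, d, hn, hp, hd, fun c => by rw [h, ← neg_div, neg_sub]⟩

instance isRatDef_add (F G : C → QQ M) [hF : IsRatDef F] [hG : IsRatDef G] :
    IsRatDef fun c => F c + G c := by
  obtain ⟨p, n, d, hp, hn, hd, h⟩ := hF.rep
  obtain ⟨p', n', d', hp', hn', hd', h'⟩ := hG.rep
  refine ⟨fun c => p c * (d' c + 1) + p' c * (d c + 1), fun c => n c * (d' c + 1) + n' c * (d c + 1),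
    fun c => d c * d' c + (d c + d' c), inferInstance, inferInstance, inferInstance, fun c => ?_⟩
  have h₁ := (nn_add_one_pos (d c)).ne'
  have h₂ := (nn_add_one_pos (d' c)).ne'
  have h₃ := (nn_add_one_pos (d c * d' c + (d c + d' c))).ne'
  rw [h, h', div_add_div _ _ h₁ h₂, div_eq_div_iff (mul_ne_zero h₁ h₂) h₃]
  simp only [map_add, map_mul, map_one]
  ring

instance isRatDef_sub (F G : C → QQ M) [IsRatDef F] [IsRatDef G] :
    IsRatDef fun c => F c - G c := by
  simp only [sub_eq_add_neg]; infer_instance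

instance isRatDef_mul (F G : C → QQ M) [hF : IsRatDef F] [hG : IsRatDef G] :
    IsRatDef fun c => F c * G c := by
  obtain ⟨p, n, d, hp, hn, hd, h⟩ := hF.rep
  obtain ⟨p', n', d', hp', hn', hd', h'⟩ := hG.rep
  refine ⟨fun c => p c * p' c + n c * n' c, fun c => p c * n' c + n c * p' c,
    fun c => d c * d' c + (d c + d' c), inferInstance, inferInstance, inferInstance, fun c => ?_⟩
  have h₁ := (nn_add_one_pos (d c)).ne'
  have h₂ := (nn_add_one_pos (d' c)).ne'
  have h₃ := (nn_add_one_pos (d c * d' c + (d c + d' c))).ne'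
  rw [h, h', div_mul_div_comm, div_eq_div_iff (mul_ne_zero h₁ h₂) h₃]
  simp only [map_add, map_mul]
  ring

instance isRatDef_ite (P : C → Prop) [DecidablePred P] (F G : C → QQ M) [IsAr M P] [hF : IsRatDef F]
    [hG : IsRatDef G] : IsRatDef fun c => if P c then F c else G c := by
  obtain ⟨p, n, d, hp, hn, hd, h⟩ := hF.rep
  obtain ⟨p', n', d', hp', hn', hd', h'⟩ := hG.rep
  refine ⟨fun c => sel (P c) (p c) (p' c), fun c => sel (P c) (n c) (n' c),
    fun c => sel (P c) (d c) (d' c), inferInstance, inferInstance, inferInstance, fun c => ?_⟩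
  by_cases hc : P c
  · simp only [sel_of hc, if_pos hc, h]
  · simp only [sel_of_not hc, if_neg hc, h']

instance isAr_rat_le (F G : C → QQ M) [hF : IsRatDef F] [hG : IsRatDef G] :
    IsAr M fun c => F c ≤ G c := by
  obtain ⟨p, n, d, hp, hn, hd, h⟩ := hF.rep
  obtain ⟨p', n', d', hp', hn', hd', h'⟩ := hG.rep
  have : ∀ c, F c ≤ G c ↔
      p c * (d' c + 1) + n' c * (d c + 1) ≤ p' c * (d c + 1) + n c * (d' c + 1) := fun c => by
    rw [h, h', div_le_div_iff₀ (nn_add_one_pos _) (nn_add_one_pos _),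
      ← nn_le]
    simp only [map_add, map_mul, map_one]
    constructor <;> intro h <;> linarith
  simp only [this]; infer_instance

instance isAr_rat_lt (F G : C → QQ M) [IsRatDef F] [IsRatDef G] : IsAr M fun c => F c < G c := by
  simp only [← not_le]; infer_instance

instance isAr_rat_eq (F G : C → QQ M) [IsRatDef F] [IsRatDef G] : IsAr M fun c => F c = G c := by
  simp only [le_antisymm_iff]; infer_instance

instance isRatDef_abs (F : C → QQ M) [IsRatDef F] : IsRatDef fun c => |F c| := by
  have : ∀ c, |F c| = if 0 ≤ F c then F c else - F c := fun c => by
    split_ifs with h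
    · exact abs_of_nonneg h
    · exact abs_of_nonpos (not_le.1 h).le
  simp only [this]; infer_instance

end

/-! ### The Archimedean property, relative to the numbers of the model -/

theorem ex_anti {j k : M.N} (h : j ≤ k) : ex k ≤ ex j := by
  obtain ⟨c, rfl⟩ := h
  change ex (j + c) ≤ ex j
  refine nat_induction (fun c => ex (j + c) ≤ ex j) c (by simp) fun n h => ?_
  rw [← add_assoc, ex_add_one]
  linarith [ex_pos (j + n)]

/-- This is `n + 1 ≤ 2 ^ n` inside the model; through it the powers `ex k` get below every positive
rational number. -/
theorem nn_mul_ex_le (n : M.N) : (nn n + 1) * ex n ≤ 1 := by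
  refine nat_induction (fun n => (nn n + 1) * ex n ≤ 1) n (by simp [ex_zero]) fun n h => ?_
  rw [nn_add_one, ex_add_one]
  have := mul_nonneg (nn_nonneg n) (ex_pos n).le
  linarith

theorem exists_lt_nn (q : QQ M) : ∃ n : M.N, q < nn n := by
  obtain ⟨r, rfl⟩ := exists_val q
  refine ⟨r.pos + 1, ?_⟩
  rw [val, div_lt_iff₀ (nn_add_one_pos _), nn_add_one]
  nlinarith [nn_nonneg r.pos, nn_nonneg r.neg, nn_nonneg r.den,
    mul_nonneg (nn_nonneg r.pos) (nn_nonneg r.den)]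

theorem exists_ex_lt {q : QQ M} (hq : 0 < q) : ∃ k : M.N, ex k < q := by
  obtain ⟨n, hn⟩ := exists_lt_nn q⁻¹
  refine ⟨n, ?_⟩
  have h := nn_mul_ex_le n
  have h₁ : 1 < q * nn n := by
    have := mul_lt_mul_of_pos_left hn hq
    rwa [mul_inv_cancel₀ hq.ne'] at this
  by_contra! hle
  nlinarith [ex_pos n, mul_le_mul_of_nonneg_right hle (nn_nonneg n)]

theorem exists_floor_nonneg {q : QQ M} (hq : 0 ≤ q) : ∃ n : M.N, nn n ≤ q ∧ q < nn n + 1 := by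
  obtain ⟨n, hn⟩ := exists_lt_nn q
  refine nat_induction (fun n => q < nn n → ∃ m : M.N, nn m ≤ q ∧ q < nn m + 1) n ?_ ?_ hn
  · intro h
    rw [map_zero] at h
    exact absurd hq (not_le.2 h)
  · intro n ih h
    rw [nn_add_one] at h
    rcases lt_or_ge q (nn n) with h' | h'
    · exact ih h'
    · exact ⟨n, h', h⟩

theorem exists_floor (q : QQ M) : ∃ a b : M.N, nn a - nn b ≤ q ∧ q < nn a - nn b + 1 := by
  obtain ⟨b, hb⟩ := exists_lt_nn (-q)
  obtain ⟨a, h₁, h₂⟩ := exists_floor_nonneg (q := q + nn b) (by linarith)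
  exact ⟨a, b, by linarith, by linarith⟩

/-! ### Codes of rational numbers -/

/-- The numerator of the positive part of the fraction with code `m`. -/
noncomputable def codePos (m : M.N) : M.N :=
  eps fun p => ∃ n d : M.N, m = RCAModel.pair (RCAModel.pair p n) d

noncomputable def codeNeg (m : M.N) : M.N :=
  eps fun n => ∃ p d : M.N, m = RCAModel.pair (RCAModel.pair p n) d

noncomputable def codeDen (m : M.N) : M.N :=
  eps fun d => ∃ p n : M.N, m = RCAModel.pair (RCAModel.pair p n) d

/-- The rational number with code `m`. -/
noncomputable def vc (m : M.N) : QQ M := val ⟨codePos m, codeNeg m, codeDen m⟩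

instance isDef_pair {C : Type u} [Ctx M C] (F G : C → M.N) [IsDef F] [IsDef G] :
    IsDef fun c => RCAModel.pair (F c) (G c) := by
  unfold RCAModel.pair; infer_instance

instance isRatDef_vc {C : Type u} [Ctx M C] (F : C → M.N) [IsDef F] :
    IsRatDef fun c => vc (F c) :=
  ⟨fun c => codePos (F c), fun c => codeNeg (F c), fun c => codeDen (F c),
    by unfold codePos; infer_instance, by unfold codeNeg; infer_instance,
    by unfold codeDen; infer_instance, fun _ => rfl⟩

omit [Fact M.Exists2] in
theorem isRat_iff (m : M.N) : RCAModel.IsRat m ↔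
    ∃ p n d : M.N, m = RCAModel.pair (RCAModel.pair p n) d :=
  ⟨fun ⟨r, hr⟩ => ⟨r.pos, r.neg, r.den, hr⟩, fun ⟨p, n, d, h⟩ => ⟨⟨p, n, d⟩, h⟩⟩

instance isAr_isRat {C : Type u} [Ctx M C] (F : C → M.N) [IsDef F] :
    IsAr M fun c => RCAModel.IsRat (F c) := by
  simp only [isRat_iff]; infer_instance

theorem vc_code (r : M.Frac) : vc r.code = val r := by
  have hp := eps_spec (fun p => ∃ n d : M.N, r.code = RCAModel.pair (RCAModel.pair p n) d)
    ⟨_, _, _, rfl⟩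
  have hn := eps_spec (fun n => ∃ p d : M.N, r.code = RCAModel.pair (RCAModel.pair p n) d)
    ⟨_, _, _, rfl⟩
  have hd := eps_spec (fun d => ∃ p n : M.N, r.code = RCAModel.pair (RCAModel.pair p n) d)
    ⟨_, _, _, rfl⟩
  have h₁ : codePos r.code = r.pos := by
    obtain ⟨n, d, h⟩ := hp
    exact (pair_inj (pair_inj h).1).1.symm
  have h₂ : codeNeg r.code = r.neg := by
    obtain ⟨p, d, h⟩ := hn
    exact (pair_inj (pair_inj h).1).2.symm
  have h₃ : codeDen r.code = r.den := by
    obtain ⟨p, n, h⟩ := hd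
    exact (pair_inj h).2.symm
  rw [vc, h₁, h₂, h₃]

/-- A code of a rational number. -/
noncomputable def qcode (q : QQ M) : M.N := eps fun m => RCAModel.IsRat m ∧ vc m = q

instance isDef_qcode {C : Type u} [Ctx M C] (F : C → QQ M) [IsRatDef F] :
    IsDef fun c => qcode (F c) := by
  unfold qcode; infer_instance

theorem qcode_spec (q : QQ M) : RCAModel.IsRat (qcode q) ∧ vc (qcode q) = q := by
  obtain ⟨r, rfl⟩ := exists_val q
  exact eps_spec (fun m => RCAModel.IsRat m ∧ vc m = val r) ⟨r.code, ⟨r, rfl⟩, vc_code r⟩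

theorem isRat_qcode (q : QQ M) : RCAModel.IsRat (qcode q) := (qcode_spec q).1

theorem vc_qcode (q : QQ M) : vc (qcode q) = q := (qcode_spec q).2

/-! ### Real numbers in terms of the values of codes -/

theorem isReal_iff (x : M.Seq) : RCAModel.IsReal x ↔ (∀ n, RCAModel.IsRat (x ⬝ n)) ∧
    ∀ n m, n ≤ m → |vc (x ⬝ n) - vc (x ⬝ m)| ≤ ex n := by
  refine and_congr_right fun hx => forall₂_congr fun n m => ?_
  obtain ⟨r, hr⟩ := hx n
  obtain ⟨s, hs⟩ := hx m
  constructor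
  · intro h hnm
    have := distLe_iff.1 (h r s hnm hr hs)
    rwa [val_twoPowNeg, ← vc_code, ← vc_code, ← hr, ← hs] at this
  · intro h r' s' hnm hr' hs'
    rw [distLe_iff, val_twoPowNeg, ← vc_code, ← vc_code, ← hr', ← hs']
    exact h hnm

/-- Values of codes replace the quantification over fractions, which makes the order arithmetical.
The premises `IsRat` stay because definability is needed for arbitrary sequences, not only for
reals. -/
theorem leR_iff (x y : M.Seq) : RCAModel.leR x y ↔ ∀ n, RCAModel.IsRat (x ⬝ n) →
    RCAModel.IsRat (y ⬝ n) → vc (x ⬝ n) ≤ vc (y ⬝ n) + 2 * ex n := by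
  refine forall_congr' fun n => ?_
  constructor
  · rintro h ⟨r, hr⟩ ⟨s, hs⟩
    have := val_le.1 (h r s hr hs)
    rw [val_add, val_add, val_twoPowNeg, ← vc_code, ← vc_code, ← hr, ← hs] at this
    linarith
  · intro h r s hr hs
    have := h ⟨r, hr⟩ ⟨s, hs⟩
    rw [val_le, val_add, val_add, val_twoPowNeg, ← vc_code, ← vc_code, ← hr, ← hs]
    linarith

theorem close_iff (k : M.N) (x y : M.Seq) : RCAModel.close k x y ↔ ∀ n, RCAModel.IsRat (x ⬝ n) →
    RCAModel.IsRat (y ⬝ n) → |vc (x ⬝ n) - vc (y ⬝ n)| ≤ ex k + 2 * ex n := by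
  refine forall_congr' fun n => ?_
  constructor
  · rintro h ⟨r, hr⟩ ⟨s, hs⟩
    have := distLe_iff.1 (h r s hr hs)
    rw [val_add, val_add, val_twoPowNeg, val_twoPowNeg, ← vc_code, ← vc_code, ← hr, ← hs] at this
    linarith
  · intro h r s hr hs
    have := h ⟨r, hr⟩ ⟨s, hs⟩
    rw [distLe_iff, val_add, val_add, val_twoPowNeg, val_twoPowNeg, ← vc_code, ← vc_code, ← hr,
      ← hs]
    linarith

section

variable {C : Type u} [Ctx M C] (F G : C → M.Seq) [IsDef F] [IsDef G]

instance isAr_leR : IsAr M fun c => RCAModel.leR (F c) (G c) := by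
  simp only [leR_iff]; infer_instance

instance isAr_ltR : IsAr M fun c => RCAModel.ltR (F c) (G c) := by
  unfold RCAModel.ltR; infer_instance

instance isAr_close (k : C → M.N) [IsDef k] : IsAr M fun c => RCAModel.close (k c) (F c) (G c) := by
  simp only [close_iff]; infer_instance

instance isDef_ratReal (k : C → M.N) [IsDef k] : IsDef fun c => RCAModel.ratReal (k c) := by
  unfold RCAModel.ratReal; infer_instance

end

/-! ### An ordered field that contains the real numbers of the model

The ultrapower of the field of rational numbers contains a limit of every Cauchy sequence of the
model, up to infinitesimals; a complement of the space of infinitesimals makes the limits unique. -/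

instance : Nonempty M.N := ⟨0⟩

variable (M) in
def KK : Type u := Filter.Germ (Ultrafilter.of (Filter.atTop : Filter M.N) : Filter M.N) (QQ M)

noncomputable instance : Field (KK M) := inferInstanceAs (Field (Filter.Germ
  (Ultrafilter.of (Filter.atTop : Filter M.N) : Filter M.N) (QQ M)))

noncomputable instance : LinearOrder (KK M) := inferInstanceAs (LinearOrder (Filter.Germ
  (Ultrafilter.of (Filter.atTop : Filter M.N) : Filter M.N) (QQ M)))

instance : IsStrictOrderedRing (KK M) := inferInstanceAs (IsStrictOrderedRing (Filter.Germ
  (Ultrafilter.of (Filter.atTop : Filter M.N) : Filter M.N) (QQ M)))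

instance : IsOrderedRing (KK M) := inferInstance

instance : IsOrderedAddMonoid (KK M) := inferInstance

/-- The class of a family of rational numbers. -/
noncomputable def germ (f : M.N → QQ M) : KK M := Filter.Germ.ofFun f

/-- The rational numbers as elements of the ultrapower. -/
noncomputable def cst : QQ M →+* KK M where
  toFun q := germ fun _ => q
  map_one' := rfl
  map_zero' := rfl
  map_add' _ _ := rfl
  map_mul' _ _ := rfl

theorem cst_le {p q : QQ M} : cst p ≤ cst q ↔ p ≤ q := Filter.Germ.const_le_iff

theorem cst_lt {p q : QQ M} : cst p < cst q ↔ p < q := by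
  rw [← not_le, ← not_le, cst_le]

theorem cst_inj {p q : QQ M} : cst p = cst q ↔ p = q := by
  rw [le_antisymm_iff, le_antisymm_iff, cst_le, cst_le]

theorem cst_abs (q : QQ M) : cst |q| = |cst q| := by
  rcases le_total 0 q with h | h
  · rw [abs_of_nonneg h, abs_of_nonneg]
    rwa [← map_zero cst, cst_le]
  · rw [abs_of_nonpos h, abs_of_nonpos, map_neg]
    rwa [← map_zero cst, cst_le]

theorem germ_le {f g : M.N → QQ M} (n : M.N) (h : ∀ m, n ≤ m → f m ≤ g m) : germ f ≤ germ g := by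
  have : ∀ᶠ m in (Filter.atTop : Filter M.N), f m ≤ g m :=
    (Filter.eventually_ge_atTop n).mono h
  exact Filter.Germ.coe_le.2 (this.filter_mono (Ultrafilter.of_le _))

/-- The number `2 ^ (-k)`. -/
noncomputable def ee (k : M.N) : KK M := cst (ex k)

theorem ee_pos (k : M.N) : 0 < ee k := by
  rw [← map_zero cst]; exact cst_lt.2 (ex_pos k)

theorem ee_zero : ee (0 : M.N) = 1 := by rw [ee, ex_zero, map_one]

theorem ee_add_one (k : M.N) : ee (k + 1) = ee k / 2 := by
  rw [ee, ex_add_one, map_div₀, map_ofNat]; rfl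

theorem ee_anti {j k : M.N} (h : j ≤ k) : ee k ≤ ee j := cst_le.2 (ex_anti h)

theorem eight_ee (k : M.N) : 8 * ee (k + 1 + 1 + 1) = ee k := by
  rw [ee_add_one, ee_add_one, ee_add_one]; ring

noncomputable instance : Module (QQ M) (KK M) := cst.toModule

theorem smul_def (q : QQ M) (x : KK M) : q • x = cst q * x := rfl

variable (M) in
/-- The space of infinitesimals. -/
def infinitesimals : Submodule (QQ M) (KK M) where
  carrier := {x | ∀ k, |x| ≤ ee k}
  zero_mem' k := by rw [abs_zero]; exact (ee_pos k).le
  add_mem' {x y} hx hy k := by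
    have h₁ := hx (k + 1)
    have h₂ := hy (k + 1)
    rw [ee_add_one] at h₁ h₂
    have := abs_add_le x y
    linarith
  smul_mem' q x hx k := by
    -- The added `1` allows division also when `q = 0`.
    have hq : 0 < |q| + 1 := by positivity
    obtain ⟨j, hj⟩ := exists_ex_lt (div_pos (ex_pos k) hq)
    rw [smul_def, abs_mul, ← cst_abs]
    have h₁ : (|q| + 1) * ex j ≤ ex k := by
      rw [lt_div_iff₀ hq] at hj; linarith
    have h₂ : cst (|q|) * ee j ≤ ee k := by
      rw [ee, ← map_mul]
      refine cst_le.2 (le_trans ?_ h₁)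
      nlinarith [ex_pos j]
    have h₃ : 0 ≤ cst (|q|) := by rw [cst_abs]; exact abs_nonneg _
    exact (mul_le_mul_of_nonneg_left (hx j) h₃).trans h₂

variable (M) in
def rationals : Submodule (QQ M) (KK M) where
  carrier := Set.range cst
  zero_mem' := ⟨0, map_zero _⟩
  add_mem' := by
    rintro _ _ ⟨p, rfl⟩ ⟨q, rfl⟩
    exact ⟨p + q, map_add _ _ _⟩
  smul_mem' := by
    rintro p _ ⟨q, rfl⟩
    exact ⟨p * q, map_mul _ _ _⟩

theorem disjoint_rationals : Disjoint (rationals M) (infinitesimals M) := by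
  rw [Submodule.disjoint_def]
  rintro _ ⟨q, rfl⟩ h
  by_contra hq
  have : 0 < |q| := by rw [abs_pos]; rintro rfl; exact hq (map_zero _)
  obtain ⟨k, hk⟩ := exists_ex_lt this
  have := h k
  rw [← cst_abs, ee, cst_le] at this
  exact absurd hk (not_lt.2 this)

variable (M) in
/-- A complement of the space of infinitesimals that contains the rational numbers. -/
noncomputable def reals : Submodule (QQ M) (KK M) := disjoint_rationals (M := M).exists_isCompl.choose

theorem cst_mem_reals (q : QQ M) : cst q ∈ reals M :=
  disjoint_rationals.exists_isCompl.choose_spec.1 ⟨q, rfl⟩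

theorem isCompl_reals : IsCompl (reals M) (infinitesimals M) :=
  disjoint_rationals.exists_isCompl.choose_spec.2

/-- The complement is only a vector space over the rationals of the model and need not be closed
under products; rational linear combinations and absolute values are all that is needed later. -/
theorem abs_mem_reals {x : KK M} (hx : x ∈ reals M) : |x| ∈ reals M := by
  rcases abs_choice x with h | h <;> rw [h]
  · exact hx
  · exact neg_mem hx

theorem exists_ee_lt {x : KK M} (hx : x ∈ reals M) (h : 0 < x) : ∃ k, ee k < x := by
  by_contra! h'
  have : x ∈ infinitesimals M := fun k => by rw [abs_of_pos h]; exact h' k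
  exact h.ne' ((Submodule.disjoint_def.1 isCompl_reals.disjoint) x hx this)

/-- A positive excess `x - y` would be an infinitesimal in the complement, hence zero. The factor
`8` is slack that lets several approximation errors accumulate. -/
theorem le_of_forall_ee {x y : KK M} (hx : x ∈ reals M) (hy : y ∈ reals M)
    (h : ∀ k, x ≤ y + 8 * ee k) : x ≤ y := by
  by_contra! h'
  obtain ⟨k, hk⟩ := exists_ee_lt (sub_mem hx hy) (sub_pos.2 h')
  have := h (k + 1 + 1 + 1)
  rw [eight_ee] at this
  linarith

/-- The germ of the sequence is within `2 ^ (-n)` of its `n`-th term. Its component in `reals`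
differs from it by an infinitesimal, and this does not affect a bound between elements of `reals`.
-/
theorem exists_lim {x : M.Seq} (hx : RCAModel.IsReal x) :
    ∃ z ∈ reals M, ∀ n, |z - cst (vc (x ⬝ n))| ≤ ee n := by
  obtain ⟨-, hx⟩ := (isReal_iff x).1 hx
  set g : KK M := germ fun n => vc (x ⬝ n)
  have hg : ∀ n, |g - cst (vc (x ⬝ n))| ≤ ee n := fun n => by
    rw [abs_sub_le_iff, sub_le_iff_le_add, sub_le_iff_le_add]
    constructor
    · refine germ_le n fun m hm => ?_
      have := (abs_sub_le_iff.1 (hx n m hm)).2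
      linarith
    · refine germ_le n fun m hm => ?_
      have := (abs_sub_le_iff.1 (hx n m hm)).1
      linarith
  obtain ⟨z, hz, w, hw, hzw⟩ := Submodule.mem_sup.1
    (show g ∈ reals M ⊔ infinitesimals M by rw [isCompl_reals.sup_eq_top]; trivial)
  refine ⟨z, hz, fun n => ?_⟩
  refine le_of_forall_ee (abs_mem_reals (sub_mem hz (cst_mem_reals _))) (cst_mem_reals _) fun k => ?_
  have h₁ := hg n
  have h₂ := hw k
  have h₃ := ee_pos k
  change _ ≤ ee n + _
  rw [← hzw, abs_le] at h₁
  rw [abs_le] at h₂ ⊢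
  constructor <;> linarith

open Classical in
/-- The value of a real number. -/
noncomputable def rho (x : M.Seq) : KK M :=
  if hx : RCAModel.IsReal x then (exists_lim hx).choose else 0

theorem rho_mem (x : M.Seq) : rho x ∈ reals M := by
  unfold rho
  split_ifs with hx
  · exact (exists_lim hx).choose_spec.1
  · exact zero_mem _

theorem abs_rho_sub {x : M.Seq} (hx : RCAModel.IsReal x) (n : M.N) :
    |rho x - cst (vc (x ⬝ n))| ≤ ee n := by
  rw [rho, dif_pos hx]
  exact (exists_lim hx).choose_spec.2 n

theorem rho_eq {x : M.Seq} (hx : RCAModel.IsReal x) {z : KK M} (hz : z ∈ reals M)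
    (h : ∀ n, |z - cst (vc (x ⬝ n))| ≤ 7 * ee n) : rho x = z := by
  apply le_antisymm
  · refine le_of_forall_ee (rho_mem x) hz fun k => ?_
    have h₁ := abs_le.1 (h k)
    have h₂ := abs_le.1 (abs_rho_sub hx k)
    linarith
  · refine le_of_forall_ee hz (rho_mem x) fun k => ?_
    have h₁ := abs_le.1 (h k)
    have h₂ := abs_le.1 (abs_rho_sub hx k)
    linarith

section

variable {x y : M.Seq} (hx : RCAModel.IsReal x) (hy : RCAModel.IsReal y)

include hx hy

theorem leR_iff_rho : RCAModel.leR x y ↔ rho x ≤ rho y := by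
  rw [leR_iff]
  constructor
  · intro h
    refine le_of_forall_ee (rho_mem x) (rho_mem y) fun k => ?_
    have := cst_le.2 (h k (hx.1 k) (hy.1 k))
    rw [map_add, map_mul, map_ofNat] at this
    change _ ≤ _ + 2 * ee k at this
    have h₁ := abs_le.1 (abs_rho_sub hx k)
    have h₂ := abs_le.1 (abs_rho_sub hy k)
    linarith [ee_pos k]
  · intro h n _ _
    rw [← cst_le, map_add, map_mul, map_ofNat]
    change _ ≤ _ + 2 * ee n
    have h₁ := abs_le.1 (abs_rho_sub hx n)
    have h₂ := abs_le.1 (abs_rho_sub hy n)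
    linarith [ee_pos n]

theorem eqR_iff_rho : RCAModel.eqR x y ↔ rho x = rho y := by
  rw [RCAModel.eqR, leR_iff_rho hx hy, leR_iff_rho hy hx, le_antisymm_iff]

theorem ltR_iff_rho : RCAModel.ltR x y ↔ rho x < rho y := by
  rw [RCAModel.ltR, leR_iff_rho hy hx, not_le]

theorem close_iff_rho (k : M.N) : RCAModel.close k x y ↔ |rho x - rho y| ≤ ee k := by
  rw [close_iff]
  constructor
  · intro h
    refine le_of_forall_ee (abs_mem_reals (sub_mem (rho_mem x) (rho_mem y))) (cst_mem_reals _)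
      fun n => ?_
    have := cst_le.2 (h n (hx.1 n) (hy.1 n))
    rw [cst_abs, map_sub, map_add, map_mul, map_ofNat] at this
    change _ ≤ ee k + 2 * ee n at this
    change _ ≤ ee k + _
    have h₁ := abs_le.1 (abs_rho_sub hx n)
    have h₂ := abs_le.1 (abs_rho_sub hy n)
    rw [abs_le] at this ⊢
    have := ee_pos n
    constructor <;> linarith
  · intro h n _ _
    rw [← cst_le, cst_abs, map_sub, map_add, map_mul, map_ofNat]
    change _ ≤ ee k + 2 * ee n
    have h₁ := abs_le.1 (abs_rho_sub hx n)
    have h₂ := abs_le.1 (abs_rho_sub hy n)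
    rw [abs_le] at h ⊢
    have := ee_pos n
    constructor <;> linarith

omit hy in
theorem exists_rat_between (h : rho x < rho y) : ∃ q, rho x < cst q ∧ cst q < rho y := by
  obtain ⟨k, hk⟩ := exists_ee_lt (sub_mem (rho_mem y) (rho_mem x)) (sub_pos.2 h)
  have h₁ := abs_le.1 (abs_rho_sub hx (k + 1 + 1))
  have h₂ := ee_pos k
  have h₃ : cst (vc (x ⬝ (k + 1 + 1)) + 2 * ex (k + 1 + 1)) =
      cst (vc (x ⬝ (k + 1 + 1))) + 2 * ee (k + 1 + 1) := by
    rw [map_add, map_mul, map_ofNat]; rfl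
  -- With `ε = 2 ^ (-k-2)`, this rational lies between `x + ε` and `x + 3 ε`, and `4 ε` is less than
  -- `y - x`.
  refine ⟨vc (x ⬝ (k + 1 + 1)) + 2 * ex (k + 1 + 1), ?_, ?_⟩ <;>
  · rw [h₃]
    rw [ee_add_one, ee_add_one] at *
    linarith

end

theorem isReal_ratReal {c : M.N} (hc : RCAModel.IsRat c) : RCAModel.IsReal (RCAModel.ratReal c) := by
  rw [isReal_iff]
  simp only [RCAModel.ratReal, M.K_app, sub_self, abs_zero]
  exact ⟨fun _ => hc, fun n _ _ => (ex_pos n).le⟩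

theorem rho_ratReal {c : M.N} (hc : RCAModel.IsRat c) : rho (RCAModel.ratReal c) = cst (vc c) := by
  refine rho_eq (isReal_ratReal hc) (cst_mem_reals _) fun n => ?_
  simp only [RCAModel.ratReal, M.K_app, sub_self, abs_zero]
  linarith [ee_pos n]

/-- The rational number `q` as a real number. -/
noncomputable def qreal (q : QQ M) : M.Seq := RCAModel.ratReal (qcode q)

theorem isReal_qreal (q : QQ M) : RCAModel.IsReal (qreal q) := isReal_ratReal (isRat_qcode q)

theorem rho_qreal (q : QQ M) : rho (qreal q) = cst q := by
  rw [qreal, rho_ratReal (isRat_qcode q), vc_qcode]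

/-! ### Lipschitz functions on the real numbers -/

/-- The extension to the real numbers of a function on the rational numbers. -/
noncomputable def mapR (φ : QQ M → QQ M) (x : M.Seq) : M.Seq :=
  lam fun n => (lam fun m => qcode (φ (vc m)) : M.Seq) ⬝ (x ⬝ n)

/-- The inner `lam` is one fixed sequence of the model, whatever `φ` is, so `φ` need not be
definable here. -/
instance isDef_mapR {C : Type u} [Ctx M C] (φ : QQ M → QQ M) (F : C → M.Seq) [IsDef F] :
    IsDef fun c => mapR φ (F c) := by
  unfold mapR
  generalize (lam fun m => qcode (φ (vc m)) : M.Seq) = f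
  infer_instance

section

variable {φ : QQ M → QQ M} [IsRatDef fun c : PUnit.{u + 1} × M.N => φ (vc c.2)]

theorem mapR_app (x : M.Seq) (n : M.N) : mapR φ x ⬝ n = qcode (φ (vc (x ⬝ n))) := by
  unfold mapR
  rw [lam_app, lam_app]

/-- With Lipschitz constant `1` the modulus `2 ^ (-n)` survives, so `φ` may act term by term. -/
theorem isReal_mapR (hφ : ∀ p q, |φ p - φ q| ≤ |p - q|) {x : M.Seq} (hx : RCAModel.IsReal x) :
    RCAModel.IsReal (mapR φ x) := by
  rw [isReal_iff] at hx ⊢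
  simp only [mapR_app, vc_qcode]
  exact ⟨fun n => isRat_qcode _, fun n m h => (hφ _ _).trans (hx.2 n m h)⟩

theorem abs_rho_mapR_sub (hφ : ∀ p q, |φ p - φ q| ≤ |p - q|) {x : M.Seq}
    (hx : RCAModel.IsReal x) (q : QQ M) : |rho (mapR φ x) - cst (φ q)| ≤ |rho x - cst q| := by
  refine le_of_forall_ee (abs_mem_reals (sub_mem (rho_mem _) (cst_mem_reals _)))
    (abs_mem_reals (sub_mem (rho_mem _) (cst_mem_reals _))) fun n => ?_
  have h₁ := abs_rho_sub (isReal_mapR hφ hx) n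
  have h₂ := abs_rho_sub hx n
  have h₃ := cst_le.2 (hφ (vc (x ⬝ n)) q)
  rw [mapR_app, vc_qcode] at h₁
  rw [cst_abs, cst_abs, map_sub, map_sub] at h₃
  have h₄ := abs_sub_le (rho (mapR φ x)) (cst (φ (vc (x ⬝ n)))) (cst (φ q))
  have h₅ := abs_sub_le (cst (vc (x ⬝ n))) (rho x) (cst q)
  rw [abs_sub_comm (cst (vc (x ⬝ n))) (rho x)] at h₅
  linarith [ee_pos n]

/-- The extension agrees with a continuous function if it does so near to the given point. -/
theorem rho_mapR_eq (hφ : ∀ p q, |φ p - φ q| ≤ |p - q|) {x : M.Seq} (hx : RCAModel.IsReal x)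
    {z : KK M} (hz : z ∈ reals M)
    (h : ∀ k, ∃ q, |rho x - cst q| ≤ ee k ∧ |z - cst (φ q)| ≤ ee k) : rho (mapR φ x) = z := by
  have key : ∀ k, |rho (mapR φ x) - z| ≤ 2 * ee k := fun k => by
    obtain ⟨q, h₁, h₂⟩ := h k
    have h₃ := (abs_rho_mapR_sub hφ hx q).trans h₁
    have h₄ := abs_sub_le (rho (mapR φ x)) (cst (φ q)) z
    rw [abs_sub_comm (cst (φ q)) z] at h₄
    linarith
  apply le_antisymm
  · refine le_of_forall_ee (rho_mem _) hz fun k => ?_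
    have := abs_le.1 (key k)
    linarith [ee_pos k]
  · refine le_of_forall_ee hz (rho_mem _) fun k => ?_
    have := abs_le.1 (key k)
    linarith [ee_pos k]

theorem abs_rho_mapR_sub_le (hφ : ∀ p q, |φ p - φ q| ≤ |p - q|) {x y : M.Seq}
    (hx : RCAModel.IsReal x) (hy : RCAModel.IsReal y) :
    |rho (mapR φ x) - rho (mapR φ y)| ≤ |rho x - rho y| := by
  refine le_of_forall_ee (abs_mem_reals (sub_mem (rho_mem _) (rho_mem _)))
    (abs_mem_reals (sub_mem (rho_mem _) (rho_mem _))) fun n => ?_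
  have h₁ := abs_rho_mapR_sub hφ hx (vc (y ⬝ n))
  have h₂ := abs_rho_mapR_sub hφ hy (vc (y ⬝ n))
  have h₃ := abs_rho_sub hy n
  have h₄ := abs_sub_le (rho (mapR φ x)) (cst (φ (vc (y ⬝ n)))) (rho (mapR φ y))
  have h₅ := abs_sub_le (rho x) (rho y) (cst (vc (y ⬝ n)))
  rw [abs_sub_comm (cst (φ (vc (y ⬝ n))))] at h₄
  linarith [ee_pos n]

end

theorem rho_mapR_affine {c s : QQ M} (hs : |s| = 1) {x : M.Seq} (hx : RCAModel.IsReal x) :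
    RCAModel.IsReal (mapR (fun q => c + s * q) x) ∧
      rho (mapR (fun q => c + s * q) x) = cst c + cst s * rho x := by
  have hφ : ∀ p q : QQ M, |(c + s * p) - (c + s * q)| ≤ |p - q| := fun p q => by
    rw [add_sub_add_left_eq_sub, ← mul_sub, abs_mul, hs, one_mul]
  refine ⟨isReal_mapR (φ := fun q => c + s * q) hφ hx, rho_mapR_eq (φ := fun q => c + s * q) hφ hx
    (add_mem (cst_mem_reals c) ((reals M).smul_mem s (rho_mem x))) fun k =>
      ⟨vc (x ⬝ k), abs_rho_sub hx k, ?_⟩⟩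
  rw [map_add, map_mul, add_sub_add_left_eq_sub, ← mul_sub, abs_mul, ← cst_abs, hs, map_one, one_mul]
  exact abs_rho_sub hx k

/-! ### Coding sequences by real numbers

The base `4` digits of a real number are used to code a sequence in such a way that the codes of
each sequence are dense. -/

/-- The number `4 ^ (-i)`. -/
noncomputable def quart (i : M.N) : QQ M := ex (i + i)

theorem quart_pos (i : M.N) : 0 < quart i := ex_pos _

theorem quart_add_one (i : M.N) : quart (i + 1) = quart i / 4 := by
  rw [quart, quart, show i + 1 + (i + 1) = i + i + 1 + 1 by ring, ex_add_one, ex_add_one]; ring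

theorem quart_zero : quart (0 : M.N) = 1 := by rw [quart, add_zero, ex_zero]

theorem quart_le (i : M.N) : quart i ≤ ex i := ex_anti (self_le_add_right _ _)

/-- The set of positions at which the code of `g` has the digit `1`. -/
def IsOne (g : M.Seq) (i : M.N) : Prop := ∃ n k : M.N, i = RCAModel.pair (RCAModel.pair n (g ⬝ n)) k

/-- The numerators of the approximations of a code of `g`. -/
noncomputable def codeNum (g : M.Seq) (N j n : M.N) : M.N :=
  M.R ⬝ n ⬝ j ⬝ lam fun c => lam fun l => 4 * c + sel (IsOne g (N + l)) 1 0

/-- A code of `g` between `j / 4 ^ N` and `(j + 1) / 4 ^ N`. -/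
noncomputable def code (g : M.Seq) (N j : M.N) : M.Seq :=
  lam fun n => qcode (nn (codeNum g N j n) * quart (N + n))

/-- The digit of `x` at the position `i` is `1`. -/
def Bit (x : M.Seq) (i : M.N) : Prop :=
  ∃ j : M.N, RCAModel.leR (qreal ((4 * nn j + 1) * quart (i + 1))) x ∧
    RCAModel.leR x (qreal ((4 * nn j + 2) * quart (i + 1)))

/-- The sequence with code `x`. -/
noncomputable def decode (x : M.Seq) : M.Seq :=
  lam fun n => eps fun m => ∃ K : M.N, ∀ k, K ≤ k → Bit x (RCAModel.pair (RCAModel.pair n m) k)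

section

variable {C : Type u} [Ctx M C]

instance isRatDef_quart (F : C → M.N) [IsDef F] : IsRatDef fun c => quart (F c) := by
  unfold quart; infer_instance

instance isAr_isOne (g : C → M.Seq) (i : C → M.N) [IsDef g] [IsDef i] :
    IsAr M fun c => IsOne (g c) (i c) := by
  unfold IsOne; infer_instance

instance isDef_codeNum (g : C → M.Seq) (N j n : C → M.N) [IsDef g] [IsDef N] [IsDef j] [IsDef n] :
    IsDef fun c => codeNum (g c) (N c) (j c) (n c) := by
  unfold codeNum; infer_instance

instance isDef_code (g : C → M.Seq) (N j : C → M.N) [IsDef g] [IsDef N] [IsDef j] :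
    IsDef fun c => code (g c) (N c) (j c) := by
  unfold code; infer_instance

instance isDef_qreal (F : C → QQ M) [IsRatDef F] : IsDef fun c => qreal (F c) := by
  unfold qreal; infer_instance

instance isAr_bit (x : C → M.Seq) (i : C → M.N) [IsDef x] [IsDef i] :
    IsAr M fun c => Bit (x c) (i c) := by
  unfold Bit; infer_instance

instance isDef_decode (x : C → M.Seq) [IsDef x] : IsDef fun c => decode (x c) := by
  unfold decode; infer_instance

end

omit [Fact M.Exists2] in
theorem codeNum_zero (g : M.Seq) (N j : M.N) : codeNum g N j 0 = j := M.R_zero _ _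

theorem codeNum_add_one (g : M.Seq) (N j n : M.N) :
    codeNum g N j (n + 1) = 4 * codeNum g N j n + sel (IsOne g (N + n)) 1 0 := by
  unfold codeNum
  rw [← succ_eq, M.R_succ, lam_app, lam_app]

/-- The approximations of a code. -/
noncomputable def approx (g : M.Seq) (N j n : M.N) : QQ M := nn (codeNum g N j n) * quart (N + n)

/-- Only the digits `0` and `1` are appended, so all later digits together add at most `1/4 + 1/16 +
… = 1/3` of the current unit; the second inequality is this bound in a form fit for induction. -/
theorem approx_bounds (g : M.Seq) (N j n m : M.N) :
    approx g N j n ≤ approx g N j (n + m) ∧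
      3 * approx g N j (n + m) + quart (N + (n + m)) ≤ 3 * approx g N j n + quart (N + n) := by
  unfold approx
  refine nat_induction (fun m => nn (codeNum g N j n) * quart (N + n) ≤
    nn (codeNum g N j (n + m)) * quart (N + (n + m)) ∧
    3 * (nn (codeNum g N j (n + m)) * quart (N + (n + m))) + quart (N + (n + m)) ≤
      3 * (nn (codeNum g N j n) * quart (N + n)) + quart (N + n)) m ?_ ?_
  · rw [add_zero]; exact ⟨le_rfl, le_rfl⟩
  · rintro m ⟨h₁, h₂⟩
    have h₃ : nn (codeNum g N j (n + (m + 1))) = 4 * nn (codeNum g N j (n + m)) ∨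
        nn (codeNum g N j (n + (m + 1))) = 4 * nn (codeNum g N j (n + m)) + 1 := by
      rw [← add_assoc n, codeNum_add_one, map_add, map_mul, map_ofNat]
      by_cases h : IsOne g (N + (n + m))
      · rw [sel_of h, map_one]; exact Or.inr rfl
      · rw [sel_of_not h, map_zero, add_zero]; exact Or.inl rfl
    have h₄ : quart (N + (n + (m + 1))) = quart (N + (n + m)) / 4 := by
      rw [← add_assoc n, ← add_assoc, quart_add_one]
    have h₅ := quart_pos (N + (n + m))
    rw [h₄]
    rcases h₃ with h | h <;> rw [h] <;> constructor <;> linarith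

theorem code_app (g : M.Seq) (N j n : M.N) : vc (code g N j ⬝ n) = approx g N j n := by
  unfold code
  rw [lam_app, vc_qcode, approx]

theorem isReal_code (g : M.Seq) (N j : M.N) : RCAModel.IsReal (code g N j) := by
  rw [isReal_iff]
  refine ⟨fun n => ?_, fun n m h => ?_⟩
  · unfold code
    rw [lam_app]
    exact isRat_qcode _
  · obtain ⟨c, rfl⟩ := h
    change |_ - vc (code g N j ⬝ (n + c))| ≤ _
    obtain ⟨h₁, h₂⟩ := approx_bounds g N j n c
    have h₃ := quart_pos (N + (n + c))
    have h₄ : quart (N + n) ≤ ex n :=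
      (quart_le _).trans (ex_anti (le_add_self))
    rw [code_app, code_app, abs_le]
    constructor <;> linarith [ex_pos n]

theorem approx_le_rho (g : M.Seq) (N j n : M.N) :
    cst (approx g N j n) ≤ rho (code g N j) ∧
      3 * rho (code g N j) ≤ 3 * cst (approx g N j n) + cst (quart (N + n)) := by
  have hr := isReal_code g N j
  have key : ∀ k, cst (approx g N j n) ≤ rho (code g N j) + ee k ∧
      3 * rho (code g N j) ≤ 3 * cst (approx g N j n) + cst (quart (N + n)) + 3 * ee k := fun k => by
    have h₁ := abs_le.1 (abs_rho_sub hr (n + k))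
    have h₂ : ee (n + k) ≤ ee k := ee_anti le_add_self
    rw [code_app] at h₁
    obtain ⟨h₃, h₄⟩ := approx_bounds g N j n k
    rw [← cst_le] at h₃ h₄
    simp only [map_add, map_mul, map_ofNat] at h₄
    have h₅ := cst_lt.2 (quart_pos (N + (n + k)))
    rw [map_zero] at h₅
    constructor <;> linarith
  have h3 : (3 : KK M) * rho (code g N j) ∈ reals M := by
    have := (reals M).smul_mem 3 (rho_mem (code g N j))
    rwa [smul_def, map_ofNat] at this
  constructor
  · refine le_of_forall_ee (cst_mem_reals _) (rho_mem _) fun k => ?_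
    linarith [(key k).1, ee_pos k]
  · have : 3 * cst (approx g N j n) + cst (quart (N + n)) =
        cst (3 * approx g N j n + quart (N + n)) := by
      simp only [map_add, map_mul, map_ofNat]
    rw [this]
    refine le_of_forall_ee h3 (cst_mem_reals _) fun k => ?_
    rw [← this]
    linarith [(key k).2, ee_pos k]

theorem bit_iff {x : M.Seq} (hx : RCAModel.IsReal x) (i : M.N) :
    Bit x i ↔ ∃ j : M.N, cst ((4 * nn j + 1) * quart (i + 1)) ≤ rho x ∧
      rho x ≤ cst ((4 * nn j + 2) * quart (i + 1)) := by
  unfold Bit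
  simp only [leR_iff_rho (isReal_qreal _) hx, leR_iff_rho hx (isReal_qreal _), rho_qreal]

/-- Measured in units of the digit, modulo `4`, the code is in `[0, 1/3]` for the digit `0` and in
`[1, 4/3]` for the digit `1`; the window `[1, 2]` of `Bit` separates the two. -/
theorem bit_code (g : M.Seq) (N j n : M.N) : Bit (code g N j) (N + n) ↔ IsOne g (N + n) := by
  rw [bit_iff (isReal_code g N j)]
  obtain ⟨h₁, h₂⟩ := approx_le_rho g N j (n + 1)
  have h₃ := quart_pos (N + n + 1)
  have h₄ : approx g N j (n + 1) = nn (codeNum g N j (n + 1)) * quart (N + n + 1) := by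
    rw [approx, ← add_assoc]
  rw [← add_assoc N] at h₂
  rw [h₄] at h₁ h₂
  by_cases h : IsOne g (N + n)
  · refine iff_of_true ⟨codeNum g N j n, ?_⟩ h
    have h₆ : nn (codeNum g N j (n + 1)) = 4 * nn (codeNum g N j n) + 1 := by
      rw [codeNum_add_one, sel_of h, map_add, map_mul, map_ofNat, map_one]
    rw [h₆] at h₁ h₂
    refine ⟨h₁, ?_⟩
    have h₅ := cst_lt.2 h₃
    simp only [map_add, map_mul, map_ofNat, map_one, map_zero] at h₁ h₂ h₅ ⊢
    linarith
  · refine iff_of_false ?_ h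
    rintro ⟨i, h₅, h₆⟩
    have h₇ : nn (codeNum g N j (n + 1)) = 4 * nn (codeNum g N j n) := by
      rw [codeNum_add_one, sel_of_not h, map_add, map_mul, map_ofNat, map_zero, add_zero]
    rw [h₇] at h₁ h₂
    replace h₇ := cst_le.1 (h₁.trans h₆)
    have h₈ : 3 * ((4 * nn i + 1) * quart (N + n + 1)) ≤
        3 * (4 * nn (codeNum g N j n) * quart (N + n + 1)) + quart (N + n + 1) := by
      rw [← cst_le, map_add, map_mul, map_ofNat, map_mul cst 3, map_ofNat]
      linarith
    rw [mul_le_mul_iff_left₀ h₃] at h₇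
    have h₉ : 3 * (4 * nn i + 1) ≤ 3 * (4 * nn (codeNum g N j n)) + 1 := by
      refine le_of_mul_le_mul_right (a := quart (N + n + 1)) ?_ h₃
      linarith
    -- With `c` for the numerator before this digit, `4 c ≤ 4 i + 2` rules out `i < c`, and `12 i +
    -- 3 ≤ 12 c + 1` rules out `i ≥ c`.
    rcases lt_or_ge (nn i) (nn (codeNum g N j n)) with h' | h'
    · linarith [nn_lt h']
    · linarith

/-- The position of a triple is at least its last entry `k`, so for `k ≥ N` it lies beyond the free
leading digits and the digit there tells whether `m = g n`. -/
theorem decode_spec (g : M.Seq) (N j n m : M.N) :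
    (∃ K : M.N, ∀ k, K ≤ k → Bit (code g N j) (RCAModel.pair (RCAModel.pair n m) k)) ↔
      m = g ⬝ n := by
  have key : ∀ k, N ≤ k → (Bit (code g N j) (RCAModel.pair (RCAModel.pair n m) k) ↔
      m = g ⬝ n) := fun k hk => by
    obtain ⟨l, hl⟩ := hk.trans (le_pair_right (RCAModel.pair n m) k)
    change N + l = _ at hl
    rw [← hl, bit_code, hl]
    constructor
    · rintro ⟨n', k', h⟩
      obtain ⟨h₁, h₂⟩ := pair_inj (pair_inj h).1
      rw [h₁, h₂]
    · rintro rfl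
      exact ⟨n, k, rfl⟩
  constructor
  · rintro ⟨K, hK⟩
    exact (key _ (le_max_right K N)).1 (hK _ (le_max_left K N))
  · intro h
    exact ⟨N, fun k hk => (key k hk).2 h⟩

theorem decode_code (g : M.Seq) (N j : M.N) : decode (code g N j) = g := by
  apply M.ext
  intro n
  unfold decode
  rw [lam_app]
  have := eps_spec (fun m => ∃ K : M.N, ∀ k, K ≤ k →
    Bit (code g N j) (RCAModel.pair (RCAModel.pair n m) k))
  simp only [decode_spec] at this ⊢
  exact this ⟨_, rfl⟩

/-- The digit test compares the real with rationals only, so it depends on the value alone. This is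
what makes functions of the decoded arguments respect equality of reals. -/
theorem decode_congr {x y : M.Seq} (hx : RCAModel.IsReal x) (hy : RCAModel.IsReal y)
    (h : rho x = rho y) : decode x = decode y := by
  have : ∀ i, Bit x i = Bit y i := fun i => by
    rw [bit_iff hx, bit_iff hy, h]
  simp only [decode, this]

theorem code_bounds (g : M.Seq) (N j : M.N) : cst (nn j * quart N) ≤ rho (code g N j) ∧
    rho (code g N j) < cst ((nn j + 1) * quart N) := by
  obtain ⟨h₁, h₂⟩ := approx_le_rho g N j 0
  have h₃ := cst_lt.2 (quart_pos N)
  rw [approx, add_zero, codeNum_zero] at h₁ h₂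
  refine ⟨h₁, ?_⟩
  simp only [map_add, map_mul, map_one, map_zero] at h₁ h₂ h₃ ⊢
  linarith

/-- The codes of each sequence are dense. -/
theorem exists_code_between {p q : QQ M} (hp : 0 ≤ p) (hpq : p < q) :
    ∃ N j : M.N, ∀ g : M.Seq, cst p < rho (code g N j) ∧ rho (code g N j) < cst q := by
  -- Cells of width `4 ^ (-N)` are shorter than half of the gap, so the cell after the one that
  -- contains `p` ends before `q`; any code in it will do, for all `g` at once.
  obtain ⟨N, hN⟩ := exists_ex_lt (show 0 < (q - p) / 2 by linarith)
  have h₁ := quart_pos N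
  have h₂ := quart_le N
  obtain ⟨j, hj, hj'⟩ := exists_floor_nonneg (div_nonneg hp h₁.le)
  rw [le_div_iff₀ h₁] at hj
  rw [div_lt_iff₀ h₁] at hj'
  refine ⟨N, j + 1, fun g => ?_⟩
  obtain ⟨h₃, h₄⟩ := code_bounds g N (j + 1)
  rw [nn_add_one] at h₃ h₄
  refine ⟨(cst_lt.2 hj').trans_le h₃, h₄.trans_le (cst_le.2 ?_)⟩
  linarith

/-! ### Points of the line and of the unit interval -/

theorem vc_zero_code : vc (RCAModel.Frac.code ⟨M.zero, M.zero, M.zero⟩) = 0 := by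
  rw [vc_code, val]; simp [zero_eq]

theorem vc_one_code : vc (RCAModel.Frac.code ⟨M.one, M.zero, M.zero⟩) = 1 := by
  rw [vc_code, val]; simp [zero_eq, one_eq]

theorem mem_unitInterval {x : M.Seq} :
    x ∈ M.unitInterval ↔ RCAModel.IsReal x ∧ 0 ≤ rho x ∧ rho x ≤ 1 := by
  refine and_congr_right fun hx => ?_
  have h₀ : RCAModel.IsRat (RCAModel.Frac.code ⟨M.zero, M.zero, M.zero⟩) := ⟨_, rfl⟩
  have h₁ : RCAModel.IsRat (RCAModel.Frac.code ⟨M.one, M.zero, M.zero⟩) := ⟨_, rfl⟩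
  rw [leR_iff_rho (isReal_ratReal h₀) hx, leR_iff_rho hx (isReal_ratReal h₁), rho_ratReal h₀,
    rho_ratReal h₁, vc_zero_code, vc_one_code, map_zero, map_one]

theorem qreal_zero_mem : qreal (0 : QQ M) ∈ M.unitInterval := by
  rw [mem_unitInterval, rho_qreal, map_zero]
  exact ⟨isReal_qreal _, le_rfl, zero_le_one⟩

theorem qreal_one_mem : qreal (1 : QQ M) ∈ M.unitInterval := by
  rw [mem_unitInterval, rho_qreal, map_one]
  exact ⟨isReal_qreal _, zero_le_one, le_rfl⟩

theorem close_refl {x : M.Seq} (hx : RCAModel.IsReal x) (k : M.N) : RCAModel.close k x x := by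
  rw [close_iff_rho hx hx, sub_self, abs_zero]; exact (ee_pos k).le

theorem exists_shift {x : M.Seq} (hx : RCAModel.IsReal x) (q : QQ M) :
    ∃ y, RCAModel.IsReal y ∧ rho y = rho x + cst q := by
  have := rho_mapR_affine (c := q) (s := 1) (by simp) hx
  exact ⟨_, this.1, by rw [this.2, map_one, one_mul, add_comm]⟩

theorem code_nonneg (g : M.Seq) (N j : M.N) : 0 ≤ rho (code g N j) := by
  refine le_trans ?_ (code_bounds g N j).1
  rw [← map_zero cst, cst_le]
  exact mul_nonneg (nn_nonneg j) (quart_pos N).le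

theorem exists_code_between_reals {x y : M.Seq} (hx : RCAModel.IsReal x) (h : rho x < rho y)
    (hy : 0 < rho y) :
    ∃ N j : M.N, ∀ g : M.Seq, rho x < rho (code g N j) ∧ rho (code g N j) < rho y := by
  have key : ∀ x, RCAModel.IsReal x → rho x < rho y → 0 ≤ rho x →
      ∃ N j : M.N, ∀ g : M.Seq, rho x < rho (code g N j) ∧ rho (code g N j) < rho y := by
    intro x hx h h₀
    obtain ⟨q, hq, hq'⟩ := exists_rat_between hx h
    rw [← rho_qreal] at hq
    obtain ⟨p, hp, hp'⟩ := exists_rat_between hx hq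
    rw [rho_qreal, cst_lt] at hp'
    have hp₀ : 0 ≤ p := by
      rw [← cst_le, map_zero]; exact h₀.trans hp.le
    obtain ⟨N, j, hN⟩ := exists_code_between hp₀ hp'
    exact ⟨N, j, fun g => ⟨hp.trans (hN g).1, (hN g).2.trans hq'⟩⟩
  rcases le_total 0 (rho x) with h₀ | h₀
  · exact key x hx h h₀
  -- Codes are nonnegative, so a lower bound below `0` is replaced by `0`.
  · have h' : rho (qreal (0 : QQ M)) = 0 := by rw [rho_qreal, map_zero]
    obtain ⟨N, j, hN⟩ := key (qreal 0) (isReal_qreal _) (by rwa [h']) h'.ge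
    exact ⟨N, j, fun g => ⟨h₀.trans_lt (h' ▸ (hN g).1), (hN g).2⟩⟩

theorem exists_code_left {x a : M.Seq} (ha : RCAModel.IsReal a) (hax : rho a < rho x)
    (hx : x ∈ M.unitInterval) (hpos : 0 < rho x) : ∃ N j : M.N, ∀ g : M.Seq,
      code g N j ∈ M.unitInterval ∧ rho a < rho (code g N j) ∧ rho (code g N j) < rho x := by
  rw [mem_unitInterval] at hx
  obtain ⟨N, j, h⟩ := exists_code_between_reals ha hax hpos
  exact ⟨N, j, fun g => ⟨mem_unitInterval.2 ⟨isReal_code _ _ _, code_nonneg _ _ _,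
    (h g).2.le.trans hx.2.2⟩, h g⟩⟩

theorem exists_code_right {x b : M.Seq} (hxb : rho x < rho b)
    (hx : x ∈ M.unitInterval) (hlt : rho x < 1) : ∃ N j : M.N, ∀ g : M.Seq,
      code g N j ∈ M.unitInterval ∧ rho x < rho (code g N j) ∧ rho (code g N j) < rho b := by
  rw [mem_unitInterval] at hx
  have key : ∀ b, rho b ≤ 1 → rho x < rho b → ∃ N j : M.N, ∀ g : M.Seq,
      code g N j ∈ M.unitInterval ∧ rho x < rho (code g N j) ∧ rho (code g N j) < rho b := by
    intro b hb hxb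
    obtain ⟨N, j, h⟩ := exists_code_between_reals hx.1 hxb (hx.2.1.trans_lt hxb)
    exact ⟨N, j, fun g => ⟨mem_unitInterval.2 ⟨isReal_code _ _ _, code_nonneg _ _ _,
      (h g).2.le.trans hb⟩, h g⟩⟩
  rcases le_total (rho b) 1 with h | h
  · exact key b h hxb
  · have h' : rho (qreal (1 : QQ M)) = 1 := by rw [rho_qreal, map_one]
    obtain ⟨N, j, hN⟩ := key (qreal 1) h'.le (by rwa [h'])
    refine ⟨N, j, fun g => ⟨(hN g).1, (hN g).2.1, (hN g).2.2.trans_le (h'.trans_le h)⟩⟩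

theorem exists_code_close {x : M.Seq} (hx : x ∈ M.unitInterval) (k : M.N) (g : M.Seq) :
    ∃ y ∈ M.unitInterval, RCAModel.close k x y ∧ decode y = g := by
  have hx' := mem_unitInterval.1 hx
  have h₁ := ee_pos k
  rcases hx'.2.1.lt_or_eq with h | h
  · obtain ⟨a, ha, ha'⟩ := exists_shift hx'.1 (- ex k)
    rw [map_neg] at ha'
    change _ = _ + - ee k at ha'
    obtain ⟨N, j, hN⟩ := exists_code_left ha (by linarith) hx h
    refine ⟨code g N j, (hN g).1, ?_, decode_code _ _ _⟩
    rw [close_iff_rho hx'.1 (isReal_code _ _ _), abs_le]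
    constructor <;> linarith [(hN g).2.1, (hN g).2.2]
  · obtain ⟨b, hb, hb'⟩ := exists_shift hx'.1 (ex k)
    change _ = _ + ee k at hb'
    obtain ⟨N, j, hN⟩ := exists_code_right (b := b) (by linarith) hx (h ▸ zero_lt_one)
    refine ⟨code g N j, (hN g).1, ?_, decode_code _ _ _⟩
    rw [close_iff_rho hx'.1 (isReal_code _ _ _), abs_le]
    constructor <;> linarith [(hN g).2.1, (hN g).2.2]

/-- The sequences demanded by the Young condition must belong to the model; arithmetical choice for
pairs of numbers supplies them, by two successive searches. -/
theorem exists_choice (P : M.N → M.N → M.N → Prop)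
    [IsAr M fun c : ((PUnit.{u + 1} × M.N) × M.N) × M.N => P c.1.1.2 c.1.2 c.2]
    (h : ∀ k, ∃ m n, P k m n) : ∃ A B : M.Seq, ∀ k, P k (A ⬝ k) (B ⬝ k) := by
  obtain ⟨t, ht⟩ : ∃ t : M.carrier (ty0 ⇒ ty0 ⇒ ty0 ⇒ ty0),
      ∀ k m n, t ⬝ k ⬝ m ⬝ n = M.zero ↔ P k m n := by
    obtain ⟨⟨G₁, ⟨G₂, ⟨G₃, -, h₃⟩, h₂⟩, h₁⟩⟩ :=
      (inferInstance : IsAr M fun c : ((PUnit.{u + 1} × M.N) × M.N) × M.N =>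
        P c.1.1.2 c.1.2 c.2).rep
    refine ⟨G₃ ⟨⟩, fun k m n => ?_⟩
    rw [h₃, h₂, h₁, chi_eq_zero]
  simp only [← ht] at h ⊢
  refine ⟨lam fun k => eps fun m => ∃ n, t ⬝ k ⬝ m ⬝ n = M.zero,
    lam fun k => eps fun n => t ⬝ k ⬝ (eps fun m => ∃ n, t ⬝ k ⬝ m ⬝ n = M.zero) ⬝ n = M.zero,
    fun k => ?_⟩
  rw [lam_app, lam_app]
  exact eps_spec (fun n => t ⬝ k ⬝ (eps fun m => ∃ n, t ⬝ k ⬝ m ⬝ n = M.zero) ⬝ n = M.zero)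
    (eps_spec (fun m => ∃ n, t ⬝ k ⬝ m ⬝ n = M.zero) (h k))

/-! ### Functions of one variable that depend on the decoded argument only -/

section

variable {h : M.carrier (ty1 ⇒ ty1)} (hr : ∀ y, RCAModel.IsReal (h ⬝ y))
  (hh : ∀ y y', decode y = decode y' → h ⬝ y = h ⬝ y')

include hr hh

theorem convergesTo_of_decode {x : M.Seq} (hx : RCAModel.IsReal x) {a : M.carrier (ty0 ⇒ ty1)}
    (ha : ∀ k, RCAModel.IsReal (a ⬝ k) ∧ decode (a ⬝ k) = decode x ∧ |rho (a ⬝ k) - rho x| ≤ ee k) :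
    RCAModel.ConvergesTo a x ∧ RCAModel.ConvergesTo (M.S ⬝ (M.K ⬝ h) ⬝ a) (h ⬝ x) := by
  refine ⟨fun k => ⟨k, fun n hn => ?_⟩, fun k => ⟨k, fun n _ => ?_⟩⟩
  · rw [close_iff_rho (ha n).1 hx]
    exact (ha n).2.2.trans (ee_anti hn)
  · rw [M.S_app, M.K_app, hh _ _ (ha n).2.1]
    exact close_refl (hr x) k

/-- Codes of `decode x` accumulate at `x` from both sides, and `h` takes the value `h x` at each of
them. -/
theorem young_of_decode : RCAModel.Young₁ M.unitInterval h := by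
  intro x hx
  have hx' := mem_unitInterval.1 hx
  constructor
  · rintro ⟨z, hz, hzx⟩
    rw [mem_unitInterval] at hz
    rw [ltR_iff_rho hz.1 hx'.1] at hzx
    have hpos : 0 < rho x := hz.2.1.trans_lt hzx
    obtain ⟨A, B, hAB⟩ := exists_choice
      (fun k m n => RCAModel.ltR (code (decode x) m n) x ∧
        RCAModel.close k (code (decode x) m n) x) fun k => by
      obtain ⟨a, ha, ha'⟩ := exists_shift hx'.1 (- ex k)
      rw [map_neg] at ha'
      change _ = _ + - ee k at ha'
      have := ee_pos k
      obtain ⟨N, j, hN⟩ := exists_code_left ha (by linarith) hx hpos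
      refine ⟨N, j, ?_⟩
      rw [ltR_iff_rho (isReal_code _ _ _) hx'.1, close_iff_rho (isReal_code _ _ _) hx'.1, abs_le]
      obtain ⟨-, h₁, h₂⟩ := hN (decode x)
      exact ⟨h₂, by linarith, by linarith⟩
    refine ⟨lam fun k => code (decode x) (A ⬝ k) (B ⬝ k), fun n => ?_, ?_⟩
    · rw [lam_app]
      refine ⟨mem_unitInterval.2 ⟨isReal_code _ _ _, code_nonneg _ _ _, ?_⟩, (hAB n).1⟩
      have := (hAB n).1
      rw [ltR_iff_rho (isReal_code _ _ _) hx'.1] at this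
      exact this.le.trans hx'.2.2
    · refine convergesTo_of_decode hr hh hx'.1 fun k => ?_
      rw [lam_app, decode_code, ← close_iff_rho (isReal_code _ _ _) hx'.1]
      exact ⟨isReal_code _ _ _, rfl, (hAB k).2⟩
  · rintro ⟨z, hz, hzx⟩
    rw [mem_unitInterval] at hz
    rw [ltR_iff_rho hx'.1 hz.1] at hzx
    have hlt : rho x < 1 := hzx.trans_le hz.2.2
    -- On the right of `x`, the bound by `1` has to be part of the choice; on the left, it follows
    -- from the bound by `x`.
    obtain ⟨A, B, hAB⟩ := exists_choice
      (fun k m n => (RCAModel.ltR x (code (decode x) m n) ∧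
        RCAModel.leR (code (decode x) m n) (qreal 1)) ∧
        RCAModel.close k (code (decode x) m n) x) fun k => by
      obtain ⟨b, hb, hb'⟩ := exists_shift hx'.1 (ex k)
      change _ = _ + ee k at hb'
      have := ee_pos k
      obtain ⟨N, j, hN⟩ := exists_code_right (b := b) (by linarith) hx hlt
      refine ⟨N, j, ?_⟩
      rw [ltR_iff_rho hx'.1 (isReal_code _ _ _), close_iff_rho (isReal_code _ _ _) hx'.1, abs_le,
        leR_iff_rho (isReal_code _ _ _) (isReal_qreal _), rho_qreal, map_one]
      obtain ⟨h₀, h₁, h₂⟩ := hN (decode x)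
      exact ⟨⟨h₁, (mem_unitInterval.1 h₀).2.2⟩, by linarith, by linarith⟩
    refine ⟨lam fun k => code (decode x) (A ⬝ k) (B ⬝ k), fun n => ?_, ?_⟩
    · rw [lam_app]
      refine ⟨mem_unitInterval.2 ⟨isReal_code _ _ _, code_nonneg _ _ _, ?_⟩, (hAB n).1.1⟩
      have := (hAB n).1.2
      rwa [leR_iff_rho (isReal_code _ _ _) (isReal_qreal _), rho_qreal, map_one] at this
    · refine convergesTo_of_decode hr hh hx'.1 fun k => ?_
      rw [lam_app, decode_code, ← close_iff_rho (isReal_code _ _ _) hx'.1]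
      exact ⟨isReal_code _ _ _, rfl, (hAB k).2⟩

end

/-! ### Open intervals and peripheral continuity -/

/-- The open interval with end-points `a` and `b`. -/
noncomputable def ioo (a b : M.Seq) : M.carrier (ty1 ⇒ ty0) :=
  lam fun z => sel (RCAModel.ltR a z ∧ RCAModel.ltR z b) M.one M.zero

theorem ioo_eq_one {a b z : M.Seq} (ha : RCAModel.IsReal a) (hb : RCAModel.IsReal b)
    (hz : RCAModel.IsReal z) : ioo a b ⬝ z = M.one ↔ rho a < rho z ∧ rho z < rho b := by
  unfold ioo
  rw [lam_app, ← ltR_iff_rho ha hz, ← ltR_iff_rho hz hb]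
  by_cases h : RCAModel.ltR a z ∧ RCAModel.ltR z b
  · exact iff_of_true (sel_of h _ _) h
  · exact iff_of_false (by rw [sel_of_not h]; exact one_ne_zero'.symm) h

theorem ioo_zero_or_one (a b z : M.Seq) : ioo a b ⬝ z = M.zero ∨ ioo a b ⬝ z = M.one := by
  unfold ioo
  rw [lam_app]
  by_cases h : RCAModel.ltR a z ∧ RCAModel.ltR z b
  · exact Or.inr (sel_of h _ _)
  · exact Or.inl (sel_of_not h _ _)

omit [Fact M.Exists2] in
theorem isReal_of_mem {I : Set M.Seq} (hI : I = M.line ∨ I = M.unitInterval) {x : M.Seq}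
    (hx : x ∈ I) : RCAModel.IsReal x := by
  rcases hI with rfl | rfl
  · exact hx
  · exact hx.1

theorem eq_of_eqR_of_iff {A : M.carrier (ty1 ⇒ ty0)} {x y : M.Seq}
    (hx : A ⬝ x = M.zero ∨ A ⬝ x = M.one) (hy : A ⬝ y = M.zero ∨ A ⬝ y = M.one)
    (h : A ⬝ x = M.one ↔ A ⬝ y = M.one) : A ⬝ x = A ⬝ y := by
  by_cases h' : A ⬝ y = M.one
  · rw [h', h.2 h']
  · rw [hy.resolve_right h', hx.resolve_right fun h'' => h' (h.1 h'')]

theorem exists_ee_lt₂ {x y z : M.Seq} (h₁ : rho x < rho y) (h₂ : rho y < rho z) :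
    ∃ k, rho x + ee k < rho y ∧ rho y + ee k < rho z := by
  obtain ⟨k, hk⟩ := exists_ee_lt (sub_mem (rho_mem y) (rho_mem x)) (sub_pos.2 h₁)
  obtain ⟨l, hl⟩ := exists_ee_lt (sub_mem (rho_mem z) (rho_mem y)) (sub_pos.2 h₂)
  have h₃ : ee (max k l) ≤ ee k := ee_anti (le_max_left k l)
  have h₄ : ee (max k l) ≤ ee l := ee_anti (le_max_right k l)
  exact ⟨max k l, by linarith, by linarith⟩

theorem isOpen_ioo {I : Set M.Seq} (hI : I = M.line ∨ I = M.unitInterval) {a b : M.Seq}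
    (ha : RCAModel.IsReal a) (hb : RCAModel.IsReal b) : RCAModel.IsOpen₁ I (ioo a b) := by
  refine ⟨fun x _ => ioo_zero_or_one a b x, fun x hx y hy h => ?_, fun x hx h => ?_⟩
  · have hx' := isReal_of_mem hI hx
    have hy' := isReal_of_mem hI hy
    refine eq_of_eqR_of_iff (ioo_zero_or_one a b x) (ioo_zero_or_one a b y) ?_
    rw [ioo_eq_one ha hb hx', ioo_eq_one ha hb hy', (eqR_iff_rho hx' hy').1 h]
  · have hx' := isReal_of_mem hI hx
    rw [ioo_eq_one ha hb hx'] at h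
    obtain ⟨k, h₁, h₂⟩ := exists_ee_lt₂ h.1 h.2
    refine ⟨k, fun z hz hxz => ?_⟩
    have hz' := isReal_of_mem hI hz
    rw [close_iff_rho hx' hz', abs_le] at hxz
    rw [ioo_eq_one ha hb hz']
    constructor <;> linarith

theorem boundary_ioo {I : Set M.Seq} (hI : I = M.line ∨ I = M.unitInterval) {a b z : M.Seq}
    (ha : RCAModel.IsReal a) (hb : RCAModel.IsReal b) (hz : z ∈ RCAModel.boundary₁ I (ioo a b)) :
    rho z = rho a ∨ rho z = rho b := by
  obtain ⟨hzI, h₁, h₂⟩ := hz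
  have hz' := isReal_of_mem hI hzI
  by_contra! hne
  by_cases h : ioo a b ⬝ z = M.one
  · obtain ⟨k, hk⟩ := (isOpen_ioo hI ha hb).2.2 z hzI h
    obtain ⟨w, hw, hzw, hw'⟩ := h₂ k
    exact hw' (hk w hw hzw)
  · rw [ioo_eq_one ha hb hz'] at h
    rcases lt_or_gt_of_ne hne.1 with h' | h'
    · obtain ⟨k, hk⟩ := exists_ee_lt (sub_mem (rho_mem a) (rho_mem z)) (sub_pos.2 h')
      obtain ⟨w, hw, hzw, hw'⟩ := h₁ k
      have hwr := isReal_of_mem hI hw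
      rw [ioo_eq_one ha hb hwr] at hw'
      rw [close_iff_rho hz' hwr, abs_le] at hzw
      linarith
    · have h'' : rho b < rho z := lt_of_le_of_ne (not_lt.1 fun h'' => h ⟨h', h''⟩) hne.2.symm
      obtain ⟨k, hk⟩ := exists_ee_lt (sub_mem (rho_mem z) (rho_mem b)) (sub_pos.2 h'')
      obtain ⟨w, hw, hzw, hw'⟩ := h₁ k
      have hwr := isReal_of_mem hI hw
      rw [ioo_eq_one ha hb hwr] at hw'
      rw [close_iff_rho hz' hwr, abs_le] at hzw
      linarith

/-- The window is an interval whose end-points are codes of `decode x`, so that `h` has the value `h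
x` on its boundary. -/
theorem peripheral_of_decode {h : M.carrier (ty1 ⇒ ty1)}
    (hh : ∀ y y', decode y = decode y' → h ⬝ y = h ⬝ y') :
    RCAModel.Peripheral₁ M.unitInterval h := by
  intro x hx a ha b hb c hc d hd hax hxb hcx hxd
  have hx' := mem_unitInterval.1 hx
  rw [ltR_iff_rho ha hx'.1] at hax
  rw [ltR_iff_rho hx'.1 hb] at hxb
  obtain ⟨a', har, hax', haz, hda⟩ : ∃ a', RCAModel.IsReal a' ∧ rho a' < rho x ∧
      (∀ z ∈ M.unitInterval, rho a' < rho z → rho a < rho z) ∧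
      ∀ z ∈ M.unitInterval, rho z = rho a' → decode z = decode x := by
    rcases hx'.2.1.lt_or_eq with h₀ | h₀
    · obtain ⟨N, j, hN⟩ := exists_code_left ha hax hx h₀
      obtain ⟨-, h₁, h₂⟩ := hN (decode x)
      exact ⟨_, isReal_code _ _ _, h₂, fun z _ hz => h₁.trans hz, fun z hz h₃ => by
        rw [decode_congr hz.1 (isReal_code _ _ _) h₃, decode_code]⟩
    -- At `x = 0` there is no room for a code on the left; the end-point `-1` lies outside `[0,1]`
    -- and contributes no boundary point. The end-point `2` does the same at `x = 1`.
    · have h₁ : rho (qreal (-1 : QQ M)) = -1 := by rw [rho_qreal, map_neg, map_one]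
      refine ⟨qreal (-1), isReal_qreal _, ?_, fun z hz _ => ?_, fun z hz h₃ => ?_⟩
      · rw [h₁, ← h₀]; exact neg_one_lt_zero
      · exact (h₀ ▸ hax).trans_le (mem_unitInterval.1 hz).2.1
      · linarith [(mem_unitInterval.1 hz).2.1]
  obtain ⟨b', hbr, hxb', hbz, hdb⟩ : ∃ b', RCAModel.IsReal b' ∧ rho x < rho b' ∧
      (∀ z ∈ M.unitInterval, rho z < rho b' → rho z < rho b) ∧
      ∀ z ∈ M.unitInterval, rho z = rho b' → decode z = decode x := by
    rcases hx'.2.2.lt_or_eq with h₀ | h₀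
    · obtain ⟨N, j, hN⟩ := exists_code_right hxb hx h₀
      obtain ⟨-, h₁, h₂⟩ := hN (decode x)
      exact ⟨_, isReal_code _ _ _, h₁, fun z _ hz => hz.trans h₂, fun z hz h₃ => by
        rw [decode_congr hz.1 (isReal_code _ _ _) h₃, decode_code]⟩
    · have h₁ : rho (qreal (2 : QQ M)) = 2 := by rw [rho_qreal, map_ofNat]
      refine ⟨qreal 2, isReal_qreal _, ?_, fun z hz _ => ?_, fun z hz h₃ => ?_⟩
      · rw [h₁, h₀]; exact one_lt_two
      · exact (mem_unitInterval.1 hz).2.2.trans_lt (h₀ ▸ hxb)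
      · linarith [(mem_unitInterval.1 hz).2.2]
  refine ⟨ioo a' b', isOpen_ioo (Or.inr rfl) har hbr, (ioo_eq_one har hbr hx'.1).2 ⟨hax', hxb'⟩,
    fun z hz hz' => ?_, fun z hz => ?_⟩
  · rw [ioo_eq_one har hbr hz.1] at hz'
    rw [ltR_iff_rho ha hz.1, ltR_iff_rho hz.1 hb]
    exact ⟨haz z hz hz'.1, hbz z hz hz'.2⟩
  · have : decode z = decode x := by
      rcases boundary_ioo (Or.inr rfl) har hbr hz with h' | h'
      · exact hda z hz.1 h'
      · exact hdb z hz.1 h'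
    rw [hh z x this]
    exact ⟨hcx, hxd⟩

/-! ### Functions of two variables that depend on the decoded arguments only -/

section

variable {f : M.carrier (ty1 ⇒ ty1 ⇒ ty1)}
  (hf : ∀ x y x' y', decode x = decode x' → decode y = decode y' → f ⬝ x ⬝ y = f ⬝ x' ⬝ y')
  (hv : ∀ x y, f ⬝ x ⬝ y = qreal 0 ∨ f ⬝ x ⬝ y = qreal 1)

include hv in
theorem isReal_of_values (x y : M.Seq) : RCAModel.IsReal (f ⬝ x ⬝ y) := by
  rcases hv x y with h | h <;> rw [h] <;> exact isReal_qreal _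

include hf

/-- Every value of `f` is taken arbitrarily close to every point, at codes of the sequences that `q`
decodes to. -/
theorem exists_close_of_decode {p q : M.Seq × M.Seq} (hp : p ∈ M.unitInterval ×ˢ M.unitInterval)
    (k : M.N) : ∃ s ∈ M.unitInterval ×ˢ M.unitInterval, RCAModel.close₂ k p s ∧
      f ⬝ s.1 ⬝ s.2 = f ⬝ q.1 ⬝ q.2 := by
  obtain ⟨x, hx, hx', hx''⟩ := exists_code_close hp.1 k (decode q.1)
  obtain ⟨y, hy, hy', hy''⟩ := exists_code_close hp.2 k (decode q.2)
  exact ⟨(x, y), ⟨hx, hy⟩, ⟨hx', hy'⟩, hf _ _ _ _ hx'' hy''⟩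

/-- A non-empty inverse image is dense, so its closure is the whole square and any radius works. -/
theorem preimage_preOpen (G : M.carrier (ty1 ⇒ ty0)) :
    RCAModel.preimage M.unitInterval f G ⊆ RCAModel.interior₂ M.unitInterval
      (RCAModel.closure₂ M.unitInterval (RCAModel.preimage M.unitInterval f G)) := by
  rintro p ⟨hp, hG⟩
  refine ⟨hp, 0, fun s hs _ => ⟨hs, fun k => ?_⟩⟩
  obtain ⟨t, ht, hst, h⟩ := exists_close_of_decode hf (q := p) hs k
  exact ⟨t, ht, ⟨ht, h ▸ hG⟩, hst⟩

include hv

/-- The continuous function is constant: any one value of `f` is taken on a dense set. -/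
theorem graphContinuous_of_decode : RCAModel.GraphContinuous M.unitInterval f := by
  set v := f ⬝ qreal 0 ⬝ qreal 0 with hvdef
  have hr : RCAModel.IsReal v := isReal_of_values hv _ _
  refine ⟨lam fun _ => lam fun _ => v, ⟨fun x _ y _ => ?_, fun x _ y _ x' _ y' _ _ _ => ?_⟩,
    fun p _ k => ⟨0, fun s _ _ => ?_⟩, fun p hp k => ?_⟩
  · rw [lam_app, lam_app]; exact hr
  · simp only [lam_app]; exact (eqR_iff_rho hr hr).2 rfl
  · simp only [lam_app]; exact close_refl hr k
  · obtain ⟨s, hs, hs', h⟩ := exists_close_of_decode hf (q := (qreal 0, qreal 0)) hp k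
    refine ⟨s, hs, hs', ?_⟩
    rw [h]
    simp only [lam_app]
    exact close_refl hr k

theorem young_of_decode₂ : RCAModel.Young M.unitInterval f :=
  ⟨fun x _ => young_of_decode (fun y => isReal_of_values hv x y) fun y y' h => hf _ _ _ _ rfl h,
    fun y _ => young_of_decode (fun x => by
      rw [RCAModel.sectionLeft_app]; exact isReal_of_values hv x y) fun x x' h => by
      rw [RCAModel.sectionLeft_app, RCAModel.sectionLeft_app]; exact hf _ _ _ _ h rfl⟩

omit hv in
theorem peripheral_of_decode₂ : RCAModel.Peripheral M.unitInterval f :=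
  ⟨fun x _ => peripheral_of_decode fun y y' h => hf _ _ _ _ rfl h,
    fun y _ => peripheral_of_decode fun x x' h => by
      rw [RCAModel.sectionLeft_app, RCAModel.sectionLeft_app]; exact hf _ _ _ _ h rfl⟩

-- A non-empty open set of reals contains a number other than `0` and `1`, and its fiber is empty.
omit hf in
theorem not_cesaro_of_values : ¬ RCAModel.CesaroType M.unitInterval f := by
  rintro ⟨U, V, -, ⟨p, hp⟩, hV, ⟨z, hz, hzV⟩, h⟩
  obtain ⟨z, hz, hzV, h₀, h₁⟩ : ∃ z ∈ M.line, V ⬝ z = M.one ∧ rho z ≠ 0 ∧ rho z ≠ 1 := by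
    by_cases h₀ : rho z = 0 ∨ rho z = 1
    · obtain ⟨k, hk⟩ := hV.2.2 z hz hzV
      -- A shift by at most `1/2` leads from `0` or `1` to neither of them and stays inside `V`.
      obtain ⟨w, hw, hw'⟩ := exists_shift hz (ex (k + 1))
      change _ = _ + ee (k + 1) at hw'
      have h₁ := ee_pos k
      have h₂ : ee k ≤ 1 := by rw [← ee_zero]; exact ee_anti zero_le
      rw [ee_add_one] at hw'
      refine ⟨w, hw, hk w hw ?_, ?_, ?_⟩
      · rw [close_iff_rho hz hw, hw', abs_le]
        constructor <;> linarith
      · rcases h₀ with h₀ | h₀ <;> apply ne_of_gt <;> linarith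
      · rcases h₀ with h₀ | h₀
        · apply ne_of_lt; linarith
        · apply ne_of_gt; linarith
    · rw [not_or] at h₀
      exact ⟨z, hz, hzV, h₀⟩
  obtain ⟨s, -, hs, -⟩ := (h z hz hzV hp).2 0
  have hs' := (eqR_iff_rho (isReal_of_values hv s.1 s.2) hz).1 hs.2
  rcases hv s.1 s.2 with h | h <;> rw [h, rho_qreal] at hs'
  · exact h₀ (by rw [← hs', map_zero])
  · exact h₁ (by rw [← hs', map_one])

omit hv in
theorem cContinuous_of_decode (hI : RCAModel.IsFun M.unitInterval M.unitInterval f) :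
    RCAModel.CContinuous M.unitInterval f := by
  intro G hG
  have hA : ∀ x y, (lam fun x => lam fun y =>
      sel (G ⬝ (f ⬝ x ⬝ y) = M.one) M.one M.zero : M.carrier (ty1 ⇒ ty1 ⇒ ty0)) ⬝ x ⬝ y = M.one ↔
      G ⬝ (f ⬝ x ⬝ y) = M.one := fun x y => by
    rw [lam_app, lam_app]
    by_cases h : G ⬝ (f ⬝ x ⬝ y) = M.one
    · exact iff_of_true (sel_of h _ _) h
    · exact iff_of_false (by rw [sel_of_not h]; exact one_ne_zero'.symm) h
  have hA' : RCAModel.points₂ M.unitInterval (lam fun x => lam fun y =>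
      sel (G ⬝ (f ⬝ x ⬝ y) = M.one) M.one M.zero) = RCAModel.preimage M.unitInterval f G := by
    ext p
    exact and_congr_right fun _ => hA p.1 p.2
  have hO : ∀ x y, (lam fun _ => lam fun _ => M.one : M.carrier (ty1 ⇒ ty1 ⇒ ty0)) ⬝ x ⬝ y =
      M.one := fun x y => by rw [lam_app, lam_app]
  refine ⟨lam fun _ => lam fun _ => M.one, lam fun x => lam fun y =>
      sel (G ⬝ (f ⬝ x ⬝ y) = M.one) M.one M.zero, ⟨⟨fun x _ y _ => Or.inr (hO x y),
      fun x _ y _ x' _ y' _ _ _ => by rw [hO, hO]⟩, fun p hp => ⟨hp.1, 0, fun s hs _ =>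
        ⟨hs, hO _ _⟩⟩⟩, ⟨fun x _ y _ => ?_, fun x hx y hy x' hx' y' hy' hxx' hyy' => ?_⟩, ?_, ?_⟩
  · rw [lam_app, lam_app]
    by_cases h : G ⬝ (f ⬝ x ⬝ y) = M.one
    · exact Or.inr (sel_of h _ _)
    · exact Or.inl (sel_of_not h _ _)
  · rw [lam_app, lam_app, lam_app, lam_app, hG.2.1 _ (hI.1 x hx y hy).1 _ (hI.1 x' hx' y' hy').1
      (hI.2 x hx y hy x' hx' y' hy' hxx' hyy')]
  · rw [hA']
    exact preimage_preOpen hf G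
  · rw [hA']
    ext p
    exact ⟨fun hp => ⟨⟨hp.1, hO _ _⟩, hp⟩, fun hp => hp.2⟩

theorem holds_of_decode (Γ : WeakContinuity)
    (hI : RCAModel.IsFun M.unitInterval M.unitInterval f) : Γ.Holds M.unitInterval f := by
  cases Γ
  · exact graphContinuous_of_decode hf hv
  · exact young_of_decode₂ hf hv
  · exact fun p hp G _ hG' => preimage_preOpen hf G ⟨hp, hG'⟩
  · exact not_cesaro_of_values hv
  · exact peripheral_of_decode₂ hf
  · exact fun G _ => preimage_preOpen hf G
  · exact cContinuous_of_decode hf hI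

end

/-! ### The supremum principle and quantification over the Baire space -/

/-- The function with the value `1` at the pairs of codes of the zeros of `Y`, and `0` elsewhere. -/
noncomputable def zeroIndicator (Y : M.carrier (ty1 ⇒ ty1 ⇒ ty0)) : M.carrier (ty1 ⇒ ty1 ⇒ ty1) :=
  lam fun x => lam fun y =>
    RCAModel.ratReal (sel (Y ⬝ decode x ⬝ decode y = M.zero) (qcode 1) (qcode 0))

theorem zeroIndicator_of_eq {Y : M.carrier (ty1 ⇒ ty1 ⇒ ty0)} {x y : M.Seq}
    (h : Y ⬝ decode x ⬝ decode y = M.zero) : zeroIndicator Y ⬝ x ⬝ y = qreal 1 := by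
  unfold zeroIndicator
  rw [lam_app, lam_app, sel_of h, qreal]

theorem zeroIndicator_of_ne {Y : M.carrier (ty1 ⇒ ty1 ⇒ ty0)} {x y : M.Seq}
    (h : Y ⬝ decode x ⬝ decode y ≠ M.zero) : zeroIndicator Y ⬝ x ⬝ y = qreal 0 := by
  unfold zeroIndicator
  rw [lam_app, lam_app, sel_of_not h, qreal]

/-- Every sequence `h` is decoded from some point of `[0,1]`, so the supremum at a code of `g` is
`1` if a zero exists and `0` otherwise. Whether it is positive is an arithmetical question about
`V`, hence answered by a functional of the model. -/
theorem exists_of_supPrinciple (Γ : WeakContinuity)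
    (hS : M.SupPrinciple M.unitInterval M.unitInterval fun f => Γ.Holds M.unitInterval f)
    (Y : M.carrier (ty1 ⇒ ty1 ⇒ ty0)) :
    ∃ Z : M.carrier (ty1 ⇒ ty0), ∀ g, Z ⬝ g = M.zero ↔ ∃ h, Y ⬝ g ⬝ h = M.zero := by
  set f := zeroIndicator Y with hfdef
  have hf : ∀ x y x' y', decode x = decode x' → decode y = decode y' →
      f ⬝ x ⬝ y = f ⬝ x' ⬝ y' := fun x y x' y' hx hy => by
    by_cases h : Y ⬝ decode x ⬝ decode y = M.zero
    · rw [hfdef, zeroIndicator_of_eq h, zeroIndicator_of_eq (hx ▸ hy ▸ h)]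
    · rw [hfdef, zeroIndicator_of_ne h, zeroIndicator_of_ne (hx ▸ hy ▸ h)]
  have hv : ∀ x y, f ⬝ x ⬝ y = qreal 0 ∨ f ⬝ x ⬝ y = qreal 1 := fun x y => by
    by_cases h : Y ⬝ decode x ⬝ decode y = M.zero
    · exact Or.inr (zeroIndicator_of_eq h)
    · exact Or.inl (zeroIndicator_of_ne h)
  have hI : RCAModel.IsFun M.unitInterval M.unitInterval f := by
    refine ⟨fun x _ y _ => ?_, fun x hx y hy x' hx' y' hy' hxx' hyy' => ?_⟩
    · rcases hv x y with h | h <;> rw [h]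
      · exact qreal_zero_mem
      · exact qreal_one_mem
    · rw [eqR_iff_rho hx.1 hx'.1] at hxx'
      rw [eqR_iff_rho hy.1 hy'.1] at hyy'
      rw [hf x y x' y' (decode_congr hx.1 hx'.1 hxx') (decode_congr hy.1 hy'.1 hyy')]
      exact (eqR_iff_rho (isReal_of_values hv _ _) (isReal_of_values hv _ _)).2 rfl
  obtain ⟨T, V, hTV⟩ := hS f hI (holds_of_decode hf hv Γ hI)
  refine ⟨lam fun g => chi M (¬ RCAModel.leR (V ⬝ code g 0 0 ⬝ qcode 0 ⬝ qcode 1) (qreal 0)),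
    fun g => ?_⟩
  rw [lam_app, chi_eq_zero]
  have hmem : ∀ g, code g 0 0 ∈ M.unitInterval := fun g => by
    rw [mem_unitInterval]
    obtain ⟨h₁, h₂⟩ := code_bounds g 0 0
    rw [map_zero, zero_add, quart_zero, one_mul, map_one] at h₂
    exact ⟨isReal_code _ _ _, code_nonneg _ _ _, h₂.le⟩
  have hbound : ∀ y ∈ M.unitInterval, RCAModel.leR (qreal 0) y ∧ RCAModel.leR y (qreal 1) :=
    fun y hy => by
      rw [leR_iff_rho (isReal_qreal _) hy.1, leR_iff_rho hy.1 (isReal_qreal _), rho_qreal,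
        rho_qreal, map_zero, map_one]
      exact (mem_unitInterval.1 hy).2
  have hdec : ∀ y, f ⬝ code g 0 0 ⬝ y = qreal 1 ↔ Y ⬝ g ⬝ decode y = M.zero := fun y => by
    by_cases h : Y ⬝ g ⬝ decode y = M.zero
    · exact iff_of_true (zeroIndicator_of_eq (by rwa [decode_code])) h
    · refine iff_of_false (fun h' => ?_) h
      rw [hfdef, zeroIndicator_of_ne (by rwa [decode_code])] at h'
      have := congrArg rho h'
      rw [rho_qreal, rho_qreal, cst_inj] at this
      exact zero_ne_one this
  rcases hTV _ (hmem g) _ _ (isRat_qcode 0) (isRat_qcode 1) qreal_zero_mem qreal_one_mem with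
    ⟨-, hreal, hub, hlub⟩ | ⟨-, hinf⟩ | ⟨-, hempty⟩
  · rw [leR_iff_rho hreal (isReal_qreal _), rho_qreal, map_zero]
    constructor
    · intro h
      by_contra! hno
      refine h ?_
      have := hlub (qreal 0) (isReal_qreal _) fun y hy _ _ => by
        rw [(hv _ y).resolve_right fun h' => hno _ ((hdec y).1 h')]
        exact (leR_iff_rho (isReal_qreal _) (isReal_qreal _)).2 le_rfl
      rwa [leR_iff_rho hreal (isReal_qreal _), rho_qreal, map_zero] at this
    · rintro ⟨h, hh⟩
      have := hub _ (hmem h) (hbound _ (hmem h)).1 (hbound _ (hmem h)).2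
      rw [(hdec _).2 (by rwa [decode_code]), leR_iff_rho (isReal_qreal _) hreal, rho_qreal,
        map_one] at this
      exact not_le.2 (zero_lt_one.trans_le this)
  · obtain ⟨y, hy, -, -, h⟩ := hinf (qreal 1) (isReal_qreal _)
    rw [ltR_iff_rho (isReal_qreal _) (isReal_of_values hv _ _), rho_qreal, map_one] at h
    exact absurd (mem_unitInterval.1 (hI.1 _ (hmem g) y hy)).2.2 (not_le.2 h)
  · exact absurd ⟨_, qreal_zero_mem, hbound _ qreal_zero_mem⟩ hempty

/-! ### Packing a number with a sequence, and `BOOT₂` -/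

/-- The sequence `n, f 0, f 1, …`. -/
noncomputable def cons (n : M.N) (f : M.Seq) : M.Seq :=
  lam fun k => M.R ⬝ k ⬝ n ⬝ lam fun _ => lam fun l => f ⬝ l

omit [Fact M.Exists2] in
theorem cons_zero (n : M.N) (f : M.Seq) : cons n f ⬝ M.zero = n := by
  unfold cons
  rw [lam_app, M.R_zero]

omit [Fact M.Exists2] in
theorem cons_succ (n : M.N) (f : M.Seq) (k : M.N) : cons n f ⬝ (M.succ ⬝ k) = f ⬝ k := by
  unfold cons
  rw [lam_app, M.R_succ, lam_app, lam_app]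

instance isDef_cons {C : Type u} [Ctx M C] (n : C → M.N) (f : C → M.Seq) [IsDef n] [IsDef f] :
    IsDef fun c => cons (n c) (f c) := by
  unfold cons; infer_instance

/-- The sequence `a 1, a 2, …`. -/
noncomputable def tail (a : M.Seq) : M.Seq := lam fun k => a ⬝ (M.succ ⬝ k)

instance isDef_tail {C : Type u} [Ctx M C] (a : C → M.Seq) [IsDef a] :
    IsDef fun c => tail (a c) := by
  unfold tail; infer_instance

omit [Fact M.Exists2] in
theorem tail_cons (n : M.N) (f : M.Seq) : tail (cons n f) = f := by
  apply M.ext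
  intro k
  rw [tail, lam_app, cons_succ]

theorem boot₂_of_supPrinciple (Γ : WeakContinuity)
    (hS : M.SupPrinciple M.unitInterval M.unitInterval fun f => Γ.Holds M.unitInterval f) :
    M.BOOT₂ := by
  intro Y
  -- `∃ f ∀ g` is read as `∃ f ¬ ∃ g ¬`. The inner quantifier has the parameters `n` and `f`, packed
  -- into the single sequence `a`; the outer one has `n` alone, passed as a constant sequence.
  obtain ⟨Z, hZ⟩ := exists_of_supPrinciple Γ hS
    (lam fun a => lam fun g => chi M (Y ⬝ tail a ⬝ g ⬝ (a ⬝ M.zero) ≠ M.zero))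
  obtain ⟨W, hW⟩ := exists_of_supPrinciple Γ hS
    (lam fun b => lam fun f => chi M (Z ⬝ cons (b ⬝ M.zero) f ≠ M.zero))
  simp only [lam_app, chi_eq_zero] at hZ hW
  refine ⟨lam fun n => sel (W ⬝ (M.K ⬝ n) = M.zero) M.one M.zero, fun n => ?_, fun n => ?_⟩
  · rw [lam_app]
    by_cases h : W ⬝ (M.K ⬝ n) = M.zero
    · exact Or.inr (sel_of h _ _)
    · exact Or.inl (sel_of_not h _ _)
  · have key : W ⬝ (M.K ⬝ n) = M.zero ↔ ∃ f : M.Seq, ∀ g : M.Seq, Y ⬝ f ⬝ g ⬝ n = M.zero := by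
      rw [hW]
      refine exists_congr fun f => ?_
      rw [Ne, hZ, tail_cons, cons_zero, M.K_app, not_exists_not]
    rw [lam_app, ← key]
    by_cases h : W ⬝ (M.K ⬝ n) = M.zero
    · exact iff_of_true (sel_of h _ _) h
    · exact iff_of_false (by rw [sel_of_not h]; exact one_ne_zero'.symm) h

/-! ### Arithmetical formulas -/

omit [Fact M.Exists2] in
theorem isDef_termVal {C : Type u} [Ctx M C] (e : ℕ → C → M.N) (he : ∀ i, IsDef (e i))
    (t : L2Term) : IsDef fun c => RCAModel.termVal (fun i => e i c) t := by
  induction t with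
  | var i => exact he i
  | zero => exact isDef_const _
  | one => exact isDef_const _
  | add s t hs ht => exact isDef_natAdd _ _
  | mul s t hs ht => exact isDef_natMul _ _

/-- The context varies in the induction because a number quantifier adds a variable to it. -/
theorem isAr_sat (φ : ArithFormula) : ∀ {C : Type u} [Ctx M C] (X : ℕ → C → M.Seq)
    (e : ℕ → C → M.N), (∀ i, IsDef (X i)) → (∀ i, IsDef (e i)) →
    IsAr M fun c => RCAModel.Sat (fun i => X i c) (fun i => e i c) φ := by
  induction φ with
  | eq s t =>
    intro C _ X e hX he
    have := isDef_termVal e he s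
    have := isDef_termVal e he t
    exact isAr_eq _ _
  | lt s t =>
    intro C _ X e hX he
    have := isDef_termVal e he s
    have := isDef_termVal e he t
    simp only [RCAModel.Sat, lt_iff]
    infer_instance
  | mem t j =>
    intro C _ X e hX he
    have := isDef_termVal e he t
    have := hX j
    simp only [RCAModel.Sat]
    infer_instance
  | neg φ ih =>
    intro C _ X e hX he
    have := ih X e hX he
    exact isAr_not _
  | and φ ψ ih₁ ih₂ =>
    intro C _ X e hX he
    have := ih₁ X e hX he
    have := ih₂ X e hX he
    exact isAr_and _ _
  | all i φ ih =>
    intro C _ X e hX he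
    have := ih (C := C × M.N) (fun j c => X j c.1)
      (fun j c => Function.update (fun j => e j c.1) i c.2 j)
      (fun j => isDef_weak (X j)) (fun j => by
        by_cases h : j = i
        · subst h
          simp only [Function.update_self]
          infer_instance
        · simp only [Function.update_of_ne h]
          have := he j
          infer_instance)
    exact isAr_forall (fun c n => RCAModel.Sat (fun j => X j c)
      (Function.update (fun j => e j c) i n) φ)

theorem pi12CA_of_boot₂ (hB : M.BOOT₂) : M.Pi12CA := by
  intro φ e X
  have : IsAr M fun c : ((PUnit.{u + 1} × M.Seq) × M.Seq) × M.N =>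
      RCAModel.Sat (Function.update (Function.update X 0 c.1.1.2) 1 c.1.2)
        (Function.update e 0 c.2) φ := by
    refine isAr_sat φ (fun i (c : ((PUnit.{u + 1} × M.Seq) × M.Seq) × M.N) =>
      Function.update (Function.update X 0 c.1.1.2) 1 c.1.2 i)
      (fun i c => Function.update e 0 c.2 i) (fun i => ?_) (fun i => ?_)
    · by_cases h₁ : i = 1
      · subst h₁
        simp only [Function.update_self]
        infer_instance
      · simp only [Function.update_of_ne h₁]
        by_cases h₀ : i = 0
        · subst h₀
          simp only [Function.update_self]
          infer_instance
        · simp only [Function.update_of_ne h₀]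
          infer_instance
    · by_cases h₀ : i = 0
      · subst h₀
        simp only [Function.update_self]
        infer_instance
      · simp only [Function.update_of_ne h₀]
        infer_instance
  obtain ⟨t, ht⟩ : ∃ t : M.carrier (ty1 ⇒ ty1 ⇒ ty0 ⇒ ty0), ∀ A B n, t ⬝ A ⬝ B ⬝ n = M.zero ↔
      RCAModel.Sat (Function.update (Function.update X 0 A) 1 B) (Function.update e 0 n) φ := by
    obtain ⟨⟨G₁, ⟨G₂, ⟨G₃, -, h₃⟩, h₂⟩, h₁⟩⟩ := this.rep
    refine ⟨G₃ ⟨⟩, fun A B n => ?_⟩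
    rw [h₃, h₂, h₁, chi_eq_zero]
  -- `Z` collects the `n` with `∃ A ∀ B ¬ φ`; the required set is its complement.
  obtain ⟨Z, -, hZ⟩ := hB (lam fun A => lam fun B => lam fun n => chi M (t ⬝ A ⬝ B ⬝ n ≠ M.zero))
  simp only [lam_app, chi_eq_zero] at hZ
  simp only [Ne, ht] at hZ
  refine ⟨lam fun n => sel (Z ⬝ n = M.one) M.zero M.one, fun n => ?_, fun n => ?_⟩
  · rw [lam_app]
    by_cases h : Z ⬝ n = M.one
    · exact Or.inl (sel_of h _ _)
    · exact Or.inr (sel_of_not h _ _)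
  · have key : ¬ Z ⬝ n = M.one ↔ ∀ A : M.Seq, ∃ B : M.Seq,
        RCAModel.Sat (Function.update (Function.update X 0 A) 1 B) (Function.update e 0 n) φ := by
      rw [hZ]; push Not; rfl
    rw [lam_app, ← key]
    by_cases h : Z ⬝ n = M.one
    · exact iff_of_false (by rw [sel_of h]; exact one_ne_zero'.symm) (not_not_intro h)
    · exact iff_of_true (sel_of_not h _ _) h

/-! ### Folding the line onto the unit interval -/

/-- `z` is an integer. -/
def IsInt (z : QQ M) : Prop := ∃ a b : M.N, z = nn a - nn b

theorem isInt_zero : IsInt (0 : QQ M) := ⟨0, 0, by simp⟩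

theorem IsInt.add_one {z : QQ M} (h : IsInt z) : IsInt (z + 1) := by
  obtain ⟨a, b, rfl⟩ := h
  exact ⟨a + 1, b, by rw [nn_add_one]; ring⟩

theorem IsInt.sub_one {z : QQ M} (h : IsInt z) : IsInt (z - 1) := by
  obtain ⟨a, b, rfl⟩ := h
  exact ⟨a, b + 1, by rw [nn_add_one]; ring⟩

theorem IsInt.add_one_le {y z : QQ M} (hy : IsInt y) (hz : IsInt z) (h : y < z) : y + 1 ≤ z := by
  obtain ⟨a, b, rfl⟩ := hy
  obtain ⟨c, d, rfl⟩ := hz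
  have : nn (a + d) < nn (c + b) := by rw [map_add, map_add]; linarith
  have := nn_lt this
  rw [map_add, map_add] at this
  linarith

theorem exists_isInt_abs_le (q : QQ M) : ∃ z, IsInt z ∧ |q - 2 * z| ≤ 1 := by
  obtain ⟨a, b, h₁, h₂⟩ := exists_floor ((q + 1) / 2)
  exact ⟨_, ⟨a, b, rfl⟩, abs_le.2 ⟨by linarith, by linarith⟩⟩

noncomputable def foldPos (q : QQ M) : M.N := eps fun a => ∃ b : M.N, |q - 2 * (nn a - nn b)| ≤ 1

noncomputable def foldNeg (q : QQ M) : M.N := eps fun b => |q - 2 * (nn (foldPos q) - nn b)| ≤ 1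

/-- The distance to the nearest even integer. -/
noncomputable def foldQ (q : QQ M) : QQ M := |q - 2 * (nn (foldPos q) - nn (foldNeg q))|

instance isDef_foldPos {C : Type u} [Ctx M C] (F : C → QQ M) [IsRatDef F] :
    IsDef fun c => foldPos (F c) := by
  unfold foldPos; infer_instance

instance isDef_foldNeg {C : Type u} [Ctx M C] (F : C → QQ M) [IsRatDef F] :
    IsDef fun c => foldNeg (F c) := by
  unfold foldNeg; infer_instance

instance isRatDef_foldQ {C : Type u} [Ctx M C] (F : C → QQ M) [IsRatDef F] :
    IsRatDef fun c => foldQ (F c) := by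
  unfold foldQ; infer_instance

theorem foldQ_le_one (q : QQ M) : foldQ q ≤ 1 := by
  obtain ⟨z, ⟨a, b, rfl⟩, h⟩ := exists_isInt_abs_le q
  exact eps_spec (fun b => |q - 2 * (nn (foldPos q) - nn b)| ≤ 1)
    (eps_spec (fun a => ∃ b : M.N, |q - 2 * (nn a - nn b)| ≤ 1) ⟨a, b, h⟩)

/-- Two different candidates occur only if `q` is an odd integer, and then both distances are `1`;
so `foldQ` does not depend on the outcome of the search. -/
theorem abs_sub_int_unique {q y z : QQ M} (hy : IsInt y) (hz : IsInt z) (h₁ : |q - 2 * y| ≤ 1)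
    (h₂ : |q - 2 * z| ≤ 1) : |q - 2 * y| = |q - 2 * z| := by
  have key : ∀ {y z : QQ M}, IsInt y → IsInt z → |q - 2 * y| ≤ 1 → |q - 2 * z| ≤ 1 → y < z →
      |q - 2 * y| = |q - 2 * z| := by
    intro y z hy hz h₁ h₂ h
    have := hy.add_one_le hz h
    rw [abs_le] at h₁ h₂
    rw [abs_of_nonneg, abs_of_nonpos] <;> linarith
  rcases lt_trichotomy y z with h | rfl | h
  · exact key hy hz h₁ h₂ h
  · rfl
  · exact (key hz hy h₂ h₁ h).symm

theorem foldQ_eq {q z : QQ M} (hz : IsInt z) (h : |q - 2 * z| ≤ 1) : foldQ q = |q - 2 * z| :=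
  abs_sub_int_unique ⟨_, _, rfl⟩ hz (foldQ_le_one q) h

/-- `foldQ` is thus the minimum of the 1-Lipschitz functions `q ↦ |q - 2 z|`, whence its own
Lipschitz bound. -/
theorem foldQ_le {q z : QQ M} (hz : IsInt z) : foldQ q ≤ |q - 2 * z| := by
  rcases le_total |q - 2 * z| 1 with h | h
  · exact (foldQ_eq hz h).le
  · exact (foldQ_le_one q).trans h

theorem foldQ_lipschitz (p q : QQ M) : |foldQ p - foldQ q| ≤ |p - q| := by
  have key : ∀ p q : QQ M, foldQ p ≤ |p - q| + foldQ q := fun p q =>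
    (foldQ_le ⟨foldPos q, foldNeg q, rfl⟩).trans (abs_sub_le _ _ _)
  rw [abs_sub_le_iff]
  constructor
  · linarith [key p q]
  · rw [abs_sub_comm]; linarith [key q p]

/-- The folding of the line onto the unit interval. -/
noncomputable def fold (x : M.Seq) : M.Seq := mapR foldQ x

instance isDef_fold {C : Type u} [Ctx M C] (F : C → M.Seq) [IsDef F] : IsDef fun c => fold (F c) :=
  isDef_mapR _ _

theorem isReal_fold {x : M.Seq} (hx : RCAModel.IsReal x) : RCAModel.IsReal (fold x) :=
  isReal_mapR foldQ_lipschitz hx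

theorem fold_lipschitz {x y : M.Seq} (hx : RCAModel.IsReal x) (hy : RCAModel.IsReal y) :
    |rho (fold x) - rho (fold y)| ≤ |rho x - rho y| :=
  abs_rho_mapR_sub_le foldQ_lipschitz hx hy

theorem rho_fold {x : M.Seq} (hx : RCAModel.IsReal x) {z : QQ M} (hz : IsInt z)
    (h : |rho x - 2 * cst z| ≤ 1) : rho (fold x) = |rho x - 2 * cst z| := by
  have h2 : (2 : KK M) * cst z = cst (2 * z) := by rw [map_mul, map_ofNat]
  rw [h2] at h ⊢
  refine rho_mapR_eq foldQ_lipschitz hx (abs_mem_reals (sub_mem (rho_mem x) (cst_mem_reals _)))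
    fun k => ?_
  have key : ∀ q, |rho x - cst q| ≤ ee k → |q - 2 * z| ≤ 1 →
      |rho x - cst q| ≤ ee k ∧ |(|rho x - cst (2 * z)|) - cst (foldQ q)| ≤ ee k := by
    intro q hq hq'
    refine ⟨hq, ?_⟩
    rw [foldQ_eq hz hq', cst_abs, map_sub]
    refine (abs_abs_sub_abs_le_abs_sub _ _).trans ?_
    rwa [sub_sub_sub_cancel_right]
  have h₁ := abs_le.1 (abs_rho_sub hx k)
  rw [abs_le] at h
  -- The approximation may overshoot the interval `[2 z - 1, 2 z + 1]` that contains `x`; the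
  -- end-point passed over is then at least as close to `x` and takes its place.
  rcases lt_or_ge (vc (x ⬝ k)) (2 * z - 1) with h' | h'
  · have h'' := cst_lt.2 h'
    refine ⟨2 * z - 1, key _ ?_ ?_⟩
    · rw [map_sub, map_one] at h'' ⊢
      rw [abs_le]; constructor <;> linarith [ee_pos k]
    · rw [abs_le]; constructor <;> linarith
  rcases lt_or_ge (2 * z + 1) (vc (x ⬝ k)) with h₂ | h₂
  · have h'' := cst_lt.2 h₂
    refine ⟨2 * z + 1, key _ ?_ ?_⟩
    · rw [map_add cst, map_one] at h'' ⊢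
      rw [abs_le]; constructor <;> linarith [ee_pos k]
    · rw [abs_le]; constructor <;> linarith
  · exact ⟨_, key _ (abs_rho_sub hx k) (abs_le.2 ⟨by linarith, by linarith⟩)⟩

theorem exists_isInt_abs_rho_le {x : M.Seq} (hx : RCAModel.IsReal x) :
    ∃ z : QQ M, IsInt z ∧ |rho x - 2 * cst z| ≤ 1 := by
  -- The first approximation is within `1` of `x`, so its integer is off by at most one.
  obtain ⟨z, hz, h⟩ := exists_isInt_abs_le (vc (x ⬝ 0))
  have h₁ := abs_le.1 (abs_rho_sub hx 0)
  rw [ee_zero] at h₁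
  rw [← cst_le, cst_abs, map_sub, map_mul, map_ofNat, map_one, abs_le] at h
  rcases lt_or_ge (rho x) (2 * cst z - 1) with h' | h'
  · refine ⟨z - 1, hz.sub_one, ?_⟩
    rw [map_sub, map_one, abs_le]
    constructor <;> linarith
  rcases lt_or_ge (2 * cst z + 1) (rho x) with h'' | h''
  · refine ⟨z + 1, hz.add_one, ?_⟩
    rw [map_add, map_one, abs_le]
    constructor <;> linarith
  · exact ⟨z, hz, abs_le.2 ⟨by linarith, by linarith⟩⟩

theorem fold_mem {x : M.Seq} (hx : RCAModel.IsReal x) : fold x ∈ M.unitInterval := by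
  obtain ⟨z, hz, h⟩ := exists_isInt_abs_rho_le hx
  have := rho_fold hx hz h
  exact mem_unitInterval.2 ⟨isReal_fold hx, this ▸ abs_nonneg _, this ▸ h⟩

theorem rho_fold_of_mem {x : M.Seq} (hx : x ∈ M.unitInterval) : rho (fold x) = rho x := by
  rw [mem_unitInterval] at hx
  have h : |rho x - 2 * cst 0| = rho x := by
    rw [map_zero, mul_zero, sub_zero, abs_of_nonneg hx.2.1]
  rw [rho_fold hx.1 isInt_zero (h.trans_le hx.2.2), h]

theorem fold_congr {x y : M.Seq} (hx : RCAModel.IsReal x) (hy : RCAModel.IsReal y)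
    (h : rho x = rho y) : rho (fold x) = rho (fold y) := by
  have := fold_lipschitz hx hy
  rw [h, sub_self, abs_zero] at this
  exact sub_eq_zero.1 (abs_nonpos_iff.1 this)

theorem eqR_fold {x y : M.Seq} (hx : RCAModel.IsReal x) (hy : RCAModel.IsReal y)
    (h : RCAModel.eqR x y) : RCAModel.eqR (fold x) (fold y) := by
  rw [eqR_iff_rho hx hy] at h
  rw [eqR_iff_rho (isReal_fold hx) (isReal_fold hy), fold_congr hx hy h]

theorem close_fold {x y : M.Seq} (hx : RCAModel.IsReal x) (hy : RCAModel.IsReal y) {k : M.N}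
    (h : RCAModel.close k x y) : RCAModel.close k (fold x) (fold y) := by
  rw [close_iff_rho hx hy] at h
  rw [close_iff_rho (isReal_fold hx) (isReal_fold hy)]
  exact (fold_lipschitz hx hy).trans h

/-! ### Branches of the inverse of the folding -/

/-- The function `y ↦ 2 * z + s * y`. -/
noncomputable def branch (z s : QQ M) (y : M.Seq) : M.Seq := mapR (fun q => 2 * z + s * q) y

instance isDef_branch {C : Type u} [Ctx M C] (z s : QQ M) (F : C → M.Seq) [IsDef F] :
    IsDef fun c => branch z s (F c) := isDef_mapR _ _

theorem isReal_branch {z s : QQ M} (hs : |s| = 1) {y : M.Seq} (hy : RCAModel.IsReal y) :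
    RCAModel.IsReal (branch z s y) := (rho_mapR_affine hs hy).1

theorem rho_branch {z s : QQ M} (hs : |s| = 1) {y : M.Seq} (hy : RCAModel.IsReal y) :
    rho (branch z s y) = 2 * cst z + cst s * rho y := by
  rw [branch, (rho_mapR_affine hs hy).2, map_mul, map_ofNat]

theorem rho_fold_branch {z s : QQ M} (hz : IsInt z) (hs : |s| = 1) {y : M.Seq}
    (hy : y ∈ M.unitInterval) : rho (fold (branch z s y)) = rho y := by
  rw [mem_unitInterval] at hy
  have h : |rho (branch z s y) - 2 * cst z| = rho y := by
    rw [rho_branch hs hy.1, add_sub_cancel_left, abs_mul, ← cst_abs, hs, map_one, one_mul,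
      abs_of_nonneg hy.2.1]
  rw [rho_fold (isReal_branch hs hy.1) hz (h.trans_le hy.2.2), h]

/-- The branch given by `z` and `s` maps the image of `x` under folding to `x`. -/
def IsBranch (x : M.Seq) (z s : QQ M) : Prop :=
  IsInt z ∧ |s| = 1 ∧ rho x = 2 * cst z + cst s * rho (fold x)

theorem IsBranch.dist {x y : M.Seq} {z s : QQ M} (h : IsBranch x z s) (hy : RCAModel.IsReal y) :
    |rho (branch z s y) - rho x| = |rho y - rho (fold x)| := by
  rw [rho_branch h.2.1 hy, h.2.2, add_sub_add_left_eq_sub, ← mul_sub, abs_mul, ← cst_abs, h.2.1,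
    map_one, one_mul]

/-- The bound on `fold x` says that the branch continues to the left of `x`: an increasing branch
needs room below `fold x`, a decreasing one room above it. -/
theorem exists_branch_left {x : M.Seq} (hx : RCAModel.IsReal x) :
    (∃ z, IsBranch x z 1 ∧ 0 < rho (fold x)) ∨ ∃ z, IsBranch x z (-1) ∧ rho (fold x) < 1 := by
  obtain ⟨z, hz, h⟩ := exists_isInt_abs_rho_le hx
  have hf := rho_fold hx hz h
  rw [abs_le] at h
  simp only [IsBranch, abs_neg, abs_one, map_neg, map_one, hf, true_and]
  rcases lt_or_ge (2 * cst z) (rho x) with h₁ | h₁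
  · rw [abs_of_pos (by linarith)]
    exact Or.inl ⟨z, ⟨hz, by ring⟩, by linarith⟩
  · rw [abs_of_nonpos (by linarith)]
    rcases h.1.lt_or_eq with h₂ | h₂
    · exact Or.inr ⟨z, ⟨hz, by ring⟩, by linarith⟩
    -- At `x = 2 z - 1` the decreasing branch of `z` ends, and the increasing branch of `z - 1`
    -- takes over.
    · refine Or.inl ⟨z - 1, ⟨hz.sub_one, ?_⟩, by linarith⟩
      rw [map_sub, map_one]; linarith

theorem exists_branch_right {x : M.Seq} (hx : RCAModel.IsReal x) :
    (∃ z, IsBranch x z 1 ∧ rho (fold x) < 1) ∨ ∃ z, IsBranch x z (-1) ∧ 0 < rho (fold x) := by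
  obtain ⟨z, hz, h⟩ := exists_isInt_abs_rho_le hx
  have hf := rho_fold hx hz h
  rw [abs_le] at h
  simp only [IsBranch, abs_neg, abs_one, map_neg, map_one, hf, true_and]
  rcases lt_or_ge (rho x) (2 * cst z) with h₁ | h₁
  · rw [abs_of_neg (by linarith)]
    exact Or.inr ⟨z, ⟨hz, by ring⟩, by linarith⟩
  · rw [abs_of_nonneg (by linarith)]
    rcases h.2.lt_or_eq with h₂ | h₂
    · exact Or.inl ⟨z, ⟨hz, by ring⟩, by linarith⟩
    · refine Or.inr ⟨z + 1, ⟨hz.add_one, ?_⟩, by linarith⟩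
      rw [map_add, map_one]; linarith

theorem exists_branch {x : M.Seq} (hx : RCAModel.IsReal x) : ∃ z s, IsBranch x z s := by
  rcases exists_branch_left hx with ⟨z, h, -⟩ | ⟨z, h, -⟩
  · exact ⟨z, 1, h⟩
  · exact ⟨z, -1, h⟩

/-- The branch through `x` is an isometric lift of `[0,1]`; thus points near to `fold x` lift to
points equally near to `x`. -/
theorem exists_fold_eq {x y : M.Seq} (hx : RCAModel.IsReal x) (hy : y ∈ M.unitInterval) {k : M.N}
    (h : RCAModel.close k (fold x) y) :
    ∃ w, RCAModel.IsReal w ∧ RCAModel.close k x w ∧ RCAModel.eqR (fold w) y := by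
  obtain ⟨z, s, hzs⟩ := exists_branch hx
  have hw := isReal_branch (z := z) hzs.2.1 hy.1
  refine ⟨branch z s y, hw, ?_, ?_⟩
  · rw [close_iff_rho hx hw, abs_sub_comm, hzs.dist hy.1, abs_sub_comm]
    rwa [close_iff_rho (isReal_fold hx) hy.1] at h
  · rw [eqR_iff_rho (isReal_fold hw) hy.1, rho_fold_branch hzs.1 hzs.2.1 hy]

/-- Near to each point, the folding preserves the distances to this point. -/
theorem exists_radial {x : M.Seq} (hx : RCAModel.IsReal x) : ∃ k : M.N, ∀ y, RCAModel.IsReal y →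
    |rho y - rho x| ≤ ee k → |rho (fold y) - rho (fold x)| = |rho y - rho x| := by
  obtain ⟨z, hz, h⟩ := exists_isInt_abs_rho_le hx
  have hf := rho_fold hx hz h
  have h2 : (2 : KK M) * cst z = cst (2 * z) := by rw [map_mul, map_ofNat]
  have hmem : |rho x - 2 * cst z| ∈ reals M := by
    rw [h2]; exact abs_mem_reals (sub_mem (rho_mem x) (cst_mem_reals _))
  have h1 : (1 : KK M) ∈ reals M := by rw [← map_one cst]; exact cst_mem_reals 1
  rcases h.lt_or_eq with hlt | heq
  · rcases (abs_nonneg (rho x - 2 * cst z)).lt_or_eq with hpos | hzero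
    · obtain ⟨k, hk⟩ := exists_ee_lt hmem hpos
      obtain ⟨l, hl⟩ := exists_ee_lt (sub_mem h1 hmem) (sub_pos.2 hlt)
      have hk' : ee (max k l) ≤ ee k := ee_anti (le_max_left k l)
      have hl' : ee (max k l) ≤ ee l := ee_anti (le_max_right k l)
      refine ⟨max k l, fun y hy hxy => ?_⟩
      have h₁ : |rho y - 2 * cst z| ≤ 1 := by
        have := abs_sub_le (rho y) (rho x) (2 * cst z)
        linarith
      rw [rho_fold hy hz h₁, hf]
      rw [abs_le] at hxy
      rcases le_total 0 (rho x - 2 * cst z) with h₂ | h₂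
      · rw [abs_of_nonneg h₂] at hk hl ⊢
        rw [abs_of_nonneg (a := rho y - 2 * cst z) (by linarith), sub_sub_sub_cancel_right]
      · rw [abs_of_nonpos h₂] at hk hl ⊢
        rw [abs_of_nonpos (a := rho y - 2 * cst z) (by linarith), ← abs_neg]
        congr 1; ring
    · refine ⟨0, fun y hy hxy => ?_⟩
      have h₁ := sub_eq_zero.1 (abs_eq_zero.1 hzero.symm)
      rw [ee_zero] at hxy
      rw [rho_fold hy hz (by rwa [← h₁]), hf, ← hzero, sub_zero, abs_abs, h₁]
  · refine ⟨0, fun y hy hxy => ?_⟩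
    rw [ee_zero, abs_le] at hxy
    rw [hf, heq]
    have key : ∀ w : QQ M, IsInt w → |rho y - 2 * cst w| ≤ 1 →
        |rho y - 2 * cst w| = 1 - |rho y - rho x| →
        |rho (fold y) - 1| = |rho y - rho x| := fun w hw h₁ h₂ => by
      rw [rho_fold hy hw h₁, h₂, sub_sub_cancel_left, abs_neg, abs_abs]
    have hmap : cst (z + 1) = cst z + 1 := by rw [map_add, map_one]
    have hmap' : cst (z - 1) = cst z - 1 := by rw [map_sub, map_one]
    -- Here `x` is an odd integer. According to its position relative to `2 z` and the side on which
    -- `y` lies, the even integer nearest to `y` comes from `z`, `z + 1` or `z - 1`, at distance `1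
    -- - |y - x|`.
    rcases abs_choice (rho x - 2 * cst z) with h₁ | h₁ <;> rw [h₁] at heq <;>
      rcases le_total (rho y) (rho x) with h₂ | h₂
    · have h₃ : |rho y - 2 * cst z| = 1 - |rho y - rho x| := by
        rw [abs_of_nonneg (by linarith), abs_of_nonpos (by linarith)]; linarith
      exact key z hz (by rw [h₃]; linarith [abs_nonneg (rho y - rho x)]) h₃
    · have h₃ : |rho y - 2 * cst (z + 1)| = 1 - |rho y - rho x| := by
        rw [hmap, abs_of_nonpos (by linarith), abs_of_nonneg (by linarith)]; linarith
      exact key _ hz.add_one (by rw [h₃]; linarith [abs_nonneg (rho y - rho x)]) h₃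
    · have h₃ : |rho y - 2 * cst (z - 1)| = 1 - |rho y - rho x| := by
        rw [hmap', abs_of_nonneg (by linarith), abs_of_nonpos (by linarith)]; linarith
      exact key _ hz.sub_one (by rw [h₃]; linarith [abs_nonneg (rho y - rho x)]) h₃
    · have h₃ : |rho y - 2 * cst z| = 1 - |rho y - rho x| := by
        rw [abs_of_nonpos (by linarith), abs_of_nonneg (by linarith)]; linarith
      exact key z hz (by rw [h₃]; linarith [abs_nonneg (rho y - rho x)]) h₃

/-! ### The extension of a function on the unit square to the plane -/

/-- The composition of `f` with the folding in each variable. -/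
noncomputable def foldFun (f : M.carrier (ty1 ⇒ ty1 ⇒ ty1)) : M.carrier (ty1 ⇒ ty1 ⇒ ty1) :=
  lam fun x => lam fun y => f ⬝ fold x ⬝ fold y

theorem foldFun_app (f : M.carrier (ty1 ⇒ ty1 ⇒ ty1)) (x y : M.Seq) :
    foldFun f ⬝ x ⬝ y = f ⬝ fold x ⬝ fold y := by
  unfold foldFun
  rw [lam_app, lam_app]

omit [Fact M.Exists2] in
theorem isFun_mono {I J J' : Set M.Seq} {f : M.carrier (ty1 ⇒ ty1 ⇒ ty1)}
    (h : RCAModel.IsFun I J f) (hJ : J ⊆ J') : RCAModel.IsFun I J' f :=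
  ⟨fun x hx y hy => hJ (h.1 x hx y hy), h.2⟩

theorem isFun_foldFun {J : Set M.Seq} {f : M.carrier (ty1 ⇒ ty1 ⇒ ty1)}
    (h : RCAModel.IsFun M.unitInterval J f) : RCAModel.IsFun M.line J (foldFun f) := by
  refine ⟨fun x hx y hy => ?_, fun x hx y hy x' hx' y' hy' hxx' hyy' => ?_⟩
  · rw [foldFun_app]
    exact h.1 _ (fold_mem hx) _ (fold_mem hy)
  · rw [foldFun_app, foldFun_app]
    exact h.2 _ (fold_mem hx) _ (fold_mem hy) _ (fold_mem hx') _ (fold_mem hy')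
      (eqR_fold hx hx' hxx') (eqR_fold hy hy' hyy')

/-- The inverse image of a set under the folding. -/
def pull (T : Set (M.Seq × M.Seq)) : Set (M.Seq × M.Seq) :=
  {p | p ∈ M.line ×ˢ M.line ∧ (fold p.1, fold p.2) ∈ T}

/-- The set `T` of points of the unit square respects equality. -/
def Saturated (T : Set (M.Seq × M.Seq)) : Prop :=
  ∀ x ∈ M.unitInterval, ∀ y ∈ M.unitInterval, ∀ x' ∈ M.unitInterval, ∀ y' ∈ M.unitInterval,
    RCAModel.eqR x x' → RCAModel.eqR y y' → (x, y) ∈ T → (x', y') ∈ T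

omit [Fact M.Exists2] in
theorem eqR_symm {x y : M.Seq} (h : RCAModel.eqR x y) : RCAModel.eqR y x := ⟨h.2, h.1⟩

theorem pull_mono {S T : Set (M.Seq × M.Seq)} (h : S ⊆ T) : pull S ⊆ pull T :=
  fun _ hp => ⟨hp.1, h hp.2⟩

omit [Fact M.Exists2] in
theorem interior_mono {I : Set M.Seq} {S T : Set (M.Seq × M.Seq)} (h : S ⊆ T) :
    RCAModel.interior₂ I S ⊆ RCAModel.interior₂ I T :=
  fun _ ⟨hp, k, hk⟩ => ⟨hp, k, fun s hs hps => h (hk s hs hps)⟩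

theorem pull_interior (T : Set (M.Seq × M.Seq)) :
    pull (RCAModel.interior₂ M.unitInterval T) ⊆ RCAModel.interior₂ M.line (pull T) := by
  rintro p ⟨hp, -, k, hk⟩
  exact ⟨hp, k, fun s hs hps => ⟨hs, hk _ ⟨fold_mem hs.1, fold_mem hs.2⟩
    ⟨close_fold hp.1 hs.1 hps.1, close_fold hp.2 hs.2 hps.2⟩⟩⟩

/-- Approximating points are lifted by `exists_fold_eq`. A lift folds back to an equal real, not to
the same sequence, which is why `T` has to be saturated. -/
theorem pull_closure {T : Set (M.Seq × M.Seq)} (hT : Saturated T) :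
    pull (RCAModel.closure₂ M.unitInterval T) ⊆ RCAModel.closure₂ M.line (pull T) := by
  rintro p ⟨hp, -, h⟩
  refine ⟨hp, fun k => ?_⟩
  obtain ⟨s, hs, hsT, hps⟩ := h k
  obtain ⟨x, hx, hpx, hxs⟩ := exists_fold_eq hp.1 hs.1 hps.1
  obtain ⟨y, hy, hpy, hys⟩ := exists_fold_eq hp.2 hs.2 hps.2
  exact ⟨(x, y), ⟨hx, hy⟩, ⟨⟨hx, hy⟩, hT _ hs.1 _ hs.2 _ (fold_mem hx) _ (fold_mem hy)
    (eqR_symm hxs) (eqR_symm hys) hsT⟩, hpx, hpy⟩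

theorem pull_preOpen {T : Set (M.Seq × M.Seq)} (hT : Saturated T)
    (h : T ⊆ RCAModel.interior₂ M.unitInterval (RCAModel.closure₂ M.unitInterval T)) :
    pull T ⊆ RCAModel.interior₂ M.line (RCAModel.closure₂ M.line (pull T)) :=
  (pull_mono h).trans ((pull_interior _).trans (interior_mono (pull_closure hT)))

section

variable {f : M.carrier (ty1 ⇒ ty1 ⇒ ty1)}

theorem preimage_foldFun (G : M.carrier (ty1 ⇒ ty0)) :
    RCAModel.preimage M.line (foldFun f) G = pull (RCAModel.preimage M.unitInterval f G) := by
  ext p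
  constructor
  · rintro ⟨hp, h⟩
    rw [foldFun_app] at h
    exact ⟨hp, ⟨fold_mem hp.1, fold_mem hp.2⟩, h⟩
  · rintro ⟨hp, -, h⟩
    refine ⟨hp, ?_⟩
    rw [foldFun_app]
    exact h

variable (hf : RCAModel.IsFun M.unitInterval M.line f)

include hf

omit [Fact M.Exists2] in
theorem saturated_preimage {G : M.carrier (ty1 ⇒ ty0)} (hG : RCAModel.IsOpen₁ M.line G) :
    Saturated (RCAModel.preimage M.unitInterval f G) := by
  rintro x hx y hy x' hx' y' hy' hxx' hyy' ⟨-, h⟩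
  refine ⟨⟨hx', hy'⟩, ?_⟩
  rw [← h]
  exact (hG.2.1 _ (hf.1 x hx y hy) _ (hf.1 x' hx' y' hy')
    (hf.2 x hx y hy x' hx' y' hy' hxx' hyy')).symm

theorem graphContinuous_foldFun (h : RCAModel.GraphContinuous M.unitInterval f) :
    RCAModel.GraphContinuous M.line (foldFun f) := by
  obtain ⟨g, hg, hgc, h⟩ := h
  refine ⟨foldFun g, isFun_foldFun hg, fun p hp k => ?_, fun p hp k => ?_⟩
  · obtain ⟨m, hm⟩ := hgc (fold p.1, fold p.2) ⟨fold_mem hp.1, fold_mem hp.2⟩ k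
    refine ⟨m, fun s hs hps => ?_⟩
    rw [foldFun_app, foldFun_app]
    exact hm (fold s.1, fold s.2) ⟨fold_mem hs.1, fold_mem hs.2⟩
      ⟨close_fold hp.1 hs.1 hps.1, close_fold hp.2 hs.2 hps.2⟩
  · obtain ⟨s, hs, hps, hgf⟩ := h (fold p.1, fold p.2) ⟨fold_mem hp.1, fold_mem hp.2⟩ k
    obtain ⟨x, hx, hpx, hxs⟩ := exists_fold_eq hp.1 hs.1 hps.1
    obtain ⟨y, hy, hpy, hys⟩ := exists_fold_eq hp.2 hs.2 hps.2
    refine ⟨(x, y), ⟨hx, hy⟩, ⟨hpx, hpy⟩, ?_⟩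
    rw [foldFun_app, foldFun_app]
    have h₁ := hg.1 _ (fold_mem hp.1) _ (fold_mem hp.2)
    have h₂ := hf.1 _ hs.1 _ hs.2
    have h₃ := hf.1 _ (fold_mem hx) _ (fold_mem hy)
    have h₄ := hf.2 _ (fold_mem hx) _ (fold_mem hy) _ hs.1 _ hs.2 hxs hys
    rw [eqR_iff_rho h₃ h₂] at h₄
    rw [close_iff_rho h₁ h₂] at hgf
    rw [close_iff_rho h₁ h₃, h₄]
    exact hgf

theorem preContinuous_foldFun {G : M.carrier (ty1 ⇒ ty0)} (hG : RCAModel.IsOpen₁ M.line G)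
    (h : RCAModel.preimage M.unitInterval f G ⊆ RCAModel.interior₂ M.unitInterval
      (RCAModel.closure₂ M.unitInterval (RCAModel.preimage M.unitInterval f G))) :
    RCAModel.preimage M.line (foldFun f) G ⊆ RCAModel.interior₂ M.line
      (RCAModel.closure₂ M.line (RCAModel.preimage M.line (foldFun f) G)) := by
  rw [preimage_foldFun]
  exact pull_preOpen (saturated_preimage hf hG) h

end

/-! ### Sets under folding: `𝒞`-continuity and the Cesàro property -/

/-- The inverse image under folding of the set with characteristic function `A`. -/
noncomputable def foldSet (A : M.carrier (ty1 ⇒ ty1 ⇒ ty0)) : M.carrier (ty1 ⇒ ty1 ⇒ ty0) :=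
  lam fun x => lam fun y => A ⬝ fold x ⬝ fold y

theorem foldSet_app (A : M.carrier (ty1 ⇒ ty1 ⇒ ty0)) (x y : M.Seq) :
    foldSet A ⬝ x ⬝ y = A ⬝ fold x ⬝ fold y := by
  unfold foldSet
  rw [lam_app, lam_app]

theorem isSet_foldSet {A : M.carrier (ty1 ⇒ ty1 ⇒ ty0)} (h : RCAModel.IsSet₂ M.unitInterval A) :
    RCAModel.IsSet₂ M.line (foldSet A) := by
  refine ⟨fun x hx y hy => ?_, fun x hx y hy x' hx' y' hy' hxx' hyy' => ?_⟩
  · rw [foldSet_app]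
    exact h.1 _ (fold_mem hx) _ (fold_mem hy)
  · rw [foldSet_app, foldSet_app]
    exact h.2 _ (fold_mem hx) _ (fold_mem hy) _ (fold_mem hx') _ (fold_mem hy')
      (eqR_fold hx hx' hxx') (eqR_fold hy hy' hyy')

theorem points_foldSet (A : M.carrier (ty1 ⇒ ty1 ⇒ ty0)) :
    RCAModel.points₂ M.line (foldSet A) = pull (RCAModel.points₂ M.unitInterval A) := by
  ext p
  constructor
  · rintro ⟨hp, h⟩
    rw [foldSet_app] at h
    exact ⟨hp, ⟨fold_mem hp.1, fold_mem hp.2⟩, h⟩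
  · rintro ⟨hp, -, h⟩
    refine ⟨hp, ?_⟩
    rw [foldSet_app]
    exact h

omit [Fact M.Exists2] in
theorem saturated_points {A : M.carrier (ty1 ⇒ ty1 ⇒ ty0)}
    (hA : RCAModel.IsSet₂ M.unitInterval A) : Saturated (RCAModel.points₂ M.unitInterval A) := by
  rintro x hx y hy x' hx' y' hy' hxx' hyy' ⟨-, h⟩
  refine ⟨⟨hx', hy'⟩, ?_⟩
  rw [← h]
  exact (hA.2 x hx y hy x' hx' y' hy' hxx' hyy').symm

theorem cContinuous_foldFun {f : M.carrier (ty1 ⇒ ty1 ⇒ ty1)}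
    (h : RCAModel.CContinuous M.unitInterval f) : RCAModel.CContinuous M.line (foldFun f) := by
  intro G hG
  obtain ⟨O, A, hO, hA, hA', hOA⟩ := h G hG
  refine ⟨foldSet O, foldSet A, ⟨isSet_foldSet hO.1, ?_⟩, isSet_foldSet hA, ?_, ?_⟩
  · rw [points_foldSet]
    exact (pull_mono hO.2).trans (pull_interior _)
  · rw [points_foldSet]
    exact pull_preOpen (saturated_points hA) hA'
  · rw [points_foldSet, points_foldSet, preimage_foldFun, hOA]
    ext p
    exact ⟨fun ⟨h, h₁, h₂⟩ => ⟨⟨h, h₁⟩, h, h₂⟩, fun ⟨⟨h, h₁⟩, _, h₂⟩ => ⟨h, h₁, h₂⟩⟩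

theorem close_branch {z s : QQ M} (hs : |s| = 1) {x y : M.Seq} (hx : RCAModel.IsReal x)
    (hy : RCAModel.IsReal y) {k : M.N} (h : RCAModel.close k x y) :
    RCAModel.close k (branch z s x) (branch z s y) := by
  rw [close_iff_rho hx hy] at h
  rw [close_iff_rho (isReal_branch hs hx) (isReal_branch hs hy), rho_branch hs hx,
    rho_branch hs hy, add_sub_add_left_eq_sub, ← mul_sub, abs_mul, ← cst_abs, hs, map_one, one_mul]
  exact h

theorem eqR_branch {z s : QQ M} (hs : |s| = 1) {x y : M.Seq} (hx : RCAModel.IsReal x)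
    (hy : RCAModel.IsReal y) (h : RCAModel.eqR x y) :
    RCAModel.eqR (branch z s x) (branch z s y) := by
  rw [eqR_iff_rho hx hy] at h
  rw [eqR_iff_rho (isReal_branch hs hx) (isReal_branch hs hy), rho_branch hs hx,
    rho_branch hs hy, h]

/-- The open set is pulled back along the branches through a point of `U`, and the points
approximating a fiber are folded into the square; folding undoes the branches. -/
theorem cesaroType_of_foldFun {f : M.carrier (ty1 ⇒ ty1 ⇒ ty1)}
    (h : RCAModel.CesaroType M.line (foldFun f)) : RCAModel.CesaroType M.unitInterval f := by
  obtain ⟨U, V, hU, ⟨p, hp, hpU⟩, hV, hne, h⟩ := h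
  obtain ⟨z, s, hzs⟩ := exists_branch hp.1
  obtain ⟨z', s', hzs'⟩ := exists_branch hp.2
  have happ : ∀ x y, (lam fun x => lam fun y => U ⬝ branch z s x ⬝ branch z' s' y :
      M.carrier (ty1 ⇒ ty1 ⇒ ty0)) ⬝ x ⬝ y = U ⬝ branch z s x ⬝ branch z' s' y := fun x y => by
    rw [lam_app, lam_app]
  have hbr : ∀ x ∈ M.unitInterval, branch z s x ∈ M.line :=
    fun x hx => isReal_branch hzs.2.1 hx.1
  have hbr' : ∀ x ∈ M.unitInterval, branch z' s' x ∈ M.line :=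
    fun x hx => isReal_branch hzs'.2.1 hx.1
  refine ⟨lam fun x => lam fun y => U ⬝ branch z s x ⬝ branch z' s' y, V,
    ⟨⟨fun x hx y hy => ?_, fun x hx y hy x₁ hx₁ y₁ hy₁ hxx hyy => ?_⟩, ?_⟩, ?_, hV, hne, ?_⟩
  · rw [happ]
    exact hU.1.1 _ (hbr x hx) _ (hbr' y hy)
  · rw [happ, happ]
    exact hU.1.2 _ (hbr x hx) _ (hbr' y hy) _ (hbr x₁ hx₁) _ (hbr' y₁ hy₁)
      (eqR_branch hzs.2.1 hx.1 hx₁.1 hxx) (eqR_branch hzs'.2.1 hy.1 hy₁.1 hyy)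
  · rintro q ⟨hq, hqU⟩
    rw [happ] at hqU
    obtain ⟨-, k, hk⟩ := hU.2 (show (branch z s q.1, branch z' s' q.2) ∈ RCAModel.points₂ M.line U
      from ⟨⟨hbr _ hq.1, hbr' _ hq.2⟩, hqU⟩)
    refine ⟨hq, k, fun t ht hqt => ⟨ht, ?_⟩⟩
    rw [happ]
    exact (hk (branch z s t.1, branch z' s' t.2) ⟨hbr _ ht.1, hbr' _ ht.2⟩
      ⟨close_branch hzs.2.1 hq.1.1 ht.1.1 hqt.1, close_branch hzs'.2.1 hq.2.1 ht.2.1 hqt.2⟩).2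
  · have h₁ := fold_mem hp.1
    have h₂ := fold_mem hp.2
    refine ⟨(fold p.1, fold p.2), ⟨h₁, h₂⟩, ?_⟩
    rw [happ, ← hpU]
    refine hU.1.2 _ (hbr _ h₁) _ (hbr' _ h₂) _ hp.1 _ hp.2 ?_ ?_
    · rw [eqR_iff_rho (hbr _ h₁) hp.1, rho_branch hzs.2.1 h₁.1, ← hzs.2.2]
    · rw [eqR_iff_rho (hbr' _ h₂) hp.2, rho_branch hzs'.2.1 h₂.1, ← hzs'.2.2]
  · rintro v hv hvV q ⟨hq, hqU⟩
    rw [happ] at hqU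
    refine ⟨hq, fun k => ?_⟩
    have hb₁ := hbr _ hq.1
    have hb₂ := hbr' _ hq.2
    obtain ⟨t, ht, htv, hqt⟩ := (h v hv hvV
      (show (branch z s q.1, branch z' s' q.2) ∈ RCAModel.points₂ M.line U
        from ⟨⟨hb₁, hb₂⟩, hqU⟩)).2 k
    have ht₁ := fold_mem ht.1
    have ht₂ := fold_mem ht.2
    refine ⟨(fold t.1, fold t.2), ⟨ht₁, ht₂⟩, ⟨⟨ht₁, ht₂⟩, ?_⟩, ?_, ?_⟩
    · have := htv.2
      rwa [foldFun_app] at this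
    · have := close_fold hb₁ ht.1 hqt.1
      rw [close_iff_rho (isReal_fold hb₁) ht₁.1, rho_fold_branch hzs.1 hzs.2.1 hq.1] at this
      rwa [close_iff_rho hq.1.1 ht₁.1]
    · have := close_fold hb₂ ht.2 hqt.2
      rw [close_iff_rho (isReal_fold hb₂) ht₂.1, rho_fold_branch hzs'.1 hzs'.2.1 hq.2] at this
      rwa [close_iff_rho hq.2.1 ht₂.1]

/-! ### Functions of one variable -/

section

variable {h : M.carrier (ty1 ⇒ ty1)} (hr : ∀ y ∈ M.unitInterval, RCAModel.IsReal (h ⬝ y))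
  (he : ∀ y ∈ M.unitInterval, ∀ y' ∈ M.unitInterval, RCAModel.eqR y y' →
    RCAModel.eqR (h ⬝ y) (h ⬝ y'))

theorem lam_fold_app (x : M.Seq) :
    (lam fun y => h ⬝ fold y : M.carrier (ty1 ⇒ ty1)) ⬝ x = h ⬝ fold x := lam_app _ _

include hr he

theorem convergesTo_branch {x : M.Seq} (hx : RCAModel.IsReal x) {z s : QQ M} (hzs : IsBranch x z s)
    {a : M.carrier (ty0 ⇒ ty1)} (ha : ∀ n, a ⬝ n ∈ M.unitInterval)
    (h₁ : RCAModel.ConvergesTo a (fold x))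
    (h₂ : RCAModel.ConvergesTo (M.S ⬝ (M.K ⬝ h) ⬝ a) (h ⬝ fold x)) :
    RCAModel.ConvergesTo (lam fun n => branch z s (a ⬝ n)) x ∧
      RCAModel.ConvergesTo (M.S ⬝ (M.K ⬝ lam fun y => h ⬝ fold y) ⬝ lam fun n =>
        branch z s (a ⬝ n)) ((lam fun y => h ⬝ fold y : M.carrier (ty1 ⇒ ty1)) ⬝ x) := by
  refine ⟨fun k => ?_, fun k => ?_⟩
  · obtain ⟨m, hm⟩ := h₁ k
    refine ⟨m, fun n hn => ?_⟩
    have := hm n hn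
    rw [close_iff_rho (ha n).1 (isReal_fold hx)] at this
    rw [lam_app, close_iff_rho (isReal_branch hzs.2.1 (ha n).1) hx, hzs.dist (ha n).1]
    exact this
  · obtain ⟨m, hm⟩ := h₂ k
    refine ⟨m, fun n hn => ?_⟩
    have := hm n hn
    have hbr := isReal_branch (z := z) hzs.2.1 (ha n).1
    have heq := he _ (fold_mem hbr) _ (ha n) (by
      rw [eqR_iff_rho (isReal_fold hbr) (ha n).1, rho_fold_branch hzs.1 hzs.2.1 (ha n)])
    rw [eqR_iff_rho (hr _ (fold_mem hbr)) (hr _ (ha n))] at heq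
    rw [M.S_app, M.K_app, close_iff_rho (hr _ (ha n)) (hr _ (fold_mem hx))] at this
    rw [M.S_app, M.K_app, lam_fold_app, lam_fold_app, lam_app,
      close_iff_rho (hr _ (fold_mem hbr)) (hr _ (fold_mem hx)), heq]
    exact this

/-- A sequence for `fold x` is transported along a branch that continues on the required side of
`x`. A decreasing branch exchanges left and right, so the opposite half of the condition at `fold x`
is used. -/
theorem young_fold (hY : RCAModel.Young₁ M.unitInterval h) :
    RCAModel.Young₁ M.line (lam fun y => h ⬝ fold y) := by
  intro x hx
  have hfx := fold_mem hx
  have hpos : 0 < rho (fold x) → ∃ z ∈ M.unitInterval, RCAModel.ltR z (fold x) := fun h₀ =>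
    ⟨qreal 0, qreal_zero_mem, by
      rwa [ltR_iff_rho (isReal_qreal _) hfx.1, rho_qreal, map_zero]⟩
  have hlt : rho (fold x) < 1 → ∃ z ∈ M.unitInterval, RCAModel.ltR (fold x) z := fun h₀ =>
    ⟨qreal 1, qreal_one_mem, by
      rwa [ltR_iff_rho hfx.1 (isReal_qreal _), rho_qreal, map_one]⟩
  constructor
  · rintro -
    rcases exists_branch_left hx with ⟨z, hz, h₀⟩ | ⟨z, hz, h₀⟩
    · obtain ⟨a, ha, h₁, h₂⟩ := (hY _ hfx).1 (hpos h₀)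
      refine ⟨lam fun n => branch z 1 (a ⬝ n), fun n => ?_,
        convergesTo_branch hr he hx hz (fun n => (ha n).1) h₁ h₂⟩
      have hbr := isReal_branch (z := z) hz.2.1 (ha n).1.1
      have := (ha n).2
      rw [ltR_iff_rho (ha n).1.1 hfx.1] at this
      rw [lam_app, ltR_iff_rho hbr hx, rho_branch hz.2.1 (ha n).1.1, hz.2.2, map_one]
      exact ⟨hbr, by linarith⟩
    · obtain ⟨a, ha, h₁, h₂⟩ := (hY _ hfx).2 (hlt h₀)
      refine ⟨lam fun n => branch z (-1) (a ⬝ n), fun n => ?_,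
        convergesTo_branch hr he hx hz (fun n => (ha n).1) h₁ h₂⟩
      have hbr := isReal_branch (z := z) hz.2.1 (ha n).1.1
      have := (ha n).2
      rw [ltR_iff_rho hfx.1 (ha n).1.1] at this
      rw [lam_app, ltR_iff_rho hbr hx, rho_branch hz.2.1 (ha n).1.1, hz.2.2, map_neg, map_one]
      exact ⟨hbr, by linarith⟩
  · rintro -
    rcases exists_branch_right hx with ⟨z, hz, h₀⟩ | ⟨z, hz, h₀⟩
    · obtain ⟨a, ha, h₁, h₂⟩ := (hY _ hfx).2 (hlt h₀)
      refine ⟨lam fun n => branch z 1 (a ⬝ n), fun n => ?_,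
        convergesTo_branch hr he hx hz (fun n => (ha n).1) h₁ h₂⟩
      have hbr := isReal_branch (z := z) hz.2.1 (ha n).1.1
      have := (ha n).2
      rw [ltR_iff_rho hfx.1 (ha n).1.1] at this
      rw [lam_app, ltR_iff_rho hx hbr, rho_branch hz.2.1 (ha n).1.1, hz.2.2, map_one]
      exact ⟨hbr, by linarith⟩
    · obtain ⟨a, ha, h₁, h₂⟩ := (hY _ hfx).1 (hpos h₀)
      refine ⟨lam fun n => branch z (-1) (a ⬝ n), fun n => ?_,
        convergesTo_branch hr he hx hz (fun n => (ha n).1) h₁ h₂⟩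
      have hbr := isReal_branch (z := z) hz.2.1 (ha n).1.1
      have := (ha n).2
      rw [ltR_iff_rho (ha n).1.1 hfx.1] at this
      rw [lam_app, ltR_iff_rho hx hbr, rho_branch hz.2.1 (ha n).1.1, hz.2.2, map_neg, map_one]
      exact ⟨hbr, by linarith⟩

end

/-! ### Peripheral continuity under folding -/

/-- The intersection of the interval with end-points `a`, `b` and the inverse image of `W` under
folding. -/
noncomputable def foldWindow (a b : M.Seq) (W : M.carrier (ty1 ⇒ ty0)) : M.carrier (ty1 ⇒ ty0) :=
  lam fun z => sel (ioo a b ⬝ z = M.one ∧ W ⬝ fold z = M.one) M.one M.zero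

theorem foldWindow_eq_one {a b z : M.Seq} {W : M.carrier (ty1 ⇒ ty0)} :
    foldWindow a b W ⬝ z = M.one ↔ ioo a b ⬝ z = M.one ∧ W ⬝ fold z = M.one := by
  unfold foldWindow
  rw [lam_app]
  by_cases h : ioo a b ⬝ z = M.one ∧ W ⬝ fold z = M.one
  · exact iff_of_true (sel_of h _ _) h
  · exact iff_of_false (by rw [sel_of_not h]; exact one_ne_zero'.symm) h

theorem foldWindow_zero_or_one (a b z : M.Seq) (W : M.carrier (ty1 ⇒ ty0)) :
    foldWindow a b W ⬝ z = M.zero ∨ foldWindow a b W ⬝ z = M.one := by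
  unfold foldWindow
  rw [lam_app]
  by_cases h : ioo a b ⬝ z = M.one ∧ W ⬝ fold z = M.one
  · exact Or.inr (sel_of h _ _)
  · exact Or.inl (sel_of_not h _ _)

theorem close_mono {x y : M.Seq} (hx : RCAModel.IsReal x) (hy : RCAModel.IsReal y) {k l : M.N}
    (hkl : k ≤ l) (h : RCAModel.close l x y) : RCAModel.close k x y := by
  rw [close_iff_rho hx hy] at h ⊢
  exact h.trans (ee_anti hkl)

theorem isOpen_foldWindow {a b : M.Seq} (ha : RCAModel.IsReal a) (hb : RCAModel.IsReal b)
    {W : M.carrier (ty1 ⇒ ty0)} (hW : RCAModel.IsOpen₁ M.unitInterval W) :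
    RCAModel.IsOpen₁ M.line (foldWindow a b W) := by
  have hab := isOpen_ioo (Or.inl rfl) ha hb
  refine ⟨fun x _ => foldWindow_zero_or_one a b x W, fun x hx y hy h => ?_, fun x hx h => ?_⟩
  · refine eq_of_eqR_of_iff (foldWindow_zero_or_one a b x W) (foldWindow_zero_or_one a b y W) ?_
    rw [foldWindow_eq_one, foldWindow_eq_one, hab.2.1 x hx y hy h,
      hW.2.1 _ (fold_mem hx) _ (fold_mem hy) (eqR_fold hx hy h)]
  · rw [foldWindow_eq_one] at h
    obtain ⟨k, hk⟩ := hab.2.2 x hx h.1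
    obtain ⟨l, hl⟩ := hW.2.2 _ (fold_mem hx) h.2
    refine ⟨max k l, fun z hz hxz => foldWindow_eq_one.2
      ⟨hk z hz (close_mono hx hz (le_max_left k l) hxz), hl _ (fold_mem hz) ?_⟩⟩
    exact close_fold hx hz (close_mono hx hz (le_max_right k l) hxz)

/-- The inverse image of a window `W` for `fold x` has copies far from `x`, so it is cut off at
distance `2 ^ (-m)`. If `W` lies within the same distance of `fold x`, then `exists_radial` shows
that the cut creates no boundary points apart from those that fold into the boundary of `W`. -/
theorem peripheral_fold {h : M.carrier (ty1 ⇒ ty1)}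
    (hP : RCAModel.Peripheral₁ M.unitInterval h) :
    RCAModel.Peripheral₁ M.line (lam fun y => h ⬝ fold y) := by
  intro x hx a ha b hb c hc d hd hax hxb hcx hxd
  simp only [lam_fold_app] at hcx hxd ⊢
  have hfx := fold_mem hx
  rw [ltR_iff_rho ha hx] at hax
  rw [ltR_iff_rho hx hb] at hxb
  obtain ⟨k, hk⟩ := exists_ee_lt₂ hax hxb
  obtain ⟨l, hl⟩ := exists_radial hx
  have hm₁ : ee (max k l) ≤ ee k := ee_anti (le_max_left k l)
  have hm₂ : ee (max k l) ≤ ee l := ee_anti (le_max_right k l)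
  have hpos := ee_pos (max k l)
  generalize max k l = m at hm₁ hm₂ hpos
  obtain ⟨a', har, ha'⟩ := exists_shift hx (- ex m)
  obtain ⟨b', hbr, hb'⟩ := exists_shift hx (ex m)
  obtain ⟨a'', har', ha''⟩ := exists_shift hfx.1 (- ex m)
  obtain ⟨b'', hbr', hb''⟩ := exists_shift hfx.1 (ex m)
  rw [map_neg] at ha' ha''
  change _ = _ + - ee m at ha' ha''
  change _ = _ + ee m at hb' hb''
  obtain ⟨W, hW, hxW, hWab, hbd⟩ := hP _ hfx a'' har' b'' hbr' c hc d hd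
    (by rw [ltR_iff_rho har' hfx.1]; linarith) (by rw [ltR_iff_rho hfx.1 hbr']; linarith) hcx hxd
  have hopen := isOpen_foldWindow har hbr hW
  refine ⟨foldWindow a' b' W, hopen, foldWindow_eq_one.2 ⟨?_, hxW⟩, fun z hz hzW => ?_,
    fun z hz => ?_⟩
  · rw [ioo_eq_one har hbr hx]
    constructor <;> linarith
  · rw [foldWindow_eq_one, ioo_eq_one har hbr hz] at hzW
    rw [ltR_iff_rho ha hz, ltR_iff_rho hz hb]
    constructor <;> linarith [hzW.1.1, hzW.1.2]
  · obtain ⟨hzr, h₁, h₂⟩ := hz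
    refine hbd _ ⟨fold_mem hzr, fun k => ?_, fun k => ⟨fold z, fold_mem hzr,
      close_refl (isReal_fold hzr) k, fun hzW => ?_⟩⟩
    · obtain ⟨w, hw, hzw, hwW⟩ := h₁ k
      exact ⟨fold w, fold_mem hw, close_fold hzr hw hzw, (foldWindow_eq_one.1 hwW).2⟩
    -- As a limit of points of the window, `z` is within the cut-off distance of `x`. If `fold z`
    -- were in `W`, the radial identity would make this strict, so `z` would be interior to the
    -- window.
    · have hnear : |rho z - rho x| ≤ ee m := by
        by_contra! hfar
        obtain ⟨j, hj⟩ := exists_ee_lt (sub_mem (abs_mem_reals (sub_mem (rho_mem z) (rho_mem x)))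
          (cst_mem_reals (ex m))) (sub_pos.2 hfar)
        obtain ⟨w, hw, hzw, hwW⟩ := h₁ j
        rw [foldWindow_eq_one, ioo_eq_one har hbr hw] at hwW
        rw [close_iff_rho hzr hw] at hzw
        have h₃ : |rho w - rho x| ≤ ee m := by
          rw [abs_le]; constructor <;> linarith [hwW.1.1, hwW.1.2]
        have h₄ := abs_sub_le (rho z) (rho w) (rho x)
        change _ < _ - ee m at hj
        linarith
      have hrad := hl z hzr (hnear.trans hm₂)
      have h₃ := hWab _ (fold_mem hzr) hzW
      rw [ltR_iff_rho har' (isReal_fold hzr), ltR_iff_rho (isReal_fold hzr) hbr'] at h₃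
      have h₄ : |rho z - rho x| < ee m := by
        rw [← hrad, abs_lt]; constructor <;> linarith [h₃.1, h₃.2]
      rw [abs_lt] at h₄
      have h₅ : foldWindow a' b' W ⬝ z = M.one := by
        rw [foldWindow_eq_one, ioo_eq_one har hbr hzr]
        exact ⟨⟨by linarith, by linarith⟩, hzW⟩
      obtain ⟨j, hj⟩ := hopen.2.2 z hzr h₅
      obtain ⟨w, hw, hzw, hwW⟩ := h₂ j
      exact hwW (hj w hw hzw)

/-! ### The supremum principle on the unit interval -/

theorem foldFun_section (f : M.carrier (ty1 ⇒ ty1 ⇒ ty1)) (x : M.Seq) :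
    foldFun f ⬝ x = lam fun y => f ⬝ fold x ⬝ fold y := by
  unfold foldFun
  rw [lam_app]

theorem foldFun_sectionLeft (f : M.carrier (ty1 ⇒ ty1 ⇒ ty1)) (y : M.Seq) :
    RCAModel.sectionLeft (foldFun f) y =
      lam fun x => RCAModel.sectionLeft f (fold y) ⬝ fold x := by
  apply M.ext
  intro x
  rw [RCAModel.sectionLeft_app, foldFun_app, lam_app, RCAModel.sectionLeft_app]

theorem eqR_refl {x : M.Seq} (hx : RCAModel.IsReal x) : RCAModel.eqR x x :=
  (eqR_iff_rho hx hx).2 rfl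

theorem holds_foldFun (Γ : WeakContinuity) {f : M.carrier (ty1 ⇒ ty1 ⇒ ty1)}
    (hf : RCAModel.IsFun M.unitInterval M.line f) (h : Γ.Holds M.unitInterval f) :
    Γ.Holds M.line (foldFun f) := by
  cases Γ with
  | graph => exact graphContinuous_foldFun hf h
  | young =>
    refine ⟨fun x hx => ?_, fun y hy => ?_⟩
    · rw [foldFun_section]
      have hx' := fold_mem hx
      exact young_fold (fun y hy => hf.1 _ hx' y hy) (fun y hy y' hy' hyy' =>
        hf.2 _ hx' y hy _ hx' y' hy' (eqR_refl hx'.1) hyy') (h.1 _ hx')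
    · rw [foldFun_sectionLeft]
      have hy' := fold_mem hy
      refine young_fold (fun x hx => ?_) (fun x hx x' hx' hxx' => ?_) (h.2 _ hy')
      · rw [RCAModel.sectionLeft_app]
        exact hf.1 x hx _ hy'
      · rw [RCAModel.sectionLeft_app, RCAModel.sectionLeft_app]
        exact hf.2 x hx _ hy' x' hx' _ hy' hxx' (eqR_refl hy'.1)
  | husain =>
    intro p hp G hG hpG
    exact preContinuous_foldFun hf hG (fun q hq => h q hq.1 G hG hq.2) ⟨hp, hpG⟩
  | notCesaro => exact fun h' => h (cesaroType_of_foldFun h')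
  | peripheral =>
    refine ⟨fun x hx => ?_, fun y hy => ?_⟩
    · rw [foldFun_section]
      exact peripheral_fold (h.1 _ (fold_mem hx))
    · rw [foldFun_sectionLeft]
      exact peripheral_fold (h.2 _ (fold_mem hy))
  | pre => exact fun G hG => preContinuous_foldFun hf hG (h G hG)
  | curlyC => exact cContinuous_foldFun h

/-- A real between `p` and `q` lies in `[0,1]`, where folding is the identity up to equality of
reals, so both suprema are taken over the same values. -/
theorem isSup_of_foldFun {f : M.carrier (ty1 ⇒ ty1 ⇒ ty1)}
    (hf : RCAModel.IsFun M.unitInterval M.line f) {x : M.Seq} (hx : x ∈ M.unitInterval)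
    {p q : M.N} (hpI : RCAModel.ratReal p ∈ M.unitInterval)
    (hqI : RCAModel.ratReal q ∈ M.unitInterval)
    {t : M.N} {v : M.Seq} (h : RCAModel.IsSup M.line (foldFun f) x p q t v) :
    RCAModel.IsSup M.unitInterval f x p q t v := by
  have hmem : ∀ y, RCAModel.IsReal y → RCAModel.leR (RCAModel.ratReal p) y →
      RCAModel.leR y (RCAModel.ratReal q) → y ∈ M.unitInterval := fun y hy h₁ h₂ => by
    rw [leR_iff_rho hpI.1 hy] at h₁
    rw [leR_iff_rho hy hqI.1] at h₂
    exact mem_unitInterval.2 ⟨hy, (mem_unitInterval.1 hpI).2.1.trans h₁,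
      h₂.trans (mem_unitInterval.1 hqI).2.2⟩
  have hreal : ∀ y ∈ M.unitInterval, RCAModel.IsReal (f ⬝ x ⬝ y) := hf.1 x hx
  have hreal' : ∀ y ∈ M.unitInterval, RCAModel.IsReal (foldFun f ⬝ x ⬝ y) :=
    fun y hy => (isFun_foldFun hf).1 x hx.1 y hy.1
  have heq : ∀ y ∈ M.unitInterval, rho (foldFun f ⬝ x ⬝ y) = rho (f ⬝ x ⬝ y) := fun y hy => by
    rw [← eqR_iff_rho (hreal' y hy) (hreal y hy), foldFun_app]
    refine hf.2 _ (fold_mem hx.1) _ (fold_mem hy.1) _ hx _ hy ?_ ?_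
    · rw [eqR_iff_rho (isReal_fold hx.1) hx.1, rho_fold_of_mem hx]
    · rw [eqR_iff_rho (isReal_fold hy.1) hy.1, rho_fold_of_mem hy]
  have hle : ∀ y ∈ M.unitInterval, ∀ w, RCAModel.IsReal w →
      (RCAModel.leR (foldFun f ⬝ x ⬝ y) w ↔ RCAModel.leR (f ⬝ x ⬝ y) w) := fun y hy w hw => by
    rw [leR_iff_rho (hreal' y hy) hw, leR_iff_rho (hreal y hy) hw, heq y hy]
  rcases h with ⟨ht, hv, hub, hlub⟩ | ⟨ht, h⟩ | ⟨ht, h⟩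
  · refine Or.inl ⟨ht, hv, fun y hy h₁ h₂ => ?_, fun w hw hwub => ?_⟩
    · rw [← hle y hy v hv]
      exact hub y hy.1 h₁ h₂
    · refine hlub w hw fun y hy h₁ h₂ => ?_
      have hy' := hmem y hy h₁ h₂
      rw [hle y hy' w hw]
      exact hwub y hy' h₁ h₂
  · refine Or.inr (Or.inl ⟨ht, fun w hw => ?_⟩)
    obtain ⟨y, hy, h₁, h₂, h₃⟩ := h w hw
    have hy' := hmem y hy h₁ h₂
    refine ⟨y, hy', h₁, h₂, ?_⟩
    rw [ltR_iff_rho hw (hreal' y hy'), heq y hy'] at h₃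
    rwa [ltR_iff_rho hw (hreal y hy')]
  · exact Or.inr (Or.inr ⟨ht, fun ⟨y, hy, h₁, h₂⟩ => h ⟨y, hy.1, h₁, h₂⟩⟩)

theorem supPrinciple_unitInterval (Γ : WeakContinuity)
    (h : M.SupPrinciple M.line M.line fun f => Γ.Holds M.line f) :
    M.SupPrinciple M.unitInterval M.unitInterval fun f => Γ.Holds M.unitInterval f := by
  intro f hf hΓ
  have hf' := isFun_mono hf (J' := M.line) fun x hx => hx.1
  obtain ⟨T, V, hTV⟩ := h (foldFun f) (isFun_foldFun hf') (holds_foldFun Γ hf' hΓ)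
  exact ⟨T, V, fun x hx p q hp hq hpI hqI =>
    isSup_of_foldFun hf' hx hpI hqI (hTV x hx.1 p q hp hq hpI.1 hqI.1)⟩

end

end Henkin

theorem theorem2p15 (M : RCAModel.{u}) (hM : M.Exists2) (Γ : WeakContinuity) :
    (M.SupPrinciple M.line M.line (fun _ => True) →
      M.SupPrinciple M.line M.line (fun f => Γ.Holds M.line f)) ∧
    (M.SupPrinciple M.line M.line (fun f => Γ.Holds M.line f) →
      M.SupPrinciple M.unitInterval M.unitInterval (fun f => Γ.Holds M.unitInterval f)) ∧
    (M.SupPrinciple M.unitInterval M.unitInterval (fun f => Γ.Holds M.unitInterval f) →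
      M.BOOT₂) ∧
    (M.BOOT₂ → M.Pi12CA) := by
  have : Fact M.Exists2 := ⟨hM⟩
  exact ⟨fun h f hf _ => h f hf trivial, Henkin.supPrinciple_unitInterval Γ,
    Henkin.boot₂_of_supPrinciple Γ, Henkin.pi12CA_of_boot₂⟩
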